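/- Let $n\ge 3$ and let $(M,g)$ be a connected smooth $n$-dimensional Lorentzian manifold (Hausdorff, second countable, signature $(-,+,\dots,+)$) with Levi-Civita connection $\nabla$, and let $K$ be a smooth vector field on $M$ with $g(K,K)<0$ everywhere. Let $\pi:TM\to M$ be the projection, and let $$C_KM=\{v\in TM \mid g(v,v)=0,\ g(v,K_{\pi(v)})=-1\}$$ be the null congruence associated with $K$, an embedded submanifold of $TM$ of dimension $2(n-1)$, endowed with the metric $\widehat g$ induced from the Sasaki metric $\widehat g(\zeta,\xi)=g(d\pi(\zeta),d\pi(\xi))+g(c(\zeta),c(\xi))$ of $TM$, where $c:TTM\to TM$ is the connection map of $\nabla$ (if $\alpha$ is a curve in $TM$ with $\alpha'(0)=\xi$, then $c(\xi)=\frac{\nabla\alpha}{dt}\big|_0$). Let $\widehat\nabla$ be the Levi-Civita connection of $(C_KM,\widehat g)$, and let $\mathcal V$ and $\mathcal H$ be the orthogonal projections of $T(C_KM)$ onto the vertical distribution $\ker d(\pi|_{C_KM})$ and onto its $\widehat g$-orthogonal complement. Let $A$ be the O'Neill fundamental tensor of the semi-Riemannian submersion $\pi|_{C_KM}:(C_KM,\widehat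 g)\to(M,g)$, $$A_{E_1}E_2=\mathcal H\,\widehat\nabla_{\mathcal HE_1}(\mathcal VE_2)+\mathcal V\,\widehat\nabla_{\mathcal HE_1}(\mathcal HE_2),\qquad E_1,E_2\in\mathfrak X(C_KM).$$ Then $A$ vanishes identically if and only if $(M,g)$ is flat, i.e. its Riemann curvature tensor $R(X,Y)Z=\nabla_X\nabla_YZ-\nabla_Y\nabla_XZ-\nabla_{[X,Y]}Z$ vanishes identically. -/

import Mathlib

open scoped Manifold ContDiff Topology

noncomputable section

/-! ### Embedded submanifolds of a manifold without boundary -/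

section Submanifold

variable {V : Type*} [NormedAddCommGroup V] [NormedSpace ℝ V]
  {H : Type*} [TopologicalSpace H] (J : ModelWithCorners ℝ V H)
  {P : Type*} [TopologicalSpace P] [ChartedSpace H P]

/-- A smooth chart of a subset `S` of the manifold `P`, seen as an embedded submanifold of
dimension `k`: a homeomorphism `φ` between an open subset of `S` (with the subspace topology) and
an open subset of `ℝᵏ` whose inverse is smooth as a map into `P`, and which is locally the
restriction to `S` of a smooth map defined on an open subset of `P`. -/
def IsSubmanifoldChart (S : Set P) (k : ℕ)
    (φ : OpenPartialHomeomorph S (EuclideanSpace ℝ (Fin k))) : Prop :=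
  ContMDiffOn (𝓡 k) J ∞ (fun y => (φ.symm y : P)) φ.target ∧
  ∀ s ∈ φ.source, ∃ U : Set P, IsOpen U ∧ (s : P) ∈ U ∧
    ∃ r : P → EuclideanSpace ℝ (Fin k), ContMDiffOn J (𝓡 k) ∞ r U ∧
      ∀ t ∈ φ.source, (t : P) ∈ U → r t = φ t

/-- A subset `S` of `P` is an embedded submanifold of dimension `k` if it is covered by its smooth
charts of dimension `k`. -/
def IsEmbeddedSubmanifold (S : Set P) (k : ℕ) : Prop :=
  ∀ s : S, ∃ φ : OpenPartialHomeomorph S (EuclideanSpace ℝ (Fin k)),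
    IsSubmanifoldChart J S k φ ∧ s ∈ φ.source

variable {J}

/-- The charted space structure of an embedded submanifold: its topology is the subspace topology,
and its atlas consists of all its smooth charts. -/
@[reducible] def IsEmbeddedSubmanifold.chartedSpace {S : Set P} {k : ℕ}
    (hS : IsEmbeddedSubmanifold J S k) : ChartedSpace (EuclideanSpace ℝ (Fin k)) S where
  atlas := {φ | IsSubmanifoldChart J S k φ}
  chartAt s := (hS s).choose
  mem_chart_source s := (hS s).choose_spec.2
  chart_mem_atlas s := (hS s).choose_spec.1

/-- An embedded submanifold is a smooth manifold. -/
theorem IsEmbeddedSubmanifold.isManifold {S : Set P} {k : ℕ}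
    (hS : IsEmbeddedSubmanifold J S k) :
    letI := hS.chartedSpace
    IsManifold (𝓡 k) ∞ S := by
  let := hS.chartedSpace
  apply isManifold_of_contDiffOn
  intro e e' he he'
  have h1 : IsSubmanifoldChart J S k e := he
  have h2 : IsSubmanifoldChart J S k e' := he'
  simp only [modelWithCornersSelf_coe, modelWithCornersSelf_coe_symm, Function.id_comp,
    Function.comp_id, Set.preimage_id, Set.range_id, Set.inter_univ]
  rw [← contMDiffOn_iff_contDiffOn]
  intro y hy
  have hy1 : y ∈ e.target := hy.1
  have hy2 : e.symm y ∈ e'.source := hy.2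
  obtain ⟨U, hU, hyU, r, hr, hre⟩ := h2.2 _ hy2
  have hsm : ContMDiffAt (𝓡 k) J ∞ (fun z => (e.symm z : P)) y :=
    h1.1.contMDiffAt (e.open_target.mem_nhds hy1)
  have hc : ContMDiffAt (𝓡 k) (𝓡 k) ∞ (fun z => r (e.symm z : P)) y :=
    ContMDiffAt.comp (I' := J) y (hr.contMDiffAt (hU.mem_nhds hyU)) hsm
  refine (hc.congr_of_eventuallyEq ?_).contMDiffWithinAt
  have o1 : ∀ᶠ z in 𝓝 y, z ∈ (e.symm ≫ₕ e').source :=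
    (e.symm ≫ₕ e').open_source.mem_nhds hy
  have o2 : ∀ᶠ z in 𝓝 y, (e.symm z : P) ∈ U :=
    hsm.continuousAt.eventually (hU.mem_nhds hyU)
  filter_upwards [o1, o2] with z hz hzU
  exact (hre _ hz.2 hzU).symm

/-- If `D` is a smooth chart of `P` with values in `W × ℝᵏ` in which `S` is the slice
`{c} × ℝᵏ`, then the second component of `D` is a smooth chart of `S`. -/
theorem exists_isSubmanifoldChart_of_slice {W : Type*} [NormedAddCommGroup W] [NormedSpace ℝ W]
    {S : Set P} {k : ℕ} (s : S) (c : W)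
    (D : OpenPartialHomeomorph P (W × EuclideanSpace ℝ (Fin k)))
    (hs : (s : P) ∈ D.source)
    (hD : ContMDiffOn J 𝓘(ℝ, W × EuclideanSpace ℝ (Fin k)) ∞ D D.source)
    (hD' : ContMDiffOn 𝓘(ℝ, W × EuclideanSpace ℝ (Fin k)) J ∞ D.symm D.target)
    (hc : ∀ p ∈ D.source, p ∈ S ↔ (D p).1 = c) :
    ∃ φ : OpenPartialHomeomorph S (EuclideanSpace ℝ (Fin k)),
      IsSubmanifoldChart J S k φ ∧ s ∈ φ.source := by
  classical
  have key : ∀ y, (c, y) ∈ D.target → D.symm (c, y) ∈ S := fun y hy => by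
    rw [hc _ (D.map_target hy), D.right_inv hy]
  let inv : EuclideanSpace ℝ (Fin k) → S := fun y =>
    if hy : (c, y) ∈ D.target then ⟨D.symm (c, y), key y hy⟩ else s
  have hinv : ∀ y, (c, y) ∈ D.target → (inv y : P) = D.symm (c, y) := fun y hy => by
    simp only [inv, dif_pos hy]
  have hpair : ∀ t : S, (t : P) ∈ D.source → (c, (D t).2) = D t := fun t ht =>
    Prod.ext ((hc _ ht).1 t.2).symm rfl
  let φ : OpenPartialHomeomorph S (EuclideanSpace ℝ (Fin k)) :=
    { toFun := fun t => (D t).2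
      invFun := inv
      source := {t | (t : P) ∈ D.source}
      target := {y | (c, y) ∈ D.target}
      map_source' := fun t ht => by
        change (c, (D t).2) ∈ D.target
        rw [hpair t ht]; exact D.map_source ht
      map_target' := fun y hy => by
        change (inv y : P) ∈ D.source
        rw [hinv y hy]; exact D.map_target hy
      left_inv' := fun t ht => by
        have ht' : (c, (D t).2) ∈ D.target := by
          rw [hpair t ht]; exact D.map_source ht
        apply Subtype.ext
        rw [hinv _ ht', hpair t ht]; exact D.left_inv ht
      right_inv' := fun y hy => by
        rw [hinv y hy, D.right_inv hy]
      open_source := D.open_source.preimage continuous_subtype_val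
      open_target := D.open_target.preimage (by fun_prop)
      continuousOn_toFun := by
        exact continuous_snd.comp_continuousOn
          (D.continuousOn.comp continuous_subtype_val.continuousOn fun t ht => ht)
      continuousOn_invFun := by
        rw [Topology.IsInducing.subtypeVal.continuousOn_iff]
        refine ContinuousOn.congr (f := fun y => D.symm (c, y)) ?_ fun y hy => hinv y hy
        exact D.continuousOn_symm.comp (by fun_prop) fun y hy => hy }
  refine ⟨φ, ⟨?_, ?_⟩, hs⟩
  · have : ContMDiffOn (𝓡 k) J ∞ (fun y => D.symm (c, y)) {y | (c, y) ∈ D.target} := by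
      refine hD'.comp (ContMDiff.contMDiffOn ?_) fun y hy => hy
      rw [contMDiff_iff_contDiff]
      fun_prop
    exact this.congr fun y hy => hinv y hy
  · intro t ht
    refine ⟨D.source, D.open_source, ht, fun p => (D p).2, ?_, fun _ _ _ => rfl⟩
    exact (contDiff_snd.contMDiff).comp_contMDiffOn hD

/-- Regular level sets are embedded submanifolds. -/
theorem isEmbeddedSubmanifold_of_regular [FiniteDimensional ℝ V] [J.Boundaryless]
    [IsManifold J ∞ P] {W : Type*} [NormedAddCommGroup W] [NormedSpace ℝ W]
    [FiniteDimensional ℝ W] {F : P → W} (hF : ContMDiff J 𝓘(ℝ, W) ∞ F) (c : W) {k : ℕ}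
    (hk : ∀ p, F p = c → Module.finrank ℝ V = Module.finrank ℝ W + k)
    (hreg : ∀ p, F p = c → Function.Surjective (mfderiv J 𝓘(ℝ, W) F p)) :
    IsEmbeddedSubmanifold J {p | F p = c} k := by
  intro s
  have hs : F s = c := s.2
  have : CompleteSpace V := FiniteDimensional.complete ℝ V
  let e : OpenPartialHomeomorph P V := (chartAt H (s : P)).transHomeomorph J.toHomeomorph
  have he : ContMDiffOn J 𝓘(ℝ, V) ∞ e e.source := contMDiffOn_extChartAt (x := (s : P))
  have he' : ContMDiffOn 𝓘(ℝ, V) J ∞ e.symm e.target := by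
    have := contMDiffOn_extChartAt_symm (I := J) (n := ∞) (s : P)
    refine this.mono ?_
    intro y hy
    simpa [e, extChartAt, J.range_eq_univ] using hy
  have hse : (s : P) ∈ e.source := mem_chart_source H (s : P)
  let x0 := e s
  have hx0 : x0 ∈ e.target := e.map_source hse
  let f : V → W := fun x => F (e.symm x)
  have hf : ContDiffOn ℝ ∞ f e.target := by
    rw [← contMDiffOn_iff_contDiffOn]
    exact hF.comp_contMDiffOn he'
  have hfs : Function.Surjective (fderiv ℝ f x0) := by
    have hfd : MDifferentiableAt 𝓘(ℝ, V) 𝓘(ℝ, W) f x0 :=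
      ((hf.contDiffAt (e.open_target.mem_nhds hx0)).differentiableAt (by simp)).mdifferentiableAt
    have hed : MDifferentiableAt J 𝓘(ℝ, V) e s :=
      (he.contMDiffAt (e.open_source.mem_nhds hse)).mdifferentiableAt (by simp)
    have hcomp : mfderiv J 𝓘(ℝ, W) F s
        = (mfderiv 𝓘(ℝ, V) 𝓘(ℝ, W) f x0).comp (mfderiv J 𝓘(ℝ, V) e s) := by
      rw [← mfderiv_comp (s : P) hfd hed]
      apply Filter.EventuallyEq.mfderiv_eq
      filter_upwards [e.open_source.mem_nhds hse] with p hp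
      simp [f, e.left_inv hp]
    intro w
    obtain ⟨ξ, hξ⟩ := hreg s hs w
    refine ⟨mfderiv J 𝓘(ℝ, V) e s ξ, ?_⟩
    rw [← mfderiv_eq_fderiv]
    rw [hcomp] at hξ
    exact hξ
  -- a linear complement to the derivative
  set f' : V →L[ℝ] W := fderiv ℝ f x0 with hf'
  have hdim : Module.finrank ℝ (f' : V →ₗ[ℝ] W).ker = k := by
    have h1 := LinearMap.finrank_range_add_finrank_ker (f' : V →ₗ[ℝ] W)
    have h2 : (f' : V →ₗ[ℝ] W).range = ⊤ := LinearMap.range_eq_top.2 hfs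
    rw [h2, finrank_top, hk s hs] at h1
    omega
  obtain ⟨q, hq⟩ := Submodule.exists_isCompl (f' : V →ₗ[ℝ] W).ker
  let L0 : (f' : V →ₗ[ℝ] W).ker ≃ₗ[ℝ] EuclideanSpace ℝ (Fin k) :=
    LinearEquiv.ofFinrankEq _ _ (by rw [hdim]; simp)
  let L : V →L[ℝ] EuclideanSpace ℝ (Fin k) :=
    LinearMap.toContinuousLinearMap
      ((L0 : _ →ₗ[ℝ] _).comp (Submodule.projectionOnto _ q hq))
  have hLr : (L : V →ₗ[ℝ] EuclideanSpace ℝ (Fin k)).range = ⊤ := by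
    rw [LinearMap.range_eq_top]
    intro y
    refine ⟨(L0.symm y : V), ?_⟩
    simp [L, Submodule.projectionOnto_apply_left]
  have hLk : (L : V →ₗ[ℝ] EuclideanSpace ℝ (Fin k)).ker = q := by
    ext x
    simp [L]
  let E : V ≃L[ℝ] W × EuclideanSpace ℝ (Fin k) :=
    ContinuousLinearMap.equivProdOfSurjectiveOfIsCompl f' L
      (LinearMap.range_eq_top.2 hfs) hLr (by rw [hLk]; exact hq)
  let Φ : V → W × EuclideanSpace ℝ (Fin k) := fun x => (f x, L x)
  have hΦ : ContDiffOn ℝ ∞ Φ e.target := hf.prodMk L.contDiff.contDiffOn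
  have hΦ0 : HasFDerivAt Φ (E : V →L[ℝ] W × EuclideanSpace ℝ (Fin k)) x0 := by
    have h1 : HasFDerivAt f f' x0 :=
      ((hf.contDiffAt (e.open_target.mem_nhds hx0)).differentiableAt (by simp)).hasFDerivAt
    exact h1.prodMk L.hasFDerivAt
  have hΦat : ContDiffAt ℝ ∞ Φ x0 := hΦ.contDiffAt (e.open_target.mem_nhds hx0)
  let G0 := hΦat.toOpenPartialHomeomorph Φ hΦ0 (by simp)
  have hG0 : x0 ∈ G0.source := hΦat.mem_toOpenPartialHomeomorph_source hΦ0 (by simp)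
  let O : Set V := e.target ∩ fderiv ℝ Φ ⁻¹'
    (Set.range fun T : V ≃L[ℝ] W × EuclideanSpace ℝ (Fin k) =>
      (T : V →L[ℝ] W × EuclideanSpace ℝ (Fin k)))
  have hO : IsOpen O :=
    (hΦ.continuousOn_fderiv_of_isOpen e.open_target (by simp)).isOpen_inter_preimage
      e.open_target ContinuousLinearEquiv.isOpen
  have hx0O : x0 ∈ O := ⟨hx0, E, hΦ0.fderiv.symm⟩
  let G := G0.restrOpen O hO
  have hGΦ : ∀ x, G x = Φ x := fun _ => rfl
  have hGsub : G.source ⊆ O := fun x hx => hx.2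
  have hGsymm : ContDiffOn ℝ ∞ G.symm G.target := by
    intro y hy
    have hyO : G.symm y ∈ O := hGsub (G.map_target hy)
    obtain ⟨T, hT⟩ := hyO.2
    have hat : ContDiffAt ℝ ∞ Φ (G.symm y) := hΦ.contDiffAt (e.open_target.mem_nhds hyO.1)
    have hd : HasFDerivAt G (T : V →L[ℝ] W × EuclideanSpace ℝ (Fin k)) (G.symm y) := by
      have := (hat.differentiableAt (by simp)).hasFDerivAt
      rw [← hT] at this
      exact this
    exact (G.contDiffAt_symm hy hd hat).contDiffWithinAt
  let D : OpenPartialHomeomorph P (W × EuclideanSpace ℝ (Fin k)) := e ≫ₕ G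
  refine exists_isSubmanifoldChart_of_slice s c D ⟨hse, hG0, hx0O⟩ ?_ ?_ ?_
  · have hG : ContMDiffOn 𝓘(ℝ, V) 𝓘(ℝ, W × EuclideanSpace ℝ (Fin k)) ∞ G G.source :=
      contMDiffOn_iff_contDiffOn.2 (hΦ.mono fun x hx => (hGsub hx).1)
    exact hG.comp (he.mono fun p hp => hp.1) fun p hp => hp.2
  · exact he'.comp ((contMDiffOn_iff_contDiffOn.2 hGsymm).mono fun y hy => hy.1)
      fun y hy => hy.2
  · intro p hp
    change F p = c ↔ F (e.symm (e p)) = c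
    rw [e.left_inv hp.1]

end Submanifold

/-! ### Geometry of a manifold with a nondegenerate metric -/

section Metric

variable {V : Type*} [NormedAddCommGroup V] [NormedSpace ℝ V]
  {H : Type*} [TopologicalSpace H] (I : ModelWithCorners ℝ V H)
  {N : Type*} [TopologicalSpace N] [ChartedSpace H N] [IsManifold I ∞ N]

/-- Smooth vector fields on `N`, i.e. the elements of `𝔛(N)`. -/
def IsSmoothField (X : ∀ x : N, TangentSpace I x) : Prop :=
  ContMDiff I I.tangent ∞ (fun x => (⟨x, X x⟩ : TangentBundle I N))

/-- The right-hand side of the Koszul formula of the metric tensor `h` at the point `x`: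
`X h(Y,Z) + Y h(Z,X) - Z h(X,Y) - h(X,[Y,Z]) + h(Y,[Z,X]) + h(Z,[X,Y])`. -/
def koszul (h : ∀ x : N, TangentSpace I x → TangentSpace I x → ℝ)
    (X Y Z : ∀ x : N, TangentSpace I x) (x : N) : ℝ :=
  mvfderiv I (fun y => h y (Y y) (Z y)) x (X x)
    + mvfderiv I (fun y => h y (Z y) (X y)) x (Y x)
    - mvfderiv I (fun y => h y (X y) (Y y)) x (Z x)
    - h x (X x) (VectorField.mlieBracket I Y Z x)
    + h x (Y x) (VectorField.mlieBracket I Z X x)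
    + h x (Z x) (VectorField.mlieBracket I X Y x)

/-- The Levi-Civita connection `∇_X Y` of the (smooth, symmetric, nondegenerate) metric tensor `h`:
`(∇_X Y)(x)` is the unique tangent vector `w` with `2 h(w, Z) = koszul(X, Y, Z)` at `x`
for all smooth vector fields `Z`. -/
def leviCivita (h : ∀ x : N, TangentSpace I x → TangentSpace I x → ℝ)
    (X Y : ∀ x : N, TangentSpace I x) (x : N) : TangentSpace I x :=
  Classical.epsilon fun w : TangentSpace I x =>
    ∀ Z : ∀ x : N, TangentSpace I x, IsSmoothField I Z →
      2 * h x w (Z x) = koszul I h X Y Z x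

/-- The curvature tensor `R(X,Y)Z = ∇_X ∇_Y Z - ∇_Y ∇_X Z - ∇_[X,Y] Z` of the metric tensor `h`. -/
def curvature (h : ∀ x : N, TangentSpace I x → TangentSpace I x → ℝ)
    (X Y Z : ∀ x : N, TangentSpace I x) (x : N) : TangentSpace I x :=
  leviCivita I h X (leviCivita I h Y Z) x - leviCivita I h Y (leviCivita I h X Z) x
    - leviCivita I h (VectorField.mlieBracket I X Y) Z x

/-- The metric tensor `h` is flat if its curvature tensor vanishes. -/
def IsFlatMetric (h : ∀ x : N, TangentSpace I x → TangentSpace I x → ℝ) : Prop :=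
  ∀ X Y Z : ∀ x : N, TangentSpace I x,
    IsSmoothField I X → IsSmoothField I Y → IsSmoothField I Z →
      ∀ x, curvature I h X Y Z x = 0

variable {V' : Type*} [NormedAddCommGroup V'] [NormedSpace ℝ V']
  {H' : Type*} [TopologicalSpace H'] (I' : ModelWithCorners ℝ V' H')
  {B : Type*} [TopologicalSpace B] [ChartedSpace H' B]

/-- The vertical space of the submersion `π : N → B` at `x`: the tangent space of the fibre
through `x`, i.e. the kernel of `dπ`. -/
def verticalSpace (π : N → B) (x : N) : Set (TangentSpace I x) :=
  {w | mfderiv I I' π x w = 0}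

/-- The vertical part of a tangent vector `ξ` of `N`: the unique vertical vector `w` such
that `ξ - w` is horizontal, i.e. orthogonal to the vertical space. -/
def verticalPart (h : ∀ x : N, TangentSpace I x → TangentSpace I x → ℝ) (π : N → B) (x : N)
    (ξ : TangentSpace I x) : TangentSpace I x :=
  Classical.epsilon fun w : TangentSpace I x =>
    w ∈ verticalSpace I I' π x ∧ ∀ u ∈ verticalSpace I I' π x, h x (ξ - w) u = 0

/-- The horizontal part of a tangent vector `ξ` of `N`. -/
def horizontalPart (h : ∀ x : N, TangentSpace I x → TangentSpace I x → ℝ) (π : N → B) (x : N)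
    (ξ : TangentSpace I x) : TangentSpace I x :=
  ξ - verticalPart I I' h π x ξ

/-- O'Neill's fundamental tensor `A` of the semi-Riemannian submersion `π : (N, h) → B`:
`A_{E₁} E₂ = 𝓗 ∇_{𝓗 E₁} (𝓥 E₂) + 𝓥 ∇_{𝓗 E₁} (𝓗 E₂)`. -/
def oneillA (h : ∀ x : N, TangentSpace I x → TangentSpace I x → ℝ) (π : N → B)
    (E₁ E₂ : ∀ x : N, TangentSpace I x) (x : N) : TangentSpace I x :=
  horizontalPart I I' h π x
      (leviCivita I h (fun y => horizontalPart I I' h π y (E₁ y))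
        (fun y => verticalPart I I' h π y (E₂ y)) x)
    + verticalPart I I' h π x
      (leviCivita I h (fun y => horizontalPart I I' h π y (E₁ y))
        (fun y => horizontalPart I I' h π y (E₂ y)) x)

end Metric

/-! ### Lorentzian manifolds, the Sasaki metric and the null congruence -/

section Lorentz

variable {n : ℕ} {M : Type*} [TopologicalSpace M] [ChartedSpace (EuclideanSpace ℝ (Fin n)) M]
  [IsManifold (𝓡 n) ∞ M]

variable (n M) in
/-- A Lorentzian metric on `M`: a smooth symmetric `(0,2)`-tensor field of signature `(-,+,…,+)`,
i.e. every tangent space contains a vector `u` with `g(u,u) < 0` whose orthogonal complement is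
positive definite. -/
structure LorentzMetric where
  /-- the metric tensor -/
  val : ∀ x : M, TangentSpace (𝓡 n) x →L[ℝ] TangentSpace (𝓡 n) x →L[ℝ] ℝ
  symm : ∀ x u v, val x u v = val x v u
  signature : ∀ x, ∃ u, val x u u < 0 ∧ ∀ w, val x u w = 0 → w ≠ 0 → 0 < val x w w
  contMDiff : ContMDiff (𝓡 n)
    ((𝓡 n).prod 𝓘(ℝ, EuclideanSpace ℝ (Fin n) →L[ℝ] EuclideanSpace ℝ (Fin n) →L[ℝ] ℝ)) ∞
    (fun x => Bundle.TotalSpace.mk'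
      (EuclideanSpace ℝ (Fin n) →L[ℝ] EuclideanSpace ℝ (Fin n) →L[ℝ] ℝ) x (val x))

/-- The metric tensor as a family of functions of two tangent vectors. -/
def LorentzMetric.tensor (g : LorentzMetric n M) (x : M)
    (u v : TangentSpace (𝓡 n) x) : ℝ := g.val x u v

/-- A (smooth) timelike vector field on the Lorentzian manifold `(M, g)`. -/
structure TimelikeField (g : LorentzMetric n M) where
  /-- the vector field -/
  val : ∀ x : M, TangentSpace (𝓡 n) x
  smooth : IsSmoothField (𝓡 n) val
  timelike : ∀ x, g.val x (val x) (val x) < 0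

/-- The connection map `c : TTM → TM` of the Levi-Civita connection `∇` of `g`. If `α` is a curve
in `TM` with `α(0) = v` and `α'(0) = ξ`, then `c(ξ)` is the covariant derivative at `0` of the
vector field `α` along the curve `π ∘ α`. It is the unique vector satisfying the product rule
`d/dt g(α, Z) = g(c(ξ), Z) + g(v, ∇_{ξ⋆} Z)` for all vector fields `Z` on `M`; here the left-hand
side is the derivative in the direction `ξ` of the function `u ↦ g(u, Z)` on `TM`, and
`ξ⋆ = dπ(ξ)` is extended to a vector field `X` on `M`. -/
def connector (g : LorentzMetric n M) (v : TangentBundle (𝓡 n) M)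
    (ξ : TangentSpace (𝓡 n).tangent v) : TangentSpace (𝓡 n) v.proj :=
  Classical.epsilon fun w : TangentSpace (𝓡 n) v.proj =>
    ∀ X Z : ∀ x : M, TangentSpace (𝓡 n) x,
      IsSmoothField (𝓡 n) X → IsSmoothField (𝓡 n) Z →
      X v.proj = mfderiv (𝓡 n).tangent (𝓡 n)
        (fun u : TangentBundle (𝓡 n) M => u.proj) v ξ →
      mvfderiv (𝓡 n).tangent (fun u : TangentBundle (𝓡 n) M => g.val u.proj u.2 (Z u.proj)) v ξ
        = g.val v.proj w (Z v.proj) + g.val v.proj v.2 (leviCivita (𝓡 n) g.tensor X Z v.proj)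

/-- The Sasaki metric `ĝ(ζ, ξ) = g(ζ⋆, ξ⋆) + g(c(ζ), c(ξ))` on `TM`. -/
def sasaki (g : LorentzMetric n M) (v : TangentBundle (𝓡 n) M)
    (ζ ξ : TangentSpace (𝓡 n).tangent v) : ℝ :=
  g.val v.proj
      (mfderiv (𝓡 n).tangent (𝓡 n) (fun u : TangentBundle (𝓡 n) M => u.proj) v ζ)
      (mfderiv (𝓡 n).tangent (𝓡 n) (fun u : TangentBundle (𝓡 n) M => u.proj) v ξ)
    + g.val v.proj (connector g v ζ) (connector g v ξ)

/-- The null congruence `C_K M = {v ∈ TM | g(v,v) = 0, g(v,K) = -1}`. -/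
def nullCongruence (g : LorentzMetric n M) (K : TimelikeField g) : Set (TangentBundle (𝓡 n) M) :=
  {v | g.val v.proj v.2 v.2 = 0 ∧ g.val v.proj v.2 (K.val v.proj) = -1}

/-- The map `v ↦ (g(v,v), g(v,K))` on `TM`, of which the null congruence is a level set. -/
def congruenceMap (g : LorentzMetric n M) (K : TimelikeField g) (v : TangentBundle (𝓡 n) M) :
    ℝ × ℝ :=
  (g.val v.proj v.2 v.2, g.val v.proj v.2 (K.val v.proj))

theorem LorentzMetric.contMDiff_pairing (g : LorentzMetric n M)
    {a b : ∀ v : TangentBundle (𝓡 n) M, TangentSpace (𝓡 n) v.proj}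
    (ha : ContMDiff (𝓡 n).tangent (𝓡 n).tangent ∞
      (fun v : TangentBundle (𝓡 n) M => (⟨v.proj, a v⟩ : TangentBundle (𝓡 n) M)))
    (hb : ContMDiff (𝓡 n).tangent (𝓡 n).tangent ∞
      (fun v : TangentBundle (𝓡 n) M => (⟨v.proj, b v⟩ : TangentBundle (𝓡 n) M))) :
    ContMDiff (𝓡 n).tangent 𝓘(ℝ, ℝ) ∞
      (fun v : TangentBundle (𝓡 n) M => g.val v.proj (a v) (b v)) := by
  have hπ : ContMDiff (𝓡 n).tangent (𝓡 n) ∞ (fun v : TangentBundle (𝓡 n) M => v.proj) :=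
    Bundle.contMDiff_proj _
  have : ContMDiff (𝓡 n).tangent ((𝓡 n).prod 𝓘(ℝ)) ∞
      (fun v : TangentBundle (𝓡 n) M => Bundle.TotalSpace.mk' ℝ (E := Bundle.Trivial M ℝ) v.proj
        (g.val v.proj (a v) (b v))) :=
    ContMDiff.clm_bundle_apply₂ (F₁ := EuclideanSpace ℝ (Fin n))
      (F₂ := EuclideanSpace ℝ (Fin n)) (g.contMDiff.comp hπ) ha hb
  intro v
  exact (Bundle.contMDiffAt_totalSpace.1 (this v)).2

theorem contMDiff_congruenceMap (g : LorentzMetric n M) (K : TimelikeField g) :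
    ContMDiff (𝓡 n).tangent 𝓘(ℝ, ℝ × ℝ) ∞ (congruenceMap g K) := by
  have hπ : ContMDiff (𝓡 n).tangent (𝓡 n) ∞ (fun v : TangentBundle (𝓡 n) M => v.proj) :=
    Bundle.contMDiff_proj _
  exact (g.contMDiff_pairing (a := fun v => v.2) (b := fun v => v.2) contMDiff_id
    contMDiff_id).prodMk_space
    (g.contMDiff_pairing (a := fun v => v.2) (b := fun v => K.val v.proj) contMDiff_id
      (K.smooth.comp hπ))

/-- The differential of `congruenceMap` at `v` maps the vertical lift of `u` to
`(2 g(v,u), g(u,K))`. -/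
theorem exists_mfderiv_congruenceMap (g : LorentzMetric n M) (K : TimelikeField g)
    (v : TangentBundle (𝓡 n) M) (u : TangentSpace (𝓡 n) v.proj) :
    ∃ ξ, mfderiv (𝓡 n).tangent 𝓘(ℝ, ℝ × ℝ) (congruenceMap g K) v ξ
      = (2 * g.val v.proj v.2 u, g.val v.proj u (K.val v.proj)) := by
  let γ : ℝ → TangentBundle (𝓡 n) M := fun t => ⟨v.proj, v.2 + t • u⟩
  have hγ0 : γ 0 = v := by simp [γ]
  have hγ : ContMDiffAt 𝓘(ℝ, ℝ) (𝓡 n).tangent ∞ γ 0 := by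
    refine Bundle.contMDiffAt_totalSpace.2 ⟨contMDiffAt_const, ?_⟩
    let e := trivializationAt (EuclideanSpace ℝ (Fin n)) (TangentSpace (𝓡 n) : M → Type _) v.proj
    have hv : v.proj ∈ e.baseSet := FiberBundle.mem_baseSet_trivializationAt' v.proj
    have : (fun t => (e (γ t)).2) = fun t => e.linearMapAt ℝ v.proj v.2
        + t • e.linearMapAt ℝ v.proj u := by
      funext t
      rw [← map_smul, ← map_add, e.coe_linearMapAt_of_mem hv]
    change ContMDiffAt 𝓘(ℝ, ℝ) 𝓘(ℝ, EuclideanSpace ℝ (Fin n)) ∞ (fun t => (e (γ t)).2) 0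
    rw [this, contMDiffAt_iff_contDiffAt]
    fun_prop
  have h1 : MDifferentiableAt 𝓘(ℝ, ℝ) (𝓡 n).tangent γ 0 := hγ.mdifferentiableAt (by simp)
  have h2 : MDifferentiableAt (𝓡 n).tangent 𝓘(ℝ, ℝ × ℝ) (congruenceMap g K) (γ 0) :=
    (contMDiff_congruenceMap g K).mdifferentiableAt (by simp)
  have hcomp := mfderiv_comp (0 : ℝ) h2 h1
  have hd : HasFDerivAt (congruenceMap g K ∘ γ) (ContinuousLinearMap.toSpanSingleton ℝ
      ((2 * g.val v.proj v.2 u, g.val v.proj u (K.val v.proj)) : ℝ × ℝ)) 0 := by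
    have hfun : congruenceMap g K ∘ γ = fun t =>
        (g.val v.proj v.2 v.2 + t * (2 * g.val v.proj v.2 u) + t ^ 2 * g.val v.proj u u,
          g.val v.proj v.2 (K.val v.proj) + t * g.val v.proj u (K.val v.proj)) := by
      funext t
      simp only [Function.comp_apply, congruenceMap, γ, map_add, map_smul,
        add_apply, smul_apply, smul_eq_mul]
      rw [g.symm v.proj u v.2]
      congr 1
      ring
    rw [hfun]
    apply HasDerivAt.hasFDerivAt
    refine HasDerivAt.prodMk ?_ ?_
    · have := (((hasDerivAt_id (0 : ℝ)).mul_const (2 * g.val v.proj v.2 u)).const_add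
        (g.val v.proj v.2 v.2)).add (((hasDerivAt_id (0 : ℝ)).pow 2).mul_const (g.val v.proj u u))
      convert! this using 1
      simp
    · have := ((hasDerivAt_id (0 : ℝ)).mul_const (g.val v.proj u (K.val v.proj))).const_add
        (g.val v.proj v.2 (K.val v.proj))
      convert! this using 1
      simp
  have hev := congrArg (fun T => T (1 : ℝ)) hcomp
  rw [mfderiv_eq_fderiv, hd.fderiv] at hev
  have hgen : ∃ ξ, mfderiv (𝓡 n).tangent 𝓘(ℝ, ℝ × ℝ) (congruenceMap g K) (γ 0) ξ
      = (2 * g.val v.proj v.2 u, g.val v.proj u (K.val v.proj)) := by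
    refine ⟨mfderiv 𝓘(ℝ, ℝ) (𝓡 n).tangent γ 0 (1 : ℝ), ?_⟩
    exact hev.symm.trans (one_smul ℝ _)
  rw [hγ0] at hgen
  exact hgen

/-- The null congruence is an embedded submanifold of `TM` of dimension `2(n-1)`. -/
theorem isEmbeddedSubmanifold_nullCongruence (g : LorentzMetric n M) (K : TimelikeField g) :
    IsEmbeddedSubmanifold (𝓡 n).tangent (nullCongruence g K) (2 * (n - 1)) := by
  have hset : nullCongruence g K = {v | congruenceMap g K v = (0, -1)} := by
    ext v
    simp [nullCongruence, congruenceMap]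
  rw [hset]
  refine isEmbeddedSubmanifold_of_regular (contMDiff_congruenceMap g K) (0, -1) ?_ ?_
  · intro v hv
    have hn : n ≠ 0 := by
      rintro rfl
      have h0 : v.2 = 0 := Subsingleton.elim (α := EuclideanSpace ℝ (Fin 0)) _ _
      have := congrArg Prod.snd hv
      simp [congruenceMap, h0] at this
    simp only [Module.finrank_prod, finrank_euclideanSpace, Fintype.card_fin,
      Module.finrank_self]
    omega
  · intro v hv w
    have hvv : g.val v.proj v.2 v.2 = 0 := congrArg Prod.fst hv
    have hvK : g.val v.proj v.2 (K.val v.proj) = -1 := congrArg Prod.snd hv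
    obtain ⟨ξ, hξ⟩ := exists_mfderiv_congruenceMap g K v
      ((-(w.1 / 2)) • K.val v.proj
        + (-w.2 - w.1 / 2 * g.val v.proj (K.val v.proj) (K.val v.proj)) • v.2)
    refine ⟨ξ, hξ.trans ?_⟩
    simp only [map_add, map_smul, add_apply, smul_apply,
      smul_eq_mul, hvv, hvK]
    refine Prod.ext ?_ ?_
    · ring
    · ring

/-- The smooth structure of the null congruence as an embedded submanifold of `TM`. -/
instance (g : LorentzMetric n M) (K : TimelikeField g) :
    ChartedSpace (EuclideanSpace ℝ (Fin (2 * (n - 1)))) (nullCongruence g K) :=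
  (isEmbeddedSubmanifold_nullCongruence g K).chartedSpace

instance (g : LorentzMetric n M) (K : TimelikeField g) :
    IsManifold (𝓡 (2 * (n - 1))) ∞ (nullCongruence g K) :=
  (isEmbeddedSubmanifold_nullCongruence g K).isManifold

/-- The metric on the null congruence induced from the Sasaki metric of `TM`. -/
def congruenceMetric (g : LorentzMetric n M) (K : TimelikeField g) (v : nullCongruence g K)
    (ζ ξ : TangentSpace (𝓡 (2 * (n - 1))) v) : ℝ :=
  sasaki g v
    (mfderiv (𝓡 (2 * (n - 1))) (𝓡 n).tangent (Subtype.val : nullCongruence g K → _) v ζ)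
    (mfderiv (𝓡 (2 * (n - 1))) (𝓡 n).tangent (Subtype.val : nullCongruence g K → _) v ξ)

/-- The projection `π|_{C_K M} : C_K M → M`. -/
def congruenceProj (g : LorentzMetric n M) (K : TimelikeField g) (v : nullCongruence g K) : M :=
  (v : TangentBundle (𝓡 n) M).proj

end Lorentz

end

/-! Write c for the connection map. Differentiating g(v,v) = 0 and g(v,K) = -1 shows that the
vectors tangent to the congruence at v, with projection a and connection part w, are exactly those
with g(w,v) = 0 and g(w,K) = -g(v,∇_a K) (`exists_tangent`). Vertical vectors are those with a = 0.
Their connection parts fill the complement of {v,K}, which is positive definite because K is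
timelike. A horizontal vector ξ therefore has c(ξ) = λ(ξ) v with λ(ξ) = g(v,∇_{dπ(ξ)} K)
(`conn_of_horizontal`). As v is orthogonal to all connection parts, the induced metric on horizontal
vectors is that of the base (`metricC_of_horizontal`).

For horizontal X, Y and vertical u the Koszul formula collapses to 2ĝ(∇_X Y,u) = ĝ([X,Y],u)
(`koszulCoord_horizontal`). Differentiating c(X) = λ(X) v gives c([X,Y]) = μ v - R(dπX,dπY)v
(`exists_conn_bracket`). If R = 0, brackets of horizontal fields are horizontal, and both summands
of A vanish, the one on vertical fields by metric compatibility (`oneill_eq_zero`). If A = 0, then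
R(a,b)v is orthogonal to the complement of {v,K} and to v, hence is a multiple of v
(`exists_curvature_eq_smul`).

So every normalized null vector is an eigenvector of every operator R(a,b). In dimension at least
three this makes R(a,b) a homothety (`exists_eq_smul_of_null_eigenvectors`), and the first Bianchi
identity then forces R = 0 (`eq_zero_of_homothety_of_cyclic`).

The geometry is carried out in coordinates, on a `CongruenceChart`. The remaining work identifies
the Levi-Civita connection, the connection map and the vertical projection, all defined by choice
from a characterizing property, with their coordinate formulas. -/

noncomputable section

/-! ### Vector fields, derivatives and Lie brackets in a chart. -/

section ChartCalculus

variable {V : Type*} [NormedAddCommGroup V] [NormedSpace ℝ V]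
  {N : Type*} [TopologicalSpace N] [ChartedSpace V N]

/-- The differential at `x` of the preferred chart at `x₀`. -/
def dchart (x₀ x : N) : TangentSpace 𝓘(ℝ, V) x →L[ℝ] V :=
  mvfderiv 𝓘(ℝ, V) (chartAt V x₀) x

/-- A vector field read in the preferred chart at `x₀`. -/
def coordField (x₀ : N) (X : ∀ x : N, TangentSpace 𝓘(ℝ, V) x) (z : V) : V :=
  dchart x₀ ((chartAt V x₀).symm z) (X ((chartAt V x₀).symm z))

theorem two_le_infty : (2 : WithTop ℕ∞) ≤ ∞ := ENat.LEInfty.out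

theorem mlieBracket_self_model {X Y : ∀ z : V, TangentSpace 𝓘(ℝ, V) z} (z : V) :
    VectorField.mlieBracket 𝓘(ℝ, V) X Y z = VectorField.lieBracket ℝ X Y z := by
  rw [← VectorField.mlieBracketWithin_univ, VectorField.mlieBracketWithin_eq_lieBracketWithin]
  exact congrFun (VectorField.lieBracketWithin_univ (𝕜 := ℝ) (V := X) (W := Y)) z

theorem coordField_chartAt {x₀ x : N} (hx : x ∈ (chartAt V x₀).source)
    (X : ∀ x : N, TangentSpace 𝓘(ℝ, V) x) :
    coordField x₀ X (chartAt V x₀ x) = dchart x₀ x (X x) := by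
  simp only [coordField]
  rw [(chartAt V x₀).left_inv hx]

variable [IsManifold 𝓘(ℝ, V) ∞ N]

theorem contMDiffOn_chartAt_self (x₀ : N) :
    ContMDiffOn 𝓘(ℝ, V) 𝓘(ℝ, V) ∞ (chartAt V x₀) (chartAt V x₀).source :=
  contMDiffOn_chart

theorem contMDiffOn_chartAt_symm_self (x₀ : N) :
    ContMDiffOn 𝓘(ℝ, V) 𝓘(ℝ, V) ∞ (chartAt V x₀).symm (chartAt V x₀).target :=
  contMDiffOn_chart_symm

theorem mdifferentiable_chartAt (x₀ : N) :
    (chartAt V x₀).MDifferentiable 𝓘(ℝ, V) 𝓘(ℝ, V) :=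
  have : IsManifold 𝓘(ℝ, V) 1 N := IsManifold.of_le (n := ∞) (by simp)
  mdifferentiable_chart x₀

theorem dchart_bijective {x₀ x : N} (hx : x ∈ (chartAt V x₀).source) :
    Function.Bijective (dchart (V := V) x₀ x) :=
  (mdifferentiable_chartAt x₀).mfderiv_bijective hx

theorem trivializationAt_snd {x₀ x : N} (hx : x ∈ (chartAt V x₀).source)
    (w : TangentSpace 𝓘(ℝ, V) x) :
    (trivializationAt V (TangentSpace 𝓘(ℝ, V)) x₀ ⟨x, w⟩).2 = dchart x₀ x w := by
  have : IsManifold 𝓘(ℝ, V) 1 N := IsManifold.of_le (n := ∞) (by simp)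
  have h := TangentBundle.continuousLinearMapAt_trivializationAt (I := 𝓘(ℝ, V)) (x₀ := x₀) hx
  have h2 := congrArg (fun T => T w) h
  refine Eq.trans ?_ h2
  exact (congrFun (Bundle.Trivialization.coe_linearMapAt_of_mem (R := ℝ)
    (trivializationAt V (TangentSpace 𝓘(ℝ, V)) x₀) (b := x) (by simpa using hx)) w).symm

/-- Derivatives of functions in the preferred chart. -/
theorem mvfderiv_eq_fderiv_chart {F : Type*} [NormedAddCommGroup F] [NormedSpace ℝ F]
    {x₀ x : N} (hx : x ∈ (chartAt V x₀).source) {f : N → F}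
    (hf : DifferentiableAt ℝ (f ∘ (chartAt V x₀).symm) (chartAt V x₀ x))
    (w : TangentSpace 𝓘(ℝ, V) x) :
    mvfderiv 𝓘(ℝ, V) f x w
      = fderiv ℝ (f ∘ (chartAt V x₀).symm) (chartAt V x₀ x) (dchart x₀ x w) := by
  have h1 : MDifferentiableAt 𝓘(ℝ, V) 𝓘(ℝ, V) (chartAt V x₀) x :=
    (mdifferentiable_chartAt x₀).mdifferentiableAt hx
  have h2 : MDifferentiableAt 𝓘(ℝ, V) 𝓘(ℝ, F) (f ∘ (chartAt V x₀).symm) (chartAt V x₀ x) :=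
    hf.mdifferentiableAt
  have h3 : mfderiv 𝓘(ℝ, V) 𝓘(ℝ, F) f x
      = mfderiv 𝓘(ℝ, V) 𝓘(ℝ, F) ((f ∘ (chartAt V x₀).symm) ∘ chartAt V x₀) x := by
    apply Filter.EventuallyEq.mfderiv_eq
    filter_upwards [(chartAt V x₀).open_source.mem_nhds hx] with y hy
    simp [(chartAt V x₀).left_inv hy]
  rw [mfderiv_comp x h2 h1, mfderiv_eq_fderiv] at h3
  exact congrArg (fun T => T w) h3

theorem IsSmoothField.contDiffOn_coordField {X : ∀ x : N, TangentSpace 𝓘(ℝ, V) x}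
    (hX : IsSmoothField 𝓘(ℝ, V) X) (x₀ : N) :
    ContDiffOn ℝ ∞ (coordField x₀ X) (chartAt V x₀).target := by
  have h1 := (Bundle.Trivialization.contMDiffOn_section_iff (n := ∞) (IB := 𝓘(ℝ, V))
    (trivializationAt V (TangentSpace 𝓘(ℝ, V)) x₀) (s := X) (chartAt V x₀).open_source
    (by simp)).1 hX.contMDiffOn
  have h2 := h1.comp (contMDiffOn_chartAt_symm_self x₀) fun z hz => (chartAt V x₀).map_target hz
  refine (contMDiffOn_iff_contDiffOn.1 h2).congr fun z hz => ?_
  exact (trivializationAt_snd ((chartAt V x₀).map_target hz) _).symm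

theorem mdifferentiableAt_of_coordField {X : ∀ x : N, TangentSpace 𝓘(ℝ, V) x} {x₀ x : N}
    (hx : x ∈ (chartAt V x₀).source)
    (hX : DifferentiableAt ℝ (coordField x₀ X) (chartAt V x₀ x)) :
    MDifferentiableAt 𝓘(ℝ, V) 𝓘(ℝ, V).tangent
      (fun x => (⟨x, X x⟩ : TangentBundle 𝓘(ℝ, V) N)) x := by
  have : IsManifold 𝓘(ℝ, V) 2 N := IsManifold.of_le (n := ∞) two_le_infty
  have : ContMDiffVectorBundle 1 V (TangentSpace 𝓘(ℝ, V) : N → Type _) 𝓘(ℝ, V) :=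
    TangentBundle.contMDiffVectorBundle (n := 1) (h := by simpa [one_add_one_eq_two])
  refine (Bundle.Trivialization.mdifferentiableAt_section_iff 𝓘(ℝ, V)
    (trivializationAt V (TangentSpace 𝓘(ℝ, V)) x₀) X (by simpa using hx)).2 ?_
  have h1 : MDifferentiableAt 𝓘(ℝ, V) 𝓘(ℝ, V) (chartAt V x₀) x :=
    (mdifferentiable_chartAt x₀).mdifferentiableAt hx
  refine (hX.mdifferentiableAt.comp x h1).congr_of_eventuallyEq ?_
  filter_upwards [(chartAt V x₀).open_source.mem_nhds hx] with y hy
  rw [trivializationAt_snd hy, ← coordField_chartAt hy]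
  rfl

/-- The Lie bracket in the preferred chart. -/
theorem dchart_mlieBracket [CompleteSpace V] {X Y : ∀ x : N, TangentSpace 𝓘(ℝ, V) x} {x₀ x : N}
    (hx : x ∈ (chartAt V x₀).source)
    (hX : DifferentiableAt ℝ (coordField x₀ X) (chartAt V x₀ x))
    (hY : DifferentiableAt ℝ (coordField x₀ Y) (chartAt V x₀ x)) :
    dchart x₀ x (VectorField.mlieBracket 𝓘(ℝ, V) X Y x)
      = fderiv ℝ (coordField x₀ Y) (chartAt V x₀ x) (coordField x₀ X (chartAt V x₀ x))
        - fderiv ℝ (coordField x₀ X) (chartAt V x₀ x) (coordField x₀ Y (chartAt V x₀ x)) := by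
  have : IsManifold 𝓘(ℝ, V) (minSmoothness ℝ 2) N :=
    IsManifold.of_le (n := ∞) (by simpa using two_le_infty)
  have hz := (chartAt V x₀).map_source hx
  -- Pulling back along the inverse chart applies the inverse of its differential, which is the
  -- differential of the chart; so the pullback is the coordinate expression of the field.
  have hinv : ∀ z ∈ (chartAt V x₀).target, ∀ Z : ∀ x : N, TangentSpace 𝓘(ℝ, V) x,
      VectorField.mpullback 𝓘(ℝ, V) 𝓘(ℝ, V) (chartAt V x₀).symm Z z = coordField x₀ Z z := by
    intro z hz Z
    have h1 := (mdifferentiable_chartAt x₀).comp_symm_deriv hz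
    have h2 := (mdifferentiable_chartAt x₀).symm_comp_deriv ((chartAt V x₀).map_target hz)
    rw [(chartAt V x₀).right_inv hz] at h2
    rw [VectorField.mpullback_apply, ContinuousLinearMap.inverse_eq h2 h1]
    rfl
  have hev : ∀ Z : ∀ x : N, TangentSpace 𝓘(ℝ, V) x,
      VectorField.mpullback 𝓘(ℝ, V) 𝓘(ℝ, V) (chartAt V x₀).symm Z
        =ᶠ[𝓝 (chartAt V x₀ x)] coordField x₀ Z := by
    intro Z
    filter_upwards [(chartAt V x₀).open_target.mem_nhds hz] with z hz using hinv z hz Z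
  have hxx := (chartAt V x₀).left_inv hx
  have key := VectorField.mpullback_mlieBracket (I := 𝓘(ℝ, V)) (I' := 𝓘(ℝ, V)) (n := ∞)
    (f := (chartAt V x₀).symm) (V := X) (W := Y) (x₀ := chartAt V x₀ x)
    (by rw [hxx]; exact mdifferentiableAt_of_coordField hx hX)
    (by rw [hxx]; exact mdifferentiableAt_of_coordField hx hY)
    ((contMDiffOn_chartAt_symm_self x₀).contMDiffAt ((chartAt V x₀).open_target.mem_nhds hz))
    (by simpa using two_le_infty)
  rw [hinv _ hz, coordField_chartAt hx] at key
  rw [key, Filter.EventuallyEq.mlieBracket_vectorField_eq (hev X) (hev Y)]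
  exact mlieBracket_self_model _

/-- Every tangent vector extends to a smooth vector field. -/
theorem exists_isSmoothField [FiniteDimensional ℝ V] [T2Space N] (x₀ : N)
    (w : TangentSpace 𝓘(ℝ, V) x₀) :
    ∃ Z : ∀ x : N, TangentSpace 𝓘(ℝ, V) x, IsSmoothField 𝓘(ℝ, V) Z ∧ Z x₀ = w := by
  let t := trivializationAt V (TangentSpace 𝓘(ℝ, V)) x₀
  let c : V := dchart x₀ x₀ w
  let s : ∀ x : N, TangentSpace 𝓘(ℝ, V) x := fun x => t.symm x c
  have hx₀ : x₀ ∈ (chartAt V x₀).source := mem_chart_source V x₀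
  have hs : ContMDiffOn 𝓘(ℝ, V) 𝓘(ℝ, V).tangent ∞
      (fun x => (⟨x, s x⟩ : TangentBundle 𝓘(ℝ, V) N)) (chartAt V x₀).source := by
    refine (Bundle.Trivialization.contMDiffOn_section_iff (n := ∞) (IB := 𝓘(ℝ, V)) t (s := s)
      (chartAt V x₀).open_source (by simp [t])).2 ?_
    refine (contMDiffOn_const (c := c)).congr fun x hx => ?_
    exact congrArg Prod.snd (t.apply_mk_symm (by simpa [t] using hx) c)
  -- The field with constant components near x₀ is cut off by a bump function. Hausdorffness of the
  -- manifold is what allows the extension by zero.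
  let f : SmoothBumpFunction 𝓘(ℝ, V) x₀ := Classical.arbitrary _
  refine ⟨fun x => f x • s x, ?_, ?_⟩
  · exact ContMDiffOn.smul_section_of_tsupport f.contMDiff.contMDiffOn
      (chartAt V x₀).open_source f.tsupport_subset_chartAt_source hs
  · have h1 : f x₀ = 1 := f.eq_one
    have h2 : dchart x₀ x₀ (s x₀) = dchart x₀ x₀ w := by
      rw [← trivializationAt_snd hx₀]
      exact congrArg Prod.snd (t.apply_mk_symm (by simp [t]) c)
    simp only [h1, one_smul]
    exact (dchart_bijective hx₀).1 h2

end ChartCalculus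

/-! ### The Koszul formula on a vector space. -/

section CoordinateKoszul

variable {V : Type*} [NormedAddCommGroup V] [NormedSpace ℝ V]

/-- The right-hand side of the Koszul formula of a metric on a vector space, as a linear form in
its last argument. -/
def koszulCoord (h : V → V →L[ℝ] V →L[ℝ] ℝ) (X Y : V → V) (z : V) : V →L[ℝ] ℝ :=
  fderiv ℝ h z (X z) (Y z) + (fderiv ℝ h z (Y z)).flip (X z)
    - ((fderiv ℝ h z).flip (X z)).flip (Y z) + (2 : ℝ) • h z (fderiv ℝ Y z (X z))

theorem koszulCoord_apply (h : V → V →L[ℝ] V →L[ℝ] ℝ) (X Y : V → V) (z ζ : V) :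
    koszulCoord h X Y z ζ = fderiv ℝ h z (X z) (Y z) ζ + fderiv ℝ h z (Y z) ζ (X z)
      - fderiv ℝ h z ζ (X z) (Y z) + 2 * h z (fderiv ℝ Y z (X z)) ζ := by
  simp [koszulCoord]

/-- The parameter space E is kept separate from V because the rule is also needed along a map into
V: for the projection of the congruence, and for functions on the tangent bundle. -/
theorem fderiv_metric_apply {E : Type*} [NormedAddCommGroup E] [NormedSpace ℝ E]
    {h : E → V →L[ℝ] V →L[ℝ] ℝ} {X Y : E → V} {z : E}
    (hh : DifferentiableAt ℝ h z) (hX : DifferentiableAt ℝ X z) (hY : DifferentiableAt ℝ Y z)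
    (ζ : E) :
    fderiv ℝ (fun z => h z (X z) (Y z)) z ζ
      = fderiv ℝ h z ζ (X z) (Y z) + h z (fderiv ℝ X z ζ) (Y z) + h z (X z) (fderiv ℝ Y z ζ) := by
  have h1 : DifferentiableAt ℝ (fun z => h z (X z)) z := hh.clm_apply hX
  rw [fderiv_clm_apply h1 hY, fderiv_clm_apply hh hX]
  simp only [add_apply, ContinuousLinearMap.comp_apply, ContinuousLinearMap.flip_apply]
  ring

/-- The Koszul formula in terms of derivatives of scalar products. -/
theorem koszulCoord_eq {h : V → V →L[ℝ] V →L[ℝ] ℝ} {X Y Z : V → V} {z : V}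
    (hh : DifferentiableAt ℝ h z) (hsymm : ∀ a b, h z a b = h z b a)
    (hX : DifferentiableAt ℝ X z) (hY : DifferentiableAt ℝ Y z) (hZ : DifferentiableAt ℝ Z z) :
    koszulCoord h X Y z (Z z) =
      fderiv ℝ (fun z => h z (Y z) (Z z)) z (X z) + fderiv ℝ (fun z => h z (Z z) (X z)) z (Y z)
        - fderiv ℝ (fun z => h z (X z) (Y z)) z (Z z)
        - h z (X z) (fderiv ℝ Z z (Y z) - fderiv ℝ Y z (Z z))
        + h z (Y z) (fderiv ℝ X z (Z z) - fderiv ℝ Z z (X z))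
        + h z (Z z) (fderiv ℝ Y z (X z) - fderiv ℝ X z (Y z)) := by
  rw [koszulCoord_apply, fderiv_metric_apply hh hY hZ, fderiv_metric_apply hh hZ hX,
    fderiv_metric_apply hh hX hY]
  simp only [map_sub]
  rw [hsymm (Z z) (fderiv ℝ Y z (X z)), hsymm (Z z) (fderiv ℝ X z (Y z)),
    hsymm (X z) (fderiv ℝ Z z (Y z)), hsymm (Y z) (fderiv ℝ X z (Z z))]
  ring

/-- A nondegenerate bilinear form on a finite-dimensional space represents every linear form. -/
theorem exists_represents [FiniteDimensional ℝ V] {b : V →L[ℝ] V →L[ℝ] ℝ}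
    (hb : ∀ a, (∀ c, b a c = 0) → a = 0) (l : V →L[ℝ] ℝ) : ∃ a, b a = l := by
  let T : V →ₗ[ℝ] Module.Dual ℝ V :=
    { toFun := fun a => (b a : V →ₗ[ℝ] ℝ)
      map_add' := fun x y => by ext; simp
      map_smul' := fun r x => by ext; simp }
  have hinj : Function.Injective T := by
    rw [injective_iff_map_eq_zero]
    exact fun a ha => hb a fun c => congrArg (fun L => L c) ha
  have hsurj : Function.Surjective T :=
    (LinearMap.injective_iff_surjective_of_finrank_eq_finrank
      (Subspace.dual_finrank_eq (K := ℝ) (V := V)).symm).1 hinj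
  obtain ⟨a, ha⟩ := hsurj (l : V →ₗ[ℝ] ℝ)
  exact ⟨a, ContinuousLinearMap.ext fun c => congrArg (fun L => L c) ha⟩

end CoordinateKoszul

/-! ### The Levi-Civita connection in a chart. -/

section LeviCivitaChart

variable {V : Type*} [NormedAddCommGroup V] [NormedSpace ℝ V]
  {N : Type*} [TopologicalSpace N] [ChartedSpace V N]

/-- The function `hc` represents the metric tensor `h` near `x` in the preferred chart at `x₀`,
and is there a differentiable nondegenerate metric. -/
structure IsMetricInChart (h : ∀ x : N, TangentSpace 𝓘(ℝ, V) x → TangentSpace 𝓘(ℝ, V) x → ℝ)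
    (hc : V → V →L[ℝ] V →L[ℝ] ℝ) (x₀ x : N) : Prop where
  mem_source : x ∈ (chartAt V x₀).source
  eq : ∀ᶠ y in 𝓝 x, ∀ ξ η, h y ξ η = hc (chartAt V x₀ y) (dchart x₀ y ξ) (dchart x₀ y η)
  symm : ∀ a b, hc (chartAt V x₀ x) a b = hc (chartAt V x₀ x) b a
  nondegenerate : ∀ a, (∀ b, hc (chartAt V x₀ x) a b = 0) → a = 0
  differentiableAt : DifferentiableAt ℝ hc (chartAt V x₀ x)

variable [IsManifold 𝓘(ℝ, V) ∞ N]
  {h : ∀ x : N, TangentSpace 𝓘(ℝ, V) x → TangentSpace 𝓘(ℝ, V) x → ℝ}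
  {hc : V → V →L[ℝ] V →L[ℝ] ℝ} {x₀ x : N}
  {X Y Z : ∀ x : N, TangentSpace 𝓘(ℝ, V) x}

omit [IsManifold 𝓘(ℝ, V) ∞ N] in
theorem IsMetricInChart.comp_symm_eventuallyEq (H : IsMetricInChart h hc x₀ x)
    (Y Z : ∀ x : N, TangentSpace 𝓘(ℝ, V) x) :
    (fun y => h y (Y y) (Z y)) ∘ (chartAt V x₀).symm =ᶠ[𝓝 (chartAt V x₀ x)]
      fun z => hc z (coordField x₀ Y z) (coordField x₀ Z z) := by
  have hz := (chartAt V x₀).map_source H.mem_source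
  have hcont := (chartAt V x₀).continuousAt_symm hz
  rw [ContinuousAt, (chartAt V x₀).left_inv H.mem_source] at hcont
  filter_upwards [hcont.eventually H.eq, (chartAt V x₀).open_target.mem_nhds hz] with z h1 h2
  simp only [Function.comp_apply, coordField]
  rw [h1, (chartAt V x₀).right_inv h2]

theorem IsMetricInChart.mvfderiv_eq (H : IsMetricInChart h hc x₀ x)
    (hY : DifferentiableAt ℝ (coordField x₀ Y) (chartAt V x₀ x))
    (hZ : DifferentiableAt ℝ (coordField x₀ Z) (chartAt V x₀ x)) (w : TangentSpace 𝓘(ℝ, V) x) :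
    mvfderiv 𝓘(ℝ, V) (fun y => h y (Y y) (Z y)) x w
      = fderiv ℝ (fun z => hc z (coordField x₀ Y z) (coordField x₀ Z z)) (chartAt V x₀ x)
          (dchart x₀ x w) := by
  have hd : DifferentiableAt ℝ (fun z => hc z (coordField x₀ Y z) (coordField x₀ Z z))
      (chartAt V x₀ x) := (H.differentiableAt.clm_apply hY).clm_apply hZ
  have hev := H.comp_symm_eventuallyEq Y Z
  rw [mvfderiv_eq_fderiv_chart H.mem_source (hd.congr_of_eventuallyEq hev), hev.fderiv_eq]

theorem IsMetricInChart.koszul_eq [CompleteSpace V] (H : IsMetricInChart h hc x₀ x)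
    (hX : DifferentiableAt ℝ (coordField x₀ X) (chartAt V x₀ x))
    (hY : DifferentiableAt ℝ (coordField x₀ Y) (chartAt V x₀ x))
    (hZ : DifferentiableAt ℝ (coordField x₀ Z) (chartAt V x₀ x)) :
    koszul 𝓘(ℝ, V) h X Y Z x
      = koszulCoord hc (coordField x₀ X) (coordField x₀ Y) (chartAt V x₀ x)
          (dchart x₀ x (Z x)) := by
  have hx := H.mem_source
  have e := H.eq.self_of_nhds
  rw [koszul, H.mvfderiv_eq hY hZ, H.mvfderiv_eq hZ hX, H.mvfderiv_eq hX hY, e, e, e,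
    dchart_mlieBracket hx hY hZ, dchart_mlieBracket hx hZ hX, dchart_mlieBracket hx hX hY]
  simp only [← coordField_chartAt hx]
  rw [koszulCoord_eq H.differentiableAt H.symm hX hY hZ]

/-- The Levi-Civita connection in a chart is characterized by the Koszul formula. -/
theorem IsMetricInChart.leviCivita_eq [FiniteDimensional ℝ V] [T2Space N]
    (H : IsMetricInChart h hc x₀ x)
    (hX : DifferentiableAt ℝ (coordField x₀ X) (chartAt V x₀ x))
    (hY : DifferentiableAt ℝ (coordField x₀ Y) (chartAt V x₀ x)) (ζ : V) :
    2 * hc (chartAt V x₀ x) (dchart x₀ x (leviCivita 𝓘(ℝ, V) h X Y x)) ζ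
      = koszulCoord hc (coordField x₀ X) (coordField x₀ Y) (chartAt V x₀ x) ζ := by
  have : CompleteSpace V := FiniteDimensional.complete ℝ V
  have hx := H.mem_source
  have hdiff : ∀ Z : ∀ x : N, TangentSpace 𝓘(ℝ, V) x, IsSmoothField 𝓘(ℝ, V) Z →
      DifferentiableAt ℝ (coordField x₀ Z) (chartAt V x₀ x) := fun Z hZ =>
    ((hZ.contDiffOn_coordField x₀).contDiffAt ((chartAt V x₀).open_target.mem_nhds
      ((chartAt V x₀).map_source hx))).differentiableAt (by simp)
  -- Nondegeneracy provides a vector satisfying the Koszul formula, so the chosen vector satisfies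
  -- it too.
  have hex : ∃ w : TangentSpace 𝓘(ℝ, V) x, ∀ Z : ∀ x : N, TangentSpace 𝓘(ℝ, V) x,
      IsSmoothField 𝓘(ℝ, V) Z → 2 * h x w (Z x) = koszul 𝓘(ℝ, V) h X Y Z x := by
    obtain ⟨a, ha⟩ := exists_represents H.nondegenerate
      ((2⁻¹ : ℝ) • koszulCoord hc (coordField x₀ X) (coordField x₀ Y) (chartAt V x₀ x))
    obtain ⟨w, rfl⟩ := (dchart_bijective hx).2 a
    refine ⟨w, fun Z hZ => ?_⟩
    rw [H.koszul_eq hX hY (hdiff Z hZ), H.eq.self_of_nhds, ha]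
    simp
  have hspec := Classical.epsilon_spec hex
  -- Each coordinate vector is the value of a smooth field, so testing against smooth fields tests
  -- against all vectors.
  obtain ⟨w, rfl⟩ := (dchart_bijective hx).2 ζ
  obtain ⟨Z, hZ, rfl⟩ := exists_isSmoothField x w
  have := hspec Z hZ
  rw [H.koszul_eq hX hY (hdiff Z hZ), H.eq.self_of_nhds] at this
  exact this

end LeviCivitaChart

/-! ### Christoffel symbols and curvature in coordinates. -/

section Christoffel

variable {V : Type*} [NormedAddCommGroup V] [NormedSpace ℝ V]

/-- A smooth pseudo-Riemannian metric on an open subset of a vector space. -/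
structure IsMetricOn (G : V → V →L[ℝ] V →L[ℝ] ℝ) (U : Set V) : Prop where
  isOpen : IsOpen U
  contDiffOn : ContDiffOn ℝ ∞ G U
  symm : ∀ z ∈ U, ∀ a b, G z a b = G z b a
  nondegenerate : ∀ z ∈ U, ∀ a, (∀ b, G z a b = 0) → a = 0

/-- The Christoffel symbol of a metric, as a bilinear form with values in linear forms. -/
def christoffelForm (G : V → V →L[ℝ] V →L[ℝ] ℝ) (z a b : V) : V →L[ℝ] ℝ :=
  (2⁻¹ : ℝ) • (fderiv ℝ G z a b + (fderiv ℝ G z b).flip a - ((fderiv ℝ G z).flip a).flip b)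

variable [FiniteDimensional ℝ V]

/-- The Christoffel symbol of a metric on a vector space. -/
def christoffel (G : V → V →L[ℝ] V →L[ℝ] ℝ) (z : V) : V →L[ℝ] V →L[ℝ] V :=
  LinearMap.toContinuousBilinearMap
    (LinearMap.mk₂ ℝ (fun a b => (G z).inverse (christoffelForm G z a b))
      (fun a a' b => by rw [← map_add]; congr 1; ext c; simp [christoffelForm]; ring)
      (fun r a b => by rw [← map_smul]; congr 1; ext c; simp [christoffelForm]; ring)
      (fun a b b' => by rw [← map_add]; congr 1; ext c; simp [christoffelForm]; ring)
      (fun r a b => by rw [← map_smul]; congr 1; ext c; simp [christoffelForm]; ring))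

theorem christoffel_apply (G : V → V →L[ℝ] V →L[ℝ] ℝ) (z a b : V) :
    christoffel G z a b = (G z).inverse (christoffelForm G z a b) := rfl

namespace IsMetricOn

variable {G : V → V →L[ℝ] V →L[ℝ] ℝ} {U : Set V} (hG : IsMetricOn G U)
include hG

/-- `ContinuousLinearMap.inverse` takes a default value at maps that are not invertible. On U the
metric is invertible, so `christoffel` has its intended meaning there. -/
theorem exists_equiv {z : V} (hz : z ∈ U) :
    ∃ T : V ≃L[ℝ] (V →L[ℝ] ℝ), (T : V →L[ℝ] (V →L[ℝ] ℝ)) = G z := by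
  have hinj : Function.Injective (G z) := by
    rw [injective_iff_map_eq_zero]
    exact fun a ha => hG.nondegenerate z hz a fun c => congrArg (fun L => L c) ha
  have hsurj : Function.Surjective (G z) := fun l => exists_represents (hG.nondegenerate z hz) l
  have := FiniteDimensional.complete ℝ V
  exact ⟨(LinearEquiv.ofBijective (G z : V →ₗ[ℝ] (V →L[ℝ] ℝ)) ⟨hinj, hsurj⟩).toContinuousLinearEquiv,
    rfl⟩

theorem apply_christoffel {z : V} (hz : z ∈ U) (a b c : V) :
    2 * G z (christoffel G z a b) c
      = fderiv ℝ G z a b c + fderiv ℝ G z b c a - fderiv ℝ G z c a b := by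
  obtain ⟨T, hT⟩ := hG.exists_equiv hz
  have h1 : G z (christoffel G z a b) = christoffelForm G z a b := by
    rw [christoffel_apply, ← hT, ContinuousLinearMap.inverse_equiv]
    exact T.apply_symm_apply _
  rw [h1]
  simp [christoffelForm]

omit [FiniteDimensional ℝ V] in
theorem contDiffOn_fderiv_apply (a b c : V) :
    ContDiffOn ℝ ∞ (fun z => fderiv ℝ G z a b c) U := by
  have h := hG.contDiffOn.fderiv_of_isOpen hG.isOpen (m := ∞) (by simp)
  exact ((h.clm_apply contDiffOn_const).clm_apply contDiffOn_const).clm_apply contDiffOn_const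

/-- Inversion of linear maps is smooth at invertible ones, and the Christoffel forms are
combinations of first derivatives of G. -/
theorem contDiffOn_christoffel : ContDiffOn ℝ ∞ (christoffel G) U := by
  have := FiniteDimensional.complete ℝ V
  refine contDiffOn_clm_apply.2 fun a => contDiffOn_clm_apply.2 fun b => ?_
  simp only [christoffel_apply]
  refine ContDiffOn.clm_apply ?_ ?_
  · intro z hz
    obtain ⟨T, hT⟩ := hG.exists_equiv hz
    have h1 : ContDiffAt ℝ ∞ ContinuousLinearMap.inverse (G z) := by
      rw [← hT]; exact contDiffAt_map_inverse T
    exact h1.comp_contDiffWithinAt z (hG.contDiffOn z hz)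
  · refine contDiffOn_clm_apply.2 fun c => ?_
    have := (((hG.contDiffOn_fderiv_apply a b c).add (hG.contDiffOn_fderiv_apply b c a)).sub
      (hG.contDiffOn_fderiv_apply c a b)).const_smul (2⁻¹ : ℝ)
    exact this.congr fun z _ => by simp [christoffelForm]

omit [FiniteDimensional ℝ V] in
theorem fderiv_symm {z : V} (hz : z ∈ U) (a b c : V) :
    fderiv ℝ G z a b c = fderiv ℝ G z a c b := by
  have hd : DifferentiableAt ℝ G z :=
    (hG.contDiffOn.contDiffAt (hG.isOpen.mem_nhds hz)).differentiableAt (by simp)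
  have h1 := fderiv_metric_apply hd (differentiableAt_const b) (differentiableAt_const c) a
  have h2 := fderiv_metric_apply hd (differentiableAt_const c) (differentiableAt_const b) a
  have h3 : (fun z => G z b c) =ᶠ[𝓝 z] fun z => G z c b := by
    filter_upwards [hG.isOpen.mem_nhds hz] with y hy using hG.symm y hy b c
  rw [h3.fderiv_eq, h2] at h1
  simpa using h1.symm

omit [FiniteDimensional ℝ V] in
theorem ext {z : V} (hz : z ∈ U) {a b : V} (h : ∀ c, G z a c = G z b c) : a = b := by
  rw [← sub_eq_zero]
  exact hG.nondegenerate z hz _ fun c => by simp [h c]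

theorem christoffel_symm {z : V} (hz : z ∈ U) (a b : V) :
    christoffel G z a b = christoffel G z b a := by
  refine hG.ext hz fun c => ?_
  have h1 := hG.apply_christoffel hz a b c
  have h2 := hG.apply_christoffel hz b a c
  rw [hG.fderiv_symm hz b c a, hG.fderiv_symm hz c a b] at h1
  rw [hG.fderiv_symm hz a c b] at h2
  linarith

/-- The Levi-Civita connection is metric. -/
theorem fderiv_eq {z : V} (hz : z ∈ U) (a b c : V) :
    fderiv ℝ G z a b c = G z (christoffel G z a b) c + G z b (christoffel G z a c) := by
  have h1 := hG.apply_christoffel hz a b c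
  have h2 := hG.apply_christoffel hz a c b
  rw [hG.symm z hz b]
  rw [hG.fderiv_symm hz b c a] at h1
  rw [hG.fderiv_symm hz a c b, hG.fderiv_symm hz c b a] at h2
  linarith

/-- By nondegeneracy this identifies the covariant derivative of Y along X as DY(X) + Γ(X,Y) in
coordinates. -/
theorem koszulCoord_eq {z : V} (hz : z ∈ U) (X Y : V → V) (ζ : V) :
    koszulCoord G X Y z ζ
      = 2 * G z (fderiv ℝ Y z (X z) + christoffel G z (X z) (Y z)) ζ := by
  rw [koszulCoord_apply, map_add, add_apply, mul_add,
    hG.apply_christoffel hz]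
  ring

end IsMetricOn

/-- The curvature of the connection with Christoffel symbol `Γ` on a vector space. -/
def curvatureCoord (Γ : V → V →L[ℝ] V →L[ℝ] V) (z a b c : V) : V :=
  fderiv ℝ Γ z a b c - fderiv ℝ Γ z b a c + Γ z a (Γ z b c) - Γ z b (Γ z a c)

omit [FiniteDimensional ℝ V] in
/-- The curvature of vector fields in coordinates. -/
theorem curvatureCoord_fields {Γ : V → V →L[ℝ] V →L[ℝ] V} {X Y Z : V → V} {z : V}
    (hΓ : DifferentiableAt ℝ Γ z)
    (hX : DifferentiableAt ℝ X z) (hY : DifferentiableAt ℝ Y z)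
    (hZ : ContDiffAt ℝ ∞ Z z) :
    (fderiv ℝ (fun y => fderiv ℝ Z y (Y y) + Γ y (Y y) (Z y)) z (X z)
        + Γ z (X z) (fderiv ℝ Z z (Y z) + Γ z (Y z) (Z z)))
      - (fderiv ℝ (fun y => fderiv ℝ Z y (X y) + Γ y (X y) (Z y)) z (Y z)
        + Γ z (Y z) (fderiv ℝ Z z (X z) + Γ z (X z) (Z z)))
      - (fderiv ℝ Z z (fderiv ℝ Y z (X z) - fderiv ℝ X z (Y z))
        + Γ z (fderiv ℝ Y z (X z) - fderiv ℝ X z (Y z)) (Z z))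
      = curvatureCoord Γ z (X z) (Y z) (Z z) := by
  have hZ1 : DifferentiableAt ℝ Z z := hZ.differentiableAt (by simp)
  have hZ2 : DifferentiableAt ℝ (fderiv ℝ Z) z :=
    (hZ.fderiv_right (m := 1) (by simpa [one_add_one_eq_two] using two_le_infty)).differentiableAt
      (by simp)
  have hsymm : ∀ a b, fderiv ℝ (fderiv ℝ Z) z a b = fderiv ℝ (fderiv ℝ Z) z b a := fun a b =>
    (hZ.isSymmSndFDerivAt (by simpa using two_le_infty)) a b
  -- One of the two iterated derivatives. In their difference the second derivatives of Z cancel by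
  -- symmetry, and the derivatives of X and Y are absorbed by the bracket term.
  have key : ∀ {X Y : V → V}, DifferentiableAt ℝ X z → DifferentiableAt ℝ Y z →
      fderiv ℝ (fun y => fderiv ℝ Z y (Y y) + Γ y (Y y) (Z y)) z (X z)
        = fderiv ℝ (fderiv ℝ Z) z (X z) (Y z) + fderiv ℝ Z z (fderiv ℝ Y z (X z))
          + (fderiv ℝ Γ z (X z) (Y z) (Z z) + Γ z (fderiv ℝ Y z (X z)) (Z z)
            + Γ z (Y z) (fderiv ℝ Z z (X z))) := by
    intro X Y hX hY
    have h1 : DifferentiableAt ℝ (fun y => Γ y (Y y)) z := hΓ.clm_apply hY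
    rw [fderiv_fun_add (hZ2.clm_apply hY) (h1.clm_apply hZ1), fderiv_clm_apply hZ2 hY,
      fderiv_clm_apply h1 hZ1, fderiv_clm_apply hΓ hY]
    simp only [add_apply, ContinuousLinearMap.comp_apply,
      ContinuousLinearMap.flip_apply]
    abel
  rw [key hX hY, key hY hX, hsymm (Y z) (X z), curvatureCoord]
  simp only [map_sub, map_add, sub_apply]
  abel

omit [FiniteDimensional ℝ V] in
/-- The first Bianchi identity. -/
theorem curvatureCoord_cyclic {Γ : V → V →L[ℝ] V →L[ℝ] V} {U : Set V} (hU : IsOpen U)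
    (hΓ : ContDiffOn ℝ ∞ Γ U) (hs : ∀ z ∈ U, ∀ a b, Γ z a b = Γ z b a) {z : V} (hz : z ∈ U)
    (a b c : V) :
    curvatureCoord Γ z a b c + curvatureCoord Γ z b c a + curvatureCoord Γ z c a b = 0 := by
  have hd : DifferentiableAt ℝ Γ z :=
    (hΓ.contDiffAt (hU.mem_nhds hz)).differentiableAt (by simp)
  -- Torsion-freeness holds on a neighbourhood, so it may be differentiated; afterwards the terms of
  -- the cyclic sum cancel in pairs.
  have hsymm : ∀ x a b : V, fderiv ℝ Γ z x a b = fderiv ℝ Γ z x b a := by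
    intro x a b
    have h3 : (fun z => Γ z a b) =ᶠ[𝓝 z] fun z => Γ z b a := by
      filter_upwards [hU.mem_nhds hz] with y hy using hs y hy a b
    have h4 := h3.fderiv_eq (𝕜 := ℝ)
    have key : ∀ a b : V, fderiv ℝ (fun z => Γ z a b) z x = fderiv ℝ Γ z x a b := by
      intro a b
      rw [fderiv_clm_apply (hd.clm_apply (differentiableAt_const a)) (differentiableAt_const b),
        fderiv_clm_apply hd (differentiableAt_const a)]
      simp
    rw [← key, ← key, h4]
  simp only [curvatureCoord]
  rw [hsymm a b c, hsymm b c a, hsymm c a b, hs z hz b c, hs z hz c a, hs z hz a b]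
  abel

end Christoffel

/-! ### Linear algebra: operators for which null vectors are eigenvectors. -/

section NullEigenvectors

variable {V : Type*} [NormedAddCommGroup V] [NormedSpace ℝ V] [FiniteDimensional ℝ V]

/-- A linear map to ℝ² from a space of dimension at least three has a kernel. This supplies two
orthogonal spacelike directions in the complement of k. -/
theorem exists_ne_zero_of_two_forms (hn : 3 ≤ Module.finrank ℝ V) (f g : V →L[ℝ] ℝ) :
    ∃ u : V, u ≠ 0 ∧ f u = 0 ∧ g u = 0 := by
  have h := LinearMap.ker_ne_bot_of_finrank_lt
    (f := (f : V →ₗ[ℝ] ℝ).prod (g : V →ₗ[ℝ] ℝ)) (by simp; omega)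
  obtain ⟨u, hu, hu0⟩ := (Submodule.ne_bot_iff _).1 h
  have hu' : ((f u, g u) : ℝ × ℝ) = 0 := hu
  exact ⟨u, hu0, congrArg Prod.fst hu', congrArg Prod.snd hu'⟩

variable {b : V →L[ℝ] V →L[ℝ] ℝ} {k : V}

omit [FiniteDimensional ℝ V] in
theorem exists_smul_norm_eq {u : V} (hu : 0 < b u u) {α : ℝ} (hα : 0 < α) :
    ∃ r : ℝ, r ≠ 0 ∧ b (r • u) (r • u) = α := by
  refine ⟨√(α / b u u), (Real.sqrt_pos.2 (div_pos hα hu)).ne', ?_⟩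
  have h := Real.mul_self_sqrt (div_pos hα hu).le
  simp only [map_smul, smul_apply, smul_eq_mul]
  rw [← mul_assoc, h, div_mul_cancel₀ _ hu.ne']

/-- In a Lorentzian vector space of dimension at least three, a linear map for which every
null vector is an eigenvector is a homothety. -/
theorem exists_eq_smul_of_null_eigenvectors (hn : 3 ≤ Module.finrank ℝ V)
    (hsymm : ∀ x y, b x y = b y x) (hk : b k k < 0)
    (hpos : ∀ w, b k w = 0 → w ≠ 0 → 0 < b w w) (T : V →ₗ[ℝ] V)
    (hT : ∀ v, b v v = 0 → b v k = -1 → ∃ μ : ℝ, T v = μ • v) :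
    ∃ μ : ℝ, ∀ v, T v = μ • v := by
  -- With this α one has b(αk,k) = -1 and b(αk,αk) = -α, so for u orthogonal to k with b(u,u) = α
  -- both αk + u and αk - u are null and normalized.
  set α : ℝ := -(b k k)⁻¹ with hα
  have hα0 : 0 < α := by rw [hα, neg_pos]; exact inv_lt_zero.2 hk
  have hαk : α * b k k = -1 := by rw [hα, neg_mul, inv_mul_cancel₀ hk.ne]
  have hsphere : ∀ u, b k u = 0 → b u u = α →
      ∃ p q : ℝ, T k = p • k + q • u ∧ T u = (α ^ 2 * q) • k + p • u := by
    intro u hu hu2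
    have hu' : b u k = 0 := by rw [hsymm, hu]
    obtain ⟨μ, hμ⟩ := hT (α • k + u)
      (by simp [hu, hu', hu2]; linear_combination α * hαk) (by simp [hu', hαk])
    obtain ⟨ν, hν⟩ := hT (α • k - u)
      (by simp [hu, hu', hu2]; linear_combination α * hαk) (by simp [hu', hαk])
    -- These coefficients come from adding and subtracting the eigenvalue equations, with
    -- eigenvalues μ and ν, of αk + u and αk - u.
    refine ⟨(μ + ν) / 2, (μ - ν) / (2 * α), ?_, ?_⟩
    · have h1 : (2 * α) • T k = (μ • (α • k + u)) + ν • (α • k - u) := by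
        rw [← hμ, ← hν, map_add, map_sub, map_smul]; module
      have h2 : T k = (2 * α)⁻¹ • ((2 * α) • T k) := by
        rw [smul_smul, inv_mul_cancel₀ (by positivity), one_smul]
      rw [h2, h1]
      match_scalars <;> field_simp
      ring
    · have h1 : (2 : ℝ) • T u = (μ • (α • k + u)) - ν • (α • k - u) := by
        rw [← hμ, ← hν, map_add, map_sub, map_smul]; module
      have h2 : T u = (2 : ℝ)⁻¹ • ((2 : ℝ) • T u) := by
        rw [smul_smul, inv_mul_cancel₀ (by positivity), one_smul]
      rw [h2, h1]
      match_scalars <;> field_simp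
      ring
  obtain ⟨u₁, hu₁, hk₁, -⟩ := exists_ne_zero_of_two_forms hn (b k) (b k)
  obtain ⟨u₂, hu₂, hk₂, h₁₂⟩ := exists_ne_zero_of_two_forms hn (b k) (b u₁)
  obtain ⟨r₁, -, hr₁⟩ := exists_smul_norm_eq (hpos u₁ hk₁ hu₁) hα0
  obtain ⟨r₂, -, hr₂⟩ := exists_smul_norm_eq (hpos u₂ hk₂ hu₂) hα0
  obtain ⟨e₁, e₂, hke₁, hke₂, he₁, he₂, he₁₂⟩ : ∃ e₁ e₂, b k e₁ = 0 ∧ b k e₂ = 0 ∧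
      b e₁ e₁ = α ∧ b e₂ e₂ = α ∧ b e₁ e₂ = 0 :=
    ⟨r₁ • u₁, r₂ • u₂, by simp [hk₁], by simp [hk₂], hr₁, hr₂, by simp [h₁₂]⟩
  obtain ⟨p₁, q₁, hTk, -⟩ := hsphere e₁ hke₁ he₁
  obtain ⟨p₂, q₂, hTk', -⟩ := hsphere e₂ hke₂ he₂
  -- The vector T k lies both in the span of k, e₁ and in that of k, e₂; pairing with e₁ removes the
  -- e₁-component.
  have hq₁ : q₁ = 0 := by
    have h1 := congrArg (b e₁) (hTk.symm.trans hTk')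
    have h2 : b e₁ k = 0 := by rw [hsymm, hke₁]
    simpa [h2, he₁, he₁₂, hα0.ne'] using h1
  rw [hq₁, zero_smul, add_zero] at hTk
  refine ⟨p₁, fun x => ?_⟩
  -- After rescaling w to square α, comparison with T k = p₁ k forces q = 0 and p = p₁, so w has the
  -- same eigenvalue as k.
  have hkw : ∀ w, b k w = 0 → T w = p₁ • w := by
    intro w hw
    by_cases hw0 : w = 0
    · simp [hw0]
    obtain ⟨r, hr, hrw⟩ := exists_smul_norm_eq (hpos w hw hw0) hα0
    obtain ⟨p, q, h1, h2⟩ := hsphere (r • w) (by simp [hw]) hrw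
    have h3 : b (r • w) k = 0 := by rw [hsymm]; simp [hw]
    have hq : q = 0 := by
      generalize r • w = w' at *
      have h4 := congrArg (b w') (hTk.symm.trans h1)
      simpa [h3, hrw, hα0.ne'] using h4
    have hp : p = p₁ := by
      have h4 := congrArg (b k) (hTk.symm.trans h1)
      simp only [hq, map_smul, zero_smul, smul_eq_mul, add_zero] at h4
      exact (mul_right_cancel₀ hk.ne h4).symm
    rw [hq, hp, mul_zero, zero_smul, zero_add, map_smul, smul_comm] at h2
    exact smul_right_injective V hr h2
  have hx : x = (b k x / b k k) • k + (x - (b k x / b k k) • k) := by abel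
  have h1 := hkw (x - (b k x / b k k) • k) (by simp [hk.ne])
  rw [map_sub, map_smul, hTk] at h1
  rw [sub_eq_iff_eq_add.1 h1]
  module

omit [FiniteDimensional ℝ V] in
/-- If all curvature operators of a torsion-free connection are homotheties, then the curvature
vanishes. -/
theorem eq_zero_of_homothety_of_cyclic (hn : 3 ≤ Module.finrank ℝ V) {R : V → V → V → V}
    (hR : ∀ x y, ∃ μ : ℝ, ∀ z, R x y z = μ • z)
    (hcyc : ∀ x y z, R x y z + R y z x + R z x y = 0) (x y z : V) : R x y z = 0 := by
  obtain ⟨μ, hμ⟩ := hR x y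
  have hspan : Submodule.span ℝ ({x, y} : Set V) ≠ ⊤ := by
    intro h
    classical
    have h1 := finrank_span_finset_le_card (R := ℝ) ({x, y} : Finset V)
    have h2 := Finset.card_le_two (a := x) (b := y)
    simp only [Finset.coe_insert, Finset.coe_singleton] at h1
    rw [Set.finrank, h, finrank_top] at h1
    omega
  -- For c outside the plane of x and y, the cyclic identity reads μ c + ν x + ρ y = 0, which forces
  -- μ = 0.
  obtain ⟨c, hc⟩ : ∃ c, c ∉ Submodule.span ℝ ({x, y} : Set V) := by
    by_contra! hall
    exact hspan (Submodule.eq_top_iff'.2 hall)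
  obtain ⟨ν, hν⟩ := hR y c
  obtain ⟨ρ, hρ⟩ := hR c x
  have h := hcyc x y c
  rw [hμ, hν, hρ] at h
  have hμ0 : μ = 0 := by
    by_contra h0
    apply hc
    rw [Submodule.mem_span_pair]
    refine ⟨-(ν / μ), -(ρ / μ), ?_⟩
    have h1 : c = μ⁻¹ • (μ • c) := by rw [smul_smul, inv_mul_cancel₀ h0, one_smul]
    have h2 : μ • c = -(ν • x + ρ • y) := by
      rw [eq_neg_iff_add_eq_zero, ← h]; abel
    rw [h1, h2]
    match_scalars <;> field_simp
  rw [hμ, hμ0, zero_smul]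

end NullEigenvectors

/-! ### Metric compatibility. -/

section KoszulSwap

variable {V : Type*} [NormedAddCommGroup V] [NormedSpace ℝ V]

/-- Metric compatibility of the Koszul formula. -/
theorem koszulCoord_add_swap {h : V → V →L[ℝ] V →L[ℝ] ℝ} {X Y Z : V → V} {z : V}
    (hh : DifferentiableAt ℝ h z) (hsymm : ∀ᶠ y in 𝓝 z, ∀ a b, h y a b = h y b a)
    (hX : DifferentiableAt ℝ X z) (hY : DifferentiableAt ℝ Y z) (hZ : DifferentiableAt ℝ Z z) :
    koszulCoord h X Y z (Z z) + koszulCoord h X Z z (Y z)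
      = 2 * fderiv ℝ (fun z => h z (Y z) (Z z)) z (X z) := by
  have hs := hsymm.self_of_nhds
  have hsw : ∀ A B : V → V, fderiv ℝ (fun z => h z (A z) (B z)) z
      = fderiv ℝ (fun z => h z (B z) (A z)) z := by
    intro A B
    apply Filter.EventuallyEq.fderiv_eq
    filter_upwards [hsymm] with y hy using hy _ _
  rw [koszulCoord_eq hh hs hX hY hZ, koszulCoord_eq hh hs hX hZ hY, hsw Z Y, hsw X Y, hsw X Z]
  simp only [map_sub]
  ring

end KoszulSwap

/-! ### Pointwise geometry of the null congruence in a chart. -/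

/-- A chart of a null congruence: the inverse `y ↦ (F y, W y)` of a chart with domain `Ω`, read in
coordinates of the base in which the metric is `G` and the timelike field is `K`, together with
a smooth left inverse `Λ` of its differential. -/
structure CongruenceChart (V E : Type*) [NormedAddCommGroup V] [NormedSpace ℝ V]
    [NormedAddCommGroup E] [NormedSpace ℝ E] where
  /-- the metric -/
  G : V → V →L[ℝ] V →L[ℝ] ℝ
  /-- the domain of the coordinates of the base -/
  U : Set V
  /-- the timelike field -/
  K : V → V
  /-- the domain of the chart -/
  Ω : Set E
  /-- the base point -/
  F : E → V
  /-- the null vector -/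
  W : E → V
  /-- the left inverse of the differential -/
  Λ : E → V × V →L[ℝ] E
  metric : IsMetricOn G U
  isOpen : IsOpen Ω
  mapsTo : ∀ y ∈ Ω, F y ∈ U
  contDiffOn_K : ContDiffOn ℝ ∞ K U
  contDiffOn_F : ContDiffOn ℝ ∞ F Ω
  contDiffOn_W : ContDiffOn ℝ ∞ W Ω
  contDiffOn_Λ : ContDiffOn ℝ ∞ Λ Ω
  null : ∀ y ∈ Ω, G (F y) (W y) (W y) = 0
  normalized : ∀ y ∈ Ω, G (F y) (W y) (K (F y)) = -1
  pos : ∀ z ∈ U, ∀ w, G z (K z) w = 0 → w ≠ 0 → 0 < G z w w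
  left_inv : ∀ y ∈ Ω, ∀ ξ, Λ y (fderiv ℝ F y ξ, fderiv ℝ W y ξ) = ξ
  finrank_eq : Module.finrank ℝ E + 2 = 2 * Module.finrank ℝ V

namespace CongruenceChart

variable {V E : Type*} [NormedAddCommGroup V] [NormedSpace ℝ V] [FiniteDimensional ℝ V]
  [NormedAddCommGroup E] [NormedSpace ℝ E] (D : CongruenceChart V E)

/-- The Christoffel symbol of the base. -/
abbrev Γ : V → V →L[ℝ] V →L[ℝ] V := christoffel D.G

/-- The differential of the projection. -/
abbrev dF (y : E) : E →L[ℝ] V := fderiv ℝ D.F y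

/-- The connection map. -/
def conn (y : E) : E →L[ℝ] V :=
  fderiv ℝ D.W y + ((D.Γ (D.F y)).flip (D.W y)).comp (D.dF y)

/-- The covariant derivative of the timelike field. -/
def nablaK (z : V) : V →L[ℝ] V := fderiv ℝ D.K z + (D.Γ z).flip (D.K z)

/-- The linear form `ξ ↦ g(v, ∇_{dπ(ξ)} K)`. -/
def lam (y : E) : E →L[ℝ] ℝ :=
  (D.G (D.F y) (D.W y)).comp ((D.nablaK (D.F y)).comp (D.dF y))

/-- The Sasaki metric. -/
def metricC (y : E) : E →L[ℝ] E →L[ℝ] ℝ :=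
  (D.G (D.F y)).bilinearComp (D.dF y) (D.dF y) + (D.G (D.F y)).bilinearComp (D.conn y) (D.conn y)

/-- The projection onto the vertical space. -/
def vert (y : E) : E →L[ℝ] E :=
  (D.Λ y).comp ((ContinuousLinearMap.inr ℝ V V).comp (D.conn y - (D.lam y).smulRight (D.W y)))

theorem conn_apply (y ξ : E) :
    D.conn y ξ = fderiv ℝ D.W y ξ + D.Γ (D.F y) (D.dF y ξ) (D.W y) := rfl

theorem nablaK_apply (z a : V) : D.nablaK z a = fderiv ℝ D.K z a + D.Γ z a (D.K z) := rfl

theorem lam_apply (y ξ : E) :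
    D.lam y ξ = D.G (D.F y) (D.W y) (D.nablaK (D.F y) (D.dF y ξ)) := rfl

theorem metricC_apply (y ξ η : E) :
    D.metricC y ξ η = D.G (D.F y) (D.dF y ξ) (D.dF y η)
      + D.G (D.F y) (D.conn y ξ) (D.conn y η) := rfl

theorem vert_apply (y ξ : E) :
    D.vert y ξ = D.Λ y (0, D.conn y ξ - D.lam y ξ • D.W y) := rfl

variable {D} {y : E} (hy : y ∈ D.Ω)
include hy

omit [FiniteDimensional ℝ V] in
theorem contDiffAt_F : ContDiffAt ℝ ∞ D.F y := D.contDiffOn_F.contDiffAt (D.isOpen.mem_nhds hy)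

omit [FiniteDimensional ℝ V] in
theorem contDiffAt_W : ContDiffAt ℝ ∞ D.W y := D.contDiffOn_W.contDiffAt (D.isOpen.mem_nhds hy)

omit [FiniteDimensional ℝ V] in
theorem contDiffAt_G : ContDiffAt ℝ ∞ D.G (D.F y) :=
  D.metric.contDiffOn.contDiffAt (D.metric.isOpen.mem_nhds (D.mapsTo y hy))

theorem contDiffAt_Γ : ContDiffAt ℝ ∞ D.Γ (D.F y) :=
  D.metric.contDiffOn_christoffel.contDiffAt (D.metric.isOpen.mem_nhds (D.mapsTo y hy))

omit [FiniteDimensional ℝ V] in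
theorem contDiffAt_K : ContDiffAt ℝ ∞ D.K (D.F y) :=
  D.contDiffOn_K.contDiffAt (D.metric.isOpen.mem_nhds (D.mapsTo y hy))

omit [FiniteDimensional ℝ V] in
theorem contDiffAt_dF : ContDiffAt ℝ ∞ D.dF y := (contDiffAt_F hy).fderiv_right (by simp)

omit [FiniteDimensional ℝ V] in
theorem hasFDerivAt_F : HasFDerivAt D.F (D.dF y) y :=
  ((contDiffAt_F hy).differentiableAt (by simp)).hasFDerivAt

theorem contDiffAt_conn : ContDiffAt ℝ ∞ D.conn y := by
  have h1 : ContDiffAt ℝ ∞ (fun y => (D.Γ (D.F y)).flip) y :=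
    (ContinuousLinearMap.flipₗᵢ ℝ V V V).contDiff.contDiffAt.comp y
      ((contDiffAt_Γ hy).comp y (contDiffAt_F hy))
  exact ((contDiffAt_W hy).fderiv_right (by simp)).add
    ((h1.clm_apply (contDiffAt_W hy)).clm_comp (contDiffAt_dF hy))

theorem contDiffAt_lam : ContDiffAt ℝ ∞ D.lam y := by
  have h1 : ContDiffAt ℝ ∞ (fun z => (D.Γ z).flip) (D.F y) :=
    (ContinuousLinearMap.flipₗᵢ ℝ V V V).contDiff.contDiffAt.comp _ (contDiffAt_Γ hy)
  have h2 : ContDiffAt ℝ ∞ D.nablaK (D.F y) :=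
    ((contDiffAt_K hy).fderiv_right (by simp)).add (h1.clm_apply (contDiffAt_K hy))
  have h3 : ContDiffAt ℝ ∞ (fun y => D.G (D.F y)) y :=
    (contDiffAt_G hy).comp y (contDiffAt_F hy)
  exact (h3.clm_apply (contDiffAt_W hy)).clm_comp
    ((h2.comp y (contDiffAt_F hy)).clm_comp (contDiffAt_dF hy))

theorem contDiffAt_metricC [FiniteDimensional ℝ E] : ContDiffAt ℝ ∞ D.metricC y := by
  have h : ContDiffOn ℝ ∞ D.metricC D.Ω := by
    refine contDiffOn_clm_apply.2 fun ξ => contDiffOn_clm_apply.2 fun η => ?_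
    intro x hx
    have h3 : ContDiffAt ℝ ∞ (fun y => D.G (D.F y)) x :=
      (contDiffAt_G hx).comp x (contDiffAt_F hx)
    have h4 := fun ζ : E => (contDiffAt_dF hx).clm_apply (contDiffAt_const (c := ζ))
    have h5 := fun ζ : E => (contDiffAt_conn hx).clm_apply (contDiffAt_const (c := ζ))
    exact (((h3.clm_apply (h4 ξ)).clm_apply (h4 η)).add
      ((h3.clm_apply (h5 ξ)).clm_apply (h5 η))).contDiffWithinAt
  exact h.contDiffAt (D.isOpen.mem_nhds hy)

theorem contDiffAt_vert [FiniteDimensional ℝ E] : ContDiffAt ℝ ∞ D.vert y := by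
  have h : ContDiffOn ℝ ∞ D.vert D.Ω := by
    refine contDiffOn_clm_apply.2 fun ξ x hx => ?_
    have h1 := (contDiffAt_conn hx).clm_apply (contDiffAt_const (c := ξ))
    have h2 := (contDiffAt_lam hx).clm_apply (contDiffAt_const (c := ξ))
    exact ((D.contDiffOn_Λ.contDiffAt (D.isOpen.mem_nhds hx)).clm_apply
      (contDiffAt_const.prodMk (h1.sub (h2.smul (contDiffAt_W hx))))).contDiffWithinAt
  exact h.contDiffAt (D.isOpen.mem_nhds hy)

/-- The product rule for the scalar product of two vector fields along the projection. -/
theorem fderiv_inner {A B : E → V} (hA : DifferentiableAt ℝ A y) (hB : DifferentiableAt ℝ B y)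
    (ξ : E) :
    fderiv ℝ (fun y => D.G (D.F y) (A y) (B y)) y ξ
      = D.G (D.F y) (fderiv ℝ A y ξ + D.Γ (D.F y) (D.dF y ξ) (A y)) (B y)
        + D.G (D.F y) (A y) (fderiv ℝ B y ξ + D.Γ (D.F y) (D.dF y ξ) (B y)) := by
  have hG : DifferentiableAt ℝ D.G (D.F y) := (contDiffAt_G hy).differentiableAt (by simp)
  have hc : HasFDerivAt (fun y => D.G (D.F y)) ((fderiv ℝ D.G (D.F y)).comp (D.dF y)) y :=
    HasFDerivAt.comp (g := D.G) y hG.hasFDerivAt (hasFDerivAt_F hy)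
  rw [fderiv_metric_apply hc.differentiableAt hA hB, hc.fderiv, ContinuousLinearMap.comp_apply,
    D.metric.fderiv_eq (D.mapsTo y hy)]
  simp only [map_add, add_apply]
  ring

/-- The derivative of g(v,v) = 0 along the congruence. -/
theorem inner_conn_W (ξ : E) : D.G (D.F y) (D.conn y ξ) (D.W y) = 0 := by
  have hW := (contDiffAt_W hy).differentiableAt (by simp)
  have h1 := fderiv_inner hy hW hW ξ
  have h2 : (fun y => D.G (D.F y) (D.W y) (D.W y)) =ᶠ[𝓝 y] fun _ => 0 := by
    filter_upwards [D.isOpen.mem_nhds hy] with x hx using D.null x hx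
  rw [h2.fderiv_eq, D.metric.symm _ (D.mapsTo y hy) (D.W y), ← conn_apply] at h1
  simp at h1
  linarith

/-- The derivative of g(v,K) = -1 along the congruence; the term containing the derivative of K is
`lam`. -/
theorem inner_conn_K (ξ : E) :
    D.G (D.F y) (D.conn y ξ) (D.K (D.F y)) = -D.lam y ξ := by
  have hW := (contDiffAt_W hy).differentiableAt (by simp)
  have hK : HasFDerivAt (fun y => D.K (D.F y)) ((fderiv ℝ D.K (D.F y)).comp (D.dF y)) y :=
    ((contDiffAt_K hy).differentiableAt (by simp)).hasFDerivAt.comp y (hasFDerivAt_F hy)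
  have h1 := fderiv_inner hy hW hK.differentiableAt ξ
  have h2 : (fun y => D.G (D.F y) (D.W y) (D.K (D.F y))) =ᶠ[𝓝 y] fun _ => -1 := by
    filter_upwards [D.isOpen.mem_nhds hy] with x hx using D.normalized x hx
  rw [h2.fderiv_eq, hK.fderiv, ← conn_apply, ContinuousLinearMap.comp_apply, ← nablaK_apply,
    ← lam_apply] at h1
  simp at h1
  linarith

/-- For a vertical vector the connection map is just the differential of W, and the differential of
(F,W) is injective because it has the left inverse Λ. -/
theorem eq_zero_of_conn {ξ : E} (h1 : D.dF y ξ = 0) (h2 : D.conn y ξ = 0) : ξ = 0 := by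
  rw [conn_apply, h1] at h2
  simp only [map_zero, zero_apply, add_zero] at h2
  have := D.left_inv y hy ξ
  rw [h1, h2] at this
  rw [← this]
  exact map_zero _

/-- The tangent space of the congruence is cut out by the linearized constraints. -/
theorem exists_tangent [FiniteDimensional ℝ E] {a w : V} (h1 : D.G (D.F y) w (D.W y) = 0)
    (h2 : D.G (D.F y) w (D.K (D.F y)) = -D.G (D.F y) (D.W y) (D.nablaK (D.F y) a)) :
    ∃ ξ, D.dF y ξ = a ∧ D.conn y ξ = w := by
  let J : E →ₗ[ℝ] V × V := (D.dF y : E →ₗ[ℝ] V).prod (D.conn y : E →ₗ[ℝ] V)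
  let P1 : V × V →L[ℝ] ℝ :=
    ((D.G (D.F y)).flip (D.W y)).comp (ContinuousLinearMap.snd ℝ V V)
  let P2 : V × V →L[ℝ] ℝ :=
    ((D.G (D.F y)).flip (D.K (D.F y))).comp (ContinuousLinearMap.snd ℝ V V)
      + ((D.G (D.F y) (D.W y)).comp (D.nablaK (D.F y))).comp (ContinuousLinearMap.fst ℝ V V)
  -- The two linearized constraints. The tangent space embeds into the kernel of Φ, and the two have
  -- the same dimension since Φ is onto ℝ².
  let Φ : V × V →ₗ[ℝ] ℝ × ℝ := (P1 : V × V →ₗ[ℝ] ℝ).prod (P2 : V × V →ₗ[ℝ] ℝ)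
  have hΦ : ∀ p, Φ p = (D.G (D.F y) p.2 (D.W y), D.G (D.F y) p.2 (D.K (D.F y))
      + D.G (D.F y) (D.W y) (D.nablaK (D.F y) p.1)) := fun p => rfl
  have hJ : Function.Injective J := by
    rw [injective_iff_map_eq_zero]
    intro ξ hξ
    exact eq_zero_of_conn hy (congrArg Prod.fst hξ) (congrArg Prod.snd hξ)
  have hle : LinearMap.range J ≤ LinearMap.ker Φ := by
    rintro _ ⟨ξ, rfl⟩
    rw [LinearMap.mem_ker, hΦ]
    refine Prod.ext (inner_conn_W hy ξ) ?_
    change D.G (D.F y) (D.conn y ξ) (D.K (D.F y)) + D.lam y ξ = 0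
    rw [inner_conn_K hy]; ring
  have hsurj : LinearMap.range Φ = ⊤ := by
    rw [LinearMap.range_eq_top]
    rintro ⟨r, s⟩
    -- A preimage of (r,s) is sought in the span of K and W: g(W,W) = 0 and g(W,K) = -1 make the
    -- system triangular.
    refine ⟨(0, (-r) • D.K (D.F y)
      + (-s - r * D.G (D.F y) (D.K (D.F y)) (D.K (D.F y))) • D.W y), ?_⟩
    have h3 := D.normalized y hy
    have h4 := h3
    rw [D.metric.symm _ (D.mapsTo y hy)] at h4
    rw [hΦ]
    refine Prod.ext ?_ ?_
    · simp [h4, D.null y hy]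
    · simp [h3]
  have hdim : Module.finrank ℝ (LinearMap.range J) = Module.finrank ℝ (LinearMap.ker Φ) := by
    have e1 := LinearMap.finrank_range_add_finrank_ker Φ
    have e2 := LinearMap.finrank_range_of_inj hJ
    have e3 := D.finrank_eq
    rw [hsurj, finrank_top] at e1
    simp only [Module.finrank_prod, Module.finrank_self] at e1
    omega
  have hmem : (a, w) ∈ LinearMap.range J := by
    rw [Submodule.eq_of_le_of_finrank_eq hle hdim, LinearMap.mem_ker, hΦ]
    exact Prod.ext h1 (by simp [h2])
  obtain ⟨ξ, hξ⟩ := hmem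
  exact ⟨ξ, congrArg Prod.fst hξ, congrArg Prod.snd hξ⟩

/-- Subtracting λ(ξ)W from the connection part makes it orthogonal to K as well as to W, hence the
connection part of a vertical vector. Applying Λ recovers that vector, and smoothness of Λ is what
makes the vertical projection smooth. -/
theorem vert_spec [FiniteDimensional ℝ E] (ξ : E) :
    D.dF y (D.vert y ξ) = 0 ∧ D.conn y (D.vert y ξ) = D.conn y ξ - D.lam y ξ • D.W y := by
  obtain ⟨η, h1, h2⟩ := exists_tangent hy (a := 0) (w := D.conn y ξ - D.lam y ξ • D.W y)
    (by simp [inner_conn_W hy, D.null y hy])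
    (by simp [inner_conn_K hy, D.normalized y hy])
  have h3 : fderiv ℝ D.W y η = D.conn y η := by rw [conn_apply, h1]; simp
  have h4 : D.vert y ξ = η := by
    rw [vert_apply, ← h2, ← h3, ← h1]
    exact D.left_inv y hy η
  rw [h4]
  exact ⟨h1, h2⟩

theorem dF_vert [FiniteDimensional ℝ E] (ξ : E) : D.dF y (D.vert y ξ) = 0 := (vert_spec hy ξ).1

theorem vert_eq_self [FiniteDimensional ℝ E] {u : E} (hu : D.dF y u = 0) : D.vert y u = u := by
  have h := vert_spec hy u
  have hl : D.lam y u = 0 := by rw [lam_apply, hu]; simp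
  rw [hl, zero_smul, sub_zero] at h
  rw [← sub_eq_zero]
  exact eq_zero_of_conn hy (by rw [map_sub, h.1, hu, sub_zero]) (by rw [map_sub, h.2, sub_self])

theorem vert_vert [FiniteDimensional ℝ E] (ξ : E) : D.vert y (D.vert y ξ) = D.vert y ξ :=
  vert_eq_self hy (dF_vert hy ξ)

theorem vert_sub_vert [FiniteDimensional ℝ E] (ξ : E) : D.vert y (ξ - D.vert y ξ) = 0 := by
  rw [map_sub, vert_vert hy, sub_self]

/-- Parallel transport along horizontal directions is corrected only in the direction of the null
vector itself. This is where the nullity of the congruence enters the curvature computation. -/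
theorem conn_of_horizontal [FiniteDimensional ℝ E] {ξ : E} (h : D.vert y ξ = 0) :
    D.conn y ξ = D.lam y ξ • D.W y := by
  have := (vert_spec hy ξ).2
  rw [h, map_zero] at this
  exact (sub_eq_zero.1 this.symm)

theorem metricC_symm (ξ η : E) : D.metricC y ξ η = D.metricC y η ξ := by
  rw [metricC_apply, metricC_apply, D.metric.symm _ (D.mapsTo y hy) (D.dF y ξ),
    D.metric.symm _ (D.mapsTo y hy) (D.conn y ξ)]

/-- The connection part of ξ is a multiple of W, which is orthogonal to every connection part. Hence
the projection is a semi-Riemannian submersion. -/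
theorem metricC_of_horizontal [FiniteDimensional ℝ E] {ξ : E} (h : D.vert y ξ = 0) (η : E) :
    D.metricC y ξ η = D.G (D.F y) (D.dF y ξ) (D.dF y η) := by
  rw [metricC_apply, conn_of_horizontal hy h, map_smul, smul_apply,
    D.metric.symm _ (D.mapsTo y hy) (D.W y), inner_conn_W hy, smul_zero, add_zero]

omit [FiniteDimensional ℝ V] hy in
theorem metricC_of_vertical [FiniteDimensional ℝ V] {u : E} (hu : D.dF y u = 0) (η : E) :
    D.metricC y η u = D.G (D.F y) (D.conn y η) (D.conn y u) := by
  rw [metricC_apply, hu, map_zero, zero_add]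

theorem metricC_horizontal_vertical [FiniteDimensional ℝ E] {ξ u : E} (h : D.vert y ξ = 0)
    (hu : D.dF y u = 0) : D.metricC y ξ u = 0 := by
  rw [metricC_of_horizontal hy h, hu, map_zero]

/-- Since λ(u) = 0, the connection part of u is orthogonal to the timelike K, and it is nonzero.
Definiteness of the fibres later lets a vertical vector be shown to vanish by pairing it with
itself. -/
theorem pos_of_vertical {u : E} (hu : D.dF y u = 0) (hu0 : u ≠ 0) : 0 < D.metricC y u u := by
  rw [metricC_of_vertical hu]
  refine D.pos _ (D.mapsTo y hy) _ ?_ fun h => hu0 (eq_zero_of_conn hy hu h)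
  rw [D.metric.symm _ (D.mapsTo y hy), inner_conn_K hy, lam_apply, hu]
  simp

/-- The preimage constructed is the horizontal lift, with connection part g(W,∇_a K) W. -/
theorem dF_surjective [FiniteDimensional ℝ E] : Function.Surjective (D.dF y) := by
  intro a
  obtain ⟨ξ, h, -⟩ := exists_tangent hy (a := a)
    (w := D.G (D.F y) (D.W y) (D.nablaK (D.F y) a) • D.W y)
    (by simp [D.null y hy]) (by simp [D.normalized y hy])
  exact ⟨ξ, h⟩

/-- The fibres are definite, the horizontal space is isometric to the nondegenerate tangent space of
the base, and the two are orthogonal. -/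
theorem metricC_nondegenerate [FiniteDimensional ℝ E] (a : E) (h : ∀ b, D.metricC y a b = 0) :
    a = 0 := by
  have h1 : D.vert y a = 0 := by
    by_contra h0
    have h2 := pos_of_vertical hy (dF_vert hy a) h0
    have h3 := metricC_horizontal_vertical hy (vert_sub_vert hy a) (dF_vert hy a)
    rw [map_sub, sub_apply, h, zero_sub] at h3
    linarith
  have h2 : D.dF y a = 0 := by
    refine D.metric.nondegenerate _ (D.mapsTo y hy) _ fun b => ?_
    obtain ⟨ξ, rfl⟩ := dF_surjective hy b
    rw [← metricC_of_horizontal hy h1, h]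
  rw [← vert_eq_self hy h2, h1]

end CongruenceChart

/-! ### Brackets of horizontal fields, curvature and the O'Neill tensor. -/

namespace CongruenceChart

variable {V E : Type*} [NormedAddCommGroup V] [NormedSpace ℝ V] [FiniteDimensional ℝ V]
  [NormedAddCommGroup E] [NormedSpace ℝ E] {D : CongruenceChart V E}
  {y : E} (hy : y ∈ D.Ω)
include hy

omit [FiniteDimensional ℝ V] in
theorem fderiv_dF_apply {X : E → E} (hX : DifferentiableAt ℝ X y) (ξ : E) :
    fderiv ℝ (fun y => D.dF y (X y)) y ξ
      = fderiv ℝ D.dF y ξ (X y) + D.dF y (fderiv ℝ X y ξ) := by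
  rw [fderiv_clm_apply ((contDiffAt_dF hy).differentiableAt (by simp)) hX]
  simp [add_comm]

omit [FiniteDimensional ℝ V] in
theorem fderiv_dF_symm (a b : E) : fderiv ℝ D.dF y a b = fderiv ℝ D.dF y b a :=
  ((contDiffAt_F hy).isSymmSndFDerivAt (by simpa using two_le_infty)) a b

omit [FiniteDimensional ℝ V] in
theorem fderiv_dW_symm (a b : E) :
    fderiv ℝ (fderiv ℝ D.W) y a b = fderiv ℝ (fderiv ℝ D.W) y b a :=
  ((contDiffAt_W hy).isSymmSndFDerivAt (by simpa using two_le_infty)) a b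

/-- The Koszul formula for two horizontal fields and a vertical vector reduces to their
bracket. -/
theorem koszulCoord_horizontal [FiniteDimensional ℝ E] {X Y : E → E}
    (hX : DifferentiableAt ℝ X y) (hY : DifferentiableAt ℝ Y y)
    (hXh : ∀ x ∈ D.Ω, D.vert x (X x) = 0) (hYh : ∀ x ∈ D.Ω, D.vert x (Y x) = 0)
    {u : E} (hu : D.dF y u = 0) :
    koszulCoord D.metricC X Y y u
      = D.metricC y (fderiv ℝ Y y (X y) - fderiv ℝ X y (Y y)) u := by
  have hΩ := D.isOpen.mem_nhds hy
  -- The Koszul expression depends only on the value u of its last argument, which may therefore be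
  -- extended to a vertical field.
  let Z : E → E := fun x => D.vert x u
  have hZu : Z y = u := vert_eq_self hy hu
  have hZ : DifferentiableAt ℝ Z y :=
    ((contDiffAt_vert hy).clm_apply contDiffAt_const).differentiableAt (by simp)
  have hZv : ∀ x ∈ D.Ω, D.dF x (Z x) = 0 := fun x hx => dF_vert hx u
  have e1 : fderiv ℝ (fun x => D.metricC x (Y x) (Z x)) y = 0 := by
    have : (fun x => D.metricC x (Y x) (Z x)) =ᶠ[𝓝 y] fun _ => 0 := by
      filter_upwards [hΩ] with x hx
      exact metricC_horizontal_vertical hx (hYh x hx) (hZv x hx)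
    rw [this.fderiv_eq]; simp
  have e2 : fderiv ℝ (fun x => D.metricC x (Z x) (X x)) y = 0 := by
    have : (fun x => D.metricC x (Z x) (X x)) =ᶠ[𝓝 y] fun _ => 0 := by
      filter_upwards [hΩ] with x hx
      rw [metricC_symm hx, metricC_horizontal_vertical hx (hXh x hx) (hZv x hx)]
    rw [this.fderiv_eq]; simp
  have hdX : DifferentiableAt ℝ (fun x => D.dF x (X x)) y :=
    ((contDiffAt_dF hy).differentiableAt (by simp)).clm_apply hX
  have hdY : DifferentiableAt ℝ (fun x => D.dF x (Y x)) y :=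
    ((contDiffAt_dF hy).differentiableAt (by simp)).clm_apply hY
  have e3 : fderiv ℝ (fun x => D.metricC x (X x) (Y x)) y u
      = D.G (D.F y) (fderiv ℝ (fun x => D.dF x (X x)) y u) (D.dF y (Y y))
        + D.G (D.F y) (D.dF y (X y)) (fderiv ℝ (fun x => D.dF x (Y x)) y u) := by
    have h1 : (fun x => D.metricC x (X x) (Y x)) =ᶠ[𝓝 y]
        fun x => D.G (D.F x) (D.dF x (X x)) (D.dF x (Y x)) := by
      filter_upwards [hΩ] with x hx using metricC_of_horizontal hx (hXh x hx) _
    rw [h1.fderiv_eq, fderiv_inner hy hdX hdY, hu]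
    simp
  -- As dF(Z) = 0 identically, the projection of [A,Z] is minus the derivative of dF(A) along u. For
  -- A = X and A = Y these terms cancel e3, and only the bracket [X,Y] is left.
  have e4 : ∀ A : E → E, DifferentiableAt ℝ A y →
      D.dF y (fderiv ℝ Z y (A y) - fderiv ℝ A y (Z y))
        = -fderiv ℝ (fun x => D.dF x (A x)) y u := by
    intro A hA
    have h1 : (fun x => D.dF x (Z x)) =ᶠ[𝓝 y] fun _ => 0 := by
      filter_upwards [hΩ] with x hx using hZv x hx
    have h2 := fderiv_dF_apply hy hZ (A y)
    rw [h1.fderiv_eq] at h2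
    have h3 := fderiv_dF_apply hy hA u
    simp only [fderiv_fun_const, Pi.zero_apply, zero_apply] at h2
    rw [h3, map_sub, hZu, eq_neg_of_add_eq_zero_right h2.symm, hZu, fderiv_dF_symm hy u]
    abel
  have h := koszulCoord_eq ((contDiffAt_metricC hy).differentiableAt (by simp))
    (metricC_symm hy) hX hY hZ
  have e5 : fderiv ℝ X y (Z y) - fderiv ℝ Z y (X y)
      = -(fderiv ℝ Z y (X y) - fderiv ℝ X y (Z y)) := by abel
  rw [e1, e2, hZu, e3, metricC_of_horizontal hy (hXh y hy), metricC_of_horizontal hy (hYh y hy)]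
    at h
  rw [hZu] at e4 e5
  rw [h, e4 Y hY, e5, map_neg (D.dF y), e4 X hX, metricC_symm hy u]
  simp only [zero_apply, map_neg, neg_neg]
  rw [D.metric.symm _ (D.mapsTo y hy) (D.dF y (Y y))]
  ring

/-- The connection map of the bracket of two horizontal fields is given by the curvature. -/
theorem exists_conn_bracket [FiniteDimensional ℝ E] {X Y : E → E}
    (hX : DifferentiableAt ℝ X y) (hY : DifferentiableAt ℝ Y y)
    (hXh : ∀ x ∈ D.Ω, D.vert x (X x) = 0) (hYh : ∀ x ∈ D.Ω, D.vert x (Y x) = 0) :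
    ∃ μ : ℝ, D.conn y (fderiv ℝ Y y (X y) - fderiv ℝ X y (Y y))
      = μ • D.W y - curvatureCoord D.Γ (D.F y) (D.dF y (X y)) (D.dF y (Y y)) (D.W y) := by
  have hΩ := D.isOpen.mem_nhds hy
  have hW := (contDiffAt_W hy).differentiableAt (by simp)
  have hdW : DifferentiableAt ℝ (fderiv ℝ D.W) y :=
    ((contDiffAt_W hy).fderiv_right (m := ∞) (by simp)).differentiableAt (by simp)
  have hΓ : HasFDerivAt (fun x => D.Γ (D.F x)) ((fderiv ℝ D.Γ (D.F y)).comp (D.dF y)) y :=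
    HasFDerivAt.comp (g := D.Γ) y ((contDiffAt_Γ hy).differentiableAt (by simp)).hasFDerivAt
      (hasFDerivAt_F hy)
  -- The identity conn(A) = λ(A) W for a horizontal field A, differentiated in the direction b.
  have key : ∀ A : E → E, DifferentiableAt ℝ A y → (∀ x ∈ D.Ω, D.vert x (A x) = 0) → ∀ b : E,
      fderiv ℝ (fderiv ℝ D.W) y b (A y) + fderiv ℝ D.W y (fderiv ℝ A y b)
        + (fderiv ℝ D.Γ (D.F y) (D.dF y b) (D.dF y (A y)) (D.W y)
          + D.Γ (D.F y) (fderiv ℝ D.dF y b (A y) + D.dF y (fderiv ℝ A y b)) (D.W y)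
          + D.Γ (D.F y) (D.dF y (A y)) (fderiv ℝ D.W y b))
        = fderiv ℝ (fun x => D.lam x (A x)) y b • D.W y
          + D.lam y (A y) • fderiv ℝ D.W y b := by
    intro A hA hAh b
    have h1 : (fun x => fderiv ℝ D.W x (A x) + D.Γ (D.F x) (D.dF x (A x)) (D.W x))
        =ᶠ[𝓝 y] fun x => D.lam x (A x) • D.W x := by
      filter_upwards [hΩ] with x hx
      rw [← conn_of_horizontal hx (hAh x hx), conn_apply]
    have hdA : DifferentiableAt ℝ (fun x => D.dF x (A x)) y :=
      ((contDiffAt_dF hy).differentiableAt (by simp)).clm_apply hA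
    have hl : DifferentiableAt ℝ (fun x => D.lam x (A x)) y :=
      ((contDiffAt_lam hy).differentiableAt (by simp)).clm_apply hA
    have hg := hΓ.differentiableAt.clm_apply hdA
    have h2 := congrArg (fun T => T b) (h1.fderiv_eq (𝕜 := ℝ))
    rw [fderiv_fun_add (hdW.clm_apply hA) (hg.clm_apply hW), fderiv_clm_apply hdW hA,
      fderiv_clm_apply hg hW, fderiv_clm_apply hΓ.differentiableAt hdA, hΓ.fderiv,
      fderiv_fun_smul hl hW] at h2
    simp only [add_apply, ContinuousLinearMap.comp_apply, ContinuousLinearMap.flip_apply,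
      smul_apply, ContinuousLinearMap.smulRight_apply,
      fderiv_dF_apply hy hA] at h2
    rw [add_comm (_ • D.W y), ← h2]
    abel
  have kX := key X hX hXh (Y y)
  have kY := key Y hY hYh (X y)
  have hWX : ∀ ξ, D.vert y ξ = 0 → fderiv ℝ D.W y ξ
      = D.lam y ξ • D.W y - D.Γ (D.F y) (D.dF y ξ) (D.W y) := by
    intro ξ hξ
    rw [← conn_of_horizontal hy hξ, conn_apply, add_sub_cancel_right]
  -- The coefficient is X(λ(Y)) - Y(λ(X)). When the two differentiated identities are subtracted,
  -- second derivatives cancel by symmetry and so do the terms λ(X)λ(Y)W.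
  refine ⟨fderiv ℝ (fun x => D.lam x (Y x)) y (X y)
    - fderiv ℝ (fun x => D.lam x (X x)) y (Y y), ?_⟩
  rw [hWX _ (hYh y hy)] at kX
  rw [hWX _ (hXh y hy)] at kY
  rw [fderiv_dW_symm hy, fderiv_dF_symm hy] at kX
  rw [conn_apply, curvatureCoord]
  simp only [map_sub, map_add, map_smul, sub_apply, add_apply, smul_sub] at kX kY ⊢
  rw [smul_comm] at kX
  linear_combination (norm := module) kY - kX

/-- If the curvature annihilates the null vector, then the O'Neill tensor vanishes. -/
theorem oneill_eq_zero [FiniteDimensional ℝ E] {X Y Q : E → E}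
    (hX : DifferentiableAt ℝ X y) (hY : DifferentiableAt ℝ Y y) (hQ : DifferentiableAt ℝ Q y)
    (hXh : ∀ x ∈ D.Ω, D.vert x (X x) = 0) (hYh : ∀ x ∈ D.Ω, D.vert x (Y x) = 0)
    (hQv : ∀ x ∈ D.Ω, D.dF x (Q x) = 0)
    (hR : ∀ a b, curvatureCoord D.Γ (D.F y) a b (D.W y) = 0) {w₁ w₂ : E}
    (h₁ : ∀ ζ, 2 * D.metricC y w₁ ζ = koszulCoord D.metricC X Q y ζ)
    (h₂ : ∀ ζ, 2 * D.metricC y w₂ ζ = koszulCoord D.metricC X Y y ζ) :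
    (w₁ - D.vert y w₁) + D.vert y w₂ = 0 := by
  -- Without curvature, the connection part of [X,Y] is a multiple of W, hence orthogonal to the
  -- connection part of any vertical vector.
  have hbr : ∀ Y : E → E, DifferentiableAt ℝ Y y → (∀ x ∈ D.Ω, D.vert x (Y x) = 0) → ∀ u,
      D.dF y u = 0 → koszulCoord D.metricC X Y y u = 0 := by
    intro Y hY hYh u hu
    obtain ⟨μ, hμ⟩ := exists_conn_bracket hy hX hY hXh hYh
    rw [hR, sub_zero] at hμ
    rw [koszulCoord_horizontal hy hX hY hXh hYh hu, metricC_of_vertical hu, hμ, map_smul,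
      smul_apply, D.metric.symm _ (D.mapsTo y hy), inner_conn_W hy, smul_zero]
  have hv : D.vert y w₂ = 0 := by
    by_contra h0
    have h1 := pos_of_vertical hy (dF_vert hy w₂) h0
    have h2 := metricC_horizontal_vertical hy (vert_sub_vert hy w₂) (dF_vert hy w₂)
    have h3 := h₂ (D.vert y w₂)
    rw [hbr Y hY hYh _ (dF_vert hy w₂)] at h3
    rw [map_sub, sub_apply] at h2
    linarith
  -- For horizontal Z, metric compatibility gives ĝ(∇_X Q,Z) = -ĝ(Q,∇_X Z), which vanishes because
  -- ∇_X Z has no vertical component.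
  have hh : w₁ - D.vert y w₁ = 0 := by
    refine metricC_nondegenerate hy _ fun ζ => ?_
    let Z : E → E := fun x => ζ - D.vert x ζ
    have hZ : DifferentiableAt ℝ Z y := (contDiffAt_const.sub
      ((contDiffAt_vert hy).clm_apply contDiffAt_const)).differentiableAt (by simp)
    have hZh : ∀ x ∈ D.Ω, D.vert x (Z x) = 0 := fun x hx => vert_sub_vert hx ζ
    have h1 := koszulCoord_add_swap ((contDiffAt_metricC hy).differentiableAt (by simp))
      (by filter_upwards [D.isOpen.mem_nhds hy] with x hx using metricC_symm hx) hX hQ hZ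
    have h2 : (fun x => D.metricC x (Q x) (Z x)) =ᶠ[𝓝 y] fun _ => 0 := by
      filter_upwards [D.isOpen.mem_nhds hy] with x hx
      rw [metricC_symm hx, metricC_horizontal_vertical hx (hZh x hx) (hQv x hx)]
    rw [h2.fderiv_eq, hbr Z hZ hZh _ (hQv y hy), ← h₁] at h1
    simp only [fderiv_fun_const, Pi.zero_apply, zero_apply, mul_zero, add_zero] at h1
    have h3 := metricC_horizontal_vertical hy (vert_sub_vert hy w₁) (dF_vert hy ζ)
    have h4 := metricC_horizontal_vertical hy (hZh y hy) (dF_vert hy w₁)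
    have h5 : ζ = Z y + D.vert y ζ := by simp [Z]
    have h6 : D.metricC y (w₁ - D.vert y w₁) (Z y) = 0 := by
      rw [map_sub (D.metricC y), sub_apply, metricC_symm hy (D.vert y w₁), h4]
      linarith
    rw [h5, map_add, h3, h6, add_zero]
  rw [hv, hh, add_zero]

/-- If the O'Neill tensor vanishes, then the null vector is an eigenvector of the curvature. -/
theorem exists_curvature_eq_smul [FiniteDimensional ℝ E] {X Y : E → E}
    (hX : DifferentiableAt ℝ X y) (hY : DifferentiableAt ℝ Y y)
    (hXh : ∀ x ∈ D.Ω, D.vert x (X x) = 0) (hYh : ∀ x ∈ D.Ω, D.vert x (Y x) = 0) {w₁ w₂ : E}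
    (h₂ : ∀ ζ, 2 * D.metricC y w₂ ζ = koszulCoord D.metricC X Y y ζ)
    (hA : (w₁ - D.vert y w₁) + D.vert y w₂ = 0) :
    ∃ μ : ℝ, curvatureCoord D.Γ (D.F y) (D.dF y (X y)) (D.dF y (Y y)) (D.W y) = μ • D.W y := by
  obtain ⟨μ, hμ⟩ := exists_conn_bracket hy hX hY hXh hYh
  set r := curvatureCoord D.Γ (D.F y) (D.dF y (X y)) (D.dF y (Y y)) (D.W y) with hr
  have hsym := D.metric.symm _ (D.mapsTo y hy)
  have hrW : D.G (D.F y) r (D.W y) = 0 := by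
    have h := inner_conn_W hy (fderiv ℝ Y y (X y) - fderiv ℝ X y (Y y))
    rw [hμ] at h
    simpa [D.null y hy] using h
  -- Pairing A = 0 with a vertical u isolates ĝ(∇_X Y,u), that is, up to a factor, the pairing of
  -- the curvature term with the connection part of u.
  have hperp : ∀ u, D.dF y u = 0 → D.G (D.F y) r (D.conn y u) = 0 := by
    intro u hu
    have h1 : D.metricC y w₂ u = 0 := by
      have e1 := metricC_horizontal_vertical hy (vert_sub_vert hy w₁) hu
      have e2 := metricC_horizontal_vertical hy (vert_sub_vert hy w₂) hu
      have e3 := congrArg (fun v => D.metricC y v u) hA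
      simp only [map_add, add_apply, e1, map_zero, zero_apply, zero_add] at e3
      rw [map_sub, sub_apply, e3, sub_zero] at e2
      exact e2
    have h2 := h₂ u
    rw [h1, koszulCoord_horizontal hy hX hY hXh hYh hu, metricC_of_vertical hu, hμ, map_sub,
      map_smul, sub_apply, smul_apply, hsym (D.W y), inner_conn_W hy] at h2
    simpa using h2
  -- Adding g(r,K)W to r makes it orthogonal to both W and K, so it is the connection part of a
  -- vertical vector. It is then orthogonal to itself in a definite space, and vanishes.
  have hrs : D.G (D.F y) (r + D.G (D.F y) r (D.K (D.F y)) • D.W y) (D.W y) = 0 := by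
    simp [hrW, D.null y hy]
  have hrK : D.G (D.F y) (r + D.G (D.F y) r (D.K (D.F y)) • D.W y) (D.K (D.F y)) = 0 := by
    simp [D.normalized y hy]
  obtain ⟨u, hu, hur⟩ := exists_tangent hy (a := 0) hrs (by rw [hrK]; simp)
  have h0 : r + D.G (D.F y) r (D.K (D.F y)) • D.W y = 0 := by
    by_contra hne
    have h1 := D.pos _ (D.mapsTo y hy) _ (by rw [hsym]; exact hrK) hne
    have h2 := hperp u hu
    rw [hur] at h2
    have h3 : ∀ s, D.G (D.F y) (r + D.G (D.F y) r (D.K (D.F y)) • D.W y) s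
        = D.G (D.F y) r s + D.G (D.F y) r (D.K (D.F y)) * D.G (D.F y) (D.W y) s := by simp
    rw [h3, h2, hsym (D.W y), hrs, mul_zero, add_zero] at h1
    exact lt_irrefl _ h1
  exact ⟨-D.G (D.F y) r (D.K (D.F y)), by rw [neg_smul]; exact eq_neg_of_add_eq_zero_left h0⟩

end CongruenceChart

/-! ### Coordinates on the tangent bundle. -/

section TangentCoordinates

variable {V : Type*} [NormedAddCommGroup V] [NormedSpace ℝ V]
  {N : Type*} [TopologicalSpace N] [ChartedSpace V N] [IsManifold 𝓘(ℝ, V) ∞ N]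

/-- The inverse of `dchart x₀ x`. -/
def dchartSymm (x₀ x : N) : V →L[ℝ] TangentSpace 𝓘(ℝ, V) x :=
  (trivializationAt V (TangentSpace 𝓘(ℝ, V)) x₀).symmL ℝ x

theorem dchartSymm_eq {x₀ x : N} (hx : x ∈ (chartAt V x₀).source) (c : V) :
    dchartSymm x₀ x c = (trivializationAt V (TangentSpace 𝓘(ℝ, V)) x₀).symm x c :=
  (trivializationAt V (TangentSpace 𝓘(ℝ, V)) x₀).symmL_apply (R := ℝ) (by simpa using hx) c

theorem dchart_dchartSymm {x₀ x : N} (hx : x ∈ (chartAt V x₀).source) (c : V) :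
    dchart x₀ x (dchartSymm x₀ x c) = c := by
  rw [← trivializationAt_snd hx, dchartSymm_eq hx]
  exact congrArg Prod.snd
    ((trivializationAt V (TangentSpace 𝓘(ℝ, V)) x₀).apply_mk_symm (by simpa using hx) c)

theorem dchartSymm_dchart {x₀ x : N} (hx : x ∈ (chartAt V x₀).source)
    (w : TangentSpace 𝓘(ℝ, V) x) : dchartSymm x₀ x (dchart x₀ x w) = w :=
  (dchart_bijective hx).1 (dchart_dchartSymm hx _)

theorem contMDiffOn_dchartSymm (x₀ : N) (c : V) :
    ContMDiffOn 𝓘(ℝ, V) 𝓘(ℝ, V).tangent ∞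
      (fun x => (⟨x, dchartSymm x₀ x c⟩ : TangentBundle 𝓘(ℝ, V) N)) (chartAt V x₀).source := by
  refine (Bundle.Trivialization.contMDiffOn_section_iff (n := ∞) (IB := 𝓘(ℝ, V))
    (trivializationAt V (TangentSpace 𝓘(ℝ, V)) x₀) (s := fun x => dchartSymm x₀ x c)
    (chartAt V x₀).open_source (by simp)).2 ?_
  refine (contMDiffOn_const (c := c)).congr fun x hx => ?_
  rw [trivializationAt_snd hx, dchart_dchartSymm hx]

/-- The coordinates on the tangent bundle induced by the preferred chart at `x₀`. -/
def tangentCoord (x₀ : N) (u : TangentBundle 𝓘(ℝ, V) N) : V × V :=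
  (chartAt V x₀ u.proj, dchart x₀ u.proj u.2)

/-- The inverse of `tangentCoord x₀`. -/
def tangentCoordSymm (x₀ : N) (q : V × V) : TangentBundle 𝓘(ℝ, V) N :=
  ⟨(chartAt V x₀).symm q.1, dchartSymm x₀ ((chartAt V x₀).symm q.1) q.2⟩

/-- The differential of `tangentCoord x₀`. -/
def dtangentCoord (x₀ : N) (u : TangentBundle 𝓘(ℝ, V) N) :
    TangentSpace 𝓘(ℝ, V).tangent u →L[ℝ] V × V :=
  mvfderiv 𝓘(ℝ, V).tangent (tangentCoord x₀) u

theorem tangentCoordSymm_tangentCoord {x₀ : N} {u : TangentBundle 𝓘(ℝ, V) N}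
    (hu : u.proj ∈ (chartAt V x₀).source) : tangentCoordSymm x₀ (tangentCoord x₀ u) = u := by
  have key : ∀ x, x = u.proj →
      (⟨x, dchartSymm x₀ x (dchart x₀ u.proj u.2)⟩ : TangentBundle 𝓘(ℝ, V) N) = u := by
    rintro _ rfl
    rw [dchartSymm_dchart hu]
  exact key _ ((chartAt V x₀).left_inv hu)

theorem isOpen_proj_preimage (x₀ : N) :
    IsOpen {u : TangentBundle 𝓘(ℝ, V) N | u.proj ∈ (chartAt V x₀).source} :=
  (chartAt V x₀).open_source.preimage (FiberBundle.continuous_proj V (TangentSpace 𝓘(ℝ, V)))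

theorem contMDiffOn_tangentCoord (x₀ : N) :
    ContMDiffOn 𝓘(ℝ, V).tangent 𝓘(ℝ, V × V) ∞ (tangentCoord x₀)
      {u : TangentBundle 𝓘(ℝ, V) N | u.proj ∈ (chartAt V x₀).source} := by
  have h1 : ContMDiffOn 𝓘(ℝ, V).tangent 𝓘(ℝ, V) ∞
      (fun u : TangentBundle 𝓘(ℝ, V) N => chartAt V x₀ u.proj)
      {u : TangentBundle 𝓘(ℝ, V) N | u.proj ∈ (chartAt V x₀).source} :=
    (contMDiffOn_chartAt_self x₀).comp (Bundle.contMDiff_proj _).contMDiffOn fun u hu => hu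
  have h2 := (trivializationAt V (TangentSpace 𝓘(ℝ, V)) x₀).contMDiffOn
    (n := ∞) (IB := 𝓘(ℝ, V))
  have h3 : ContMDiffOn 𝓘(ℝ, V).tangent 𝓘(ℝ, V) ∞
      (fun u : TangentBundle 𝓘(ℝ, V) N => dchart x₀ u.proj u.2)
      {u : TangentBundle 𝓘(ℝ, V) N | u.proj ∈ (chartAt V x₀).source} := by
    refine ContMDiffOn.congr (f := fun u : TangentBundle 𝓘(ℝ, V) N =>
      (trivializationAt V (TangentSpace 𝓘(ℝ, V)) x₀ u).2) ?_ fun u hu =>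
      (trivializationAt_snd hu u.2).symm
    exact contMDiff_snd.comp_contMDiffOn (h2.mono fun u hu => hu)
  exact h1.prodMk_space h3

theorem contMDiffOn_tangentCoordSymm (x₀ : N) :
    ContMDiffOn 𝓘(ℝ, V × V) 𝓘(ℝ, V).tangent ∞ (tangentCoordSymm x₀ : V × V → TangentBundle _ N)
      {q | q.1 ∈ (chartAt V x₀).target} := by
  have h2 := (trivializationAt V (TangentSpace 𝓘(ℝ, V)) x₀).contMDiffOn_symm
    (n := ∞) (IB := 𝓘(ℝ, V))
  have h1 : ContMDiffOn 𝓘(ℝ, V × V) (𝓘(ℝ, V).prod 𝓘(ℝ, V)) ∞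
      (fun q : V × V => ((chartAt V x₀).symm q.1, q.2)) {q | q.1 ∈ (chartAt V x₀).target} := by
    refine ContMDiffOn.prodMk ?_ contDiff_snd.contMDiff.contMDiffOn
    exact (contMDiffOn_chartAt_symm_self x₀).comp contDiff_fst.contMDiff.contMDiffOn
      fun q hq => hq
  have hmem : ∀ q ∈ {q : V × V | q.1 ∈ (chartAt V x₀).target},
      (chartAt V x₀).symm q.1 ∈ (trivializationAt V (TangentSpace 𝓘(ℝ, V)) x₀).baseSet :=
    fun q hq => by simpa using (chartAt V x₀).map_target hq
  refine (h2.comp h1 fun q hq => ?_).congr fun q hq => ?_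
  · exact (trivializationAt V (TangentSpace 𝓘(ℝ, V)) x₀).mem_target.2 (hmem q hq)
  · refine Eq.trans ?_
      ((trivializationAt V (TangentSpace 𝓘(ℝ, V)) x₀).mk_symm (hmem q hq) q.2)
    rw [tangentCoordSymm, dchartSymm_eq ((chartAt V x₀).map_target hq)]

/-- Derivatives of functions on the tangent bundle in coordinates. -/
theorem mvfderiv_tangentCoord {F : Type*} [NormedAddCommGroup F] [NormedSpace ℝ F] {x₀ : N}
    {v : TangentBundle 𝓘(ℝ, V) N} (hv : v.proj ∈ (chartAt V x₀).source)
    {f : TangentBundle 𝓘(ℝ, V) N → F} {f' : V × V → F}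
    (hf : f =ᶠ[𝓝 v] f' ∘ tangentCoord x₀) (hf' : DifferentiableAt ℝ f' (tangentCoord x₀ v))
    (ξ : TangentSpace 𝓘(ℝ, V).tangent v) :
    mvfderiv 𝓘(ℝ, V).tangent f v ξ
      = fderiv ℝ f' (tangentCoord x₀ v) (dtangentCoord x₀ v ξ) := by
  have h1 : MDifferentiableAt 𝓘(ℝ, V).tangent 𝓘(ℝ, V × V) (tangentCoord x₀) v :=
    ((contMDiffOn_tangentCoord x₀).contMDiffAt
      ((isOpen_proj_preimage x₀).mem_nhds hv)).mdifferentiableAt (by simp)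
  have h3 := hf.mfderiv_eq (I := 𝓘(ℝ, V).tangent) (I' := 𝓘(ℝ, F))
  rw [mfderiv_comp v hf'.mdifferentiableAt h1, mfderiv_eq_fderiv] at h3
  exact congrArg (fun T => T ξ) h3

theorem dchart_mfderiv_proj {x₀ : N} {v : TangentBundle 𝓘(ℝ, V) N}
    (hv : v.proj ∈ (chartAt V x₀).source) (ξ : TangentSpace 𝓘(ℝ, V).tangent v) :
    dchart x₀ v.proj (mfderiv 𝓘(ℝ, V).tangent 𝓘(ℝ, V)
      (fun u : TangentBundle 𝓘(ℝ, V) N => u.proj) v ξ) = (dtangentCoord x₀ v ξ).1 := by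
  have h1 := mvfderiv_tangentCoord hv (f := fun u => chartAt V x₀ u.proj) (f' := Prod.fst)
    (Filter.Eventually.of_forall fun _ => rfl) differentiableAt_fst ξ
  rw [fderiv_fst] at h1
  refine Eq.trans ?_ h1
  have h2 : MDifferentiableAt 𝓘(ℝ, V).tangent 𝓘(ℝ, V)
      (fun u : TangentBundle 𝓘(ℝ, V) N => u.proj) v :=
    (Bundle.contMDiff_proj (n := ∞) _).mdifferentiableAt (by simp)
  exact (congrArg (fun T => T ξ) (mfderiv_comp v
    ((mdifferentiable_chartAt x₀).mdifferentiableAt hv) h2)).symm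

end TangentCoordinates

/-- The total space of a fiber bundle with Hausdorff base and fiber is Hausdorff. -/
theorem t2Space_totalSpace {B F : Type*} {E : B → Type*} [TopologicalSpace B]
    [TopologicalSpace F] [TopologicalSpace (Bundle.TotalSpace F E)]
    [∀ b, TopologicalSpace (E b)] [FiberBundle F E] [T2Space B] [T2Space F] :
    T2Space (Bundle.TotalSpace F E) := by
  refine ⟨fun u v huv => ?_⟩
  have hcont := FiberBundle.continuous_proj F E
  by_cases hp : u.proj = v.proj
  · let t := trivializationAt F E u.proj
    have hu : u ∈ t.source := FiberBundle.mem_trivializationAt_proj_source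
    have hv : v ∈ t.source := by
      rw [t.mem_source, ← hp]; exact FiberBundle.mem_baseSet_trivializationAt' _
    obtain ⟨O₁, O₂, h1, h2, h3, h4, h5⟩ := t2_separation (fun h => huv (t.injOn hu hv h))
    refine ⟨t.source ∩ t ⁻¹' O₁, t.source ∩ t ⁻¹' O₂,
      t.continuousOn.isOpen_inter_preimage t.open_source h1,
      t.continuousOn.isOpen_inter_preimage t.open_source h2, ⟨hu, h3⟩, ⟨hv, h4⟩, ?_⟩
    exact (h5.preimage t).mono Set.inter_subset_right Set.inter_subset_right
  · obtain ⟨O₁, O₂, h1, h2, h3, h4, h5⟩ := t2_separation hp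
    exact ⟨_, _, h1.preimage hcont, h2.preimage hcont, h3, h4, h5.preimage _⟩

theorem hasFDerivAt_comp_fst {V F : Type*} [NormedAddCommGroup V] [NormedSpace ℝ V]
    [NormedAddCommGroup F] [NormedSpace ℝ F] {f : V → F} {f' : V →L[ℝ] F} {q : V × V}
    (h : HasFDerivAt f f' q.1) :
    HasFDerivAt (fun q : V × V => f q.1) (f'.comp (ContinuousLinearMap.fst ℝ V V)) q :=
  h.comp q hasFDerivAt_fst

/-! ### The Lorentzian metric, its connection and its curvature in coordinates. -/

section LorentzCoordinates

variable {n : ℕ} {M : Type*} [TopologicalSpace M] [ChartedSpace (EuclideanSpace ℝ (Fin n)) M]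
  [IsManifold (𝓡 n) ∞ M]

local notation "𝔼" => EuclideanSpace ℝ (Fin n)

/-- The components of the metric in the preferred chart at `p`. -/
def LorentzMetric.coordMetric (g : LorentzMetric n M) (p : M) (z : 𝔼) : 𝔼 →L[ℝ] 𝔼 →L[ℝ] ℝ :=
  LinearMap.toContinuousBilinearMap (LinearMap.mk₂ ℝ
    (fun a b => g.val ((chartAt 𝔼 p).symm z) (dchartSymm p ((chartAt 𝔼 p).symm z) a)
      (dchartSymm p ((chartAt 𝔼 p).symm z) b))
    (by intros; simp only [map_add, add_apply]) (by intros; simp only [map_smul, smul_apply])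
    (by intros; simp only [map_add]) (by intros; simp only [map_smul]))

namespace LorentzMetric

variable (g : LorentzMetric n M)

theorem coordMetric_apply (p : M) (z a b : 𝔼) :
    g.coordMetric p z a b = g.val ((chartAt 𝔼 p).symm z)
      (dchartSymm p ((chartAt 𝔼 p).symm z) a) (dchartSymm p ((chartAt 𝔼 p).symm z) b) := rfl

theorem val_eq_coordMetric {p x : M} (hx : x ∈ (chartAt 𝔼 p).source)
    (ξ η : TangentSpace (𝓡 n) x) :
    g.val x ξ η = g.coordMetric p (chartAt 𝔼 p x) (dchart p x ξ) (dchart p x η) := by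
  have key : ∀ y, y = x → g.val y (dchartSymm p y (dchart p x ξ)) (dchartSymm p y (dchart p x η))
      = g.val x ξ η := by
    rintro _ rfl
    rw [dchartSymm_dchart hx, dchartSymm_dchart hx]
  exact (key _ ((chartAt 𝔼 p).left_inv hx)).symm

theorem eq_zero_of_forall (x : M) (w : TangentSpace (𝓡 n) x) (hw : ∀ u, g.val x w u = 0) :
    w = 0 := by
  obtain ⟨u, -, hu⟩ := g.signature x
  by_contra h0
  have := hu w (by rw [g.symm, hw]) h0
  rw [hw] at this
  exact lt_irrefl _ this

theorem isMetricOn_coordMetric (p : M) :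
    IsMetricOn (g.coordMetric p) (chartAt 𝔼 p).target where
  isOpen := (chartAt 𝔼 p).open_target
  contDiffOn := by
    refine contDiffOn_clm_apply.2 fun a => contDiffOn_clm_apply.2 fun b => ?_
    have h1 : ContMDiffOn (𝓡 n) ((𝓡 n).prod 𝓘(ℝ)) ∞
        (fun x : M => Bundle.TotalSpace.mk' ℝ (E := Bundle.Trivial M ℝ) x
          (g.val x (dchartSymm p x a) (dchartSymm p x b))) (chartAt 𝔼 p).source :=
      ContMDiffOn.clm_bundle_apply₂ (F₁ := 𝔼) (F₂ := 𝔼) g.contMDiff.contMDiffOn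
        (contMDiffOn_dchartSymm p a) (contMDiffOn_dchartSymm p b)
    have h2 : ContMDiffOn (𝓡 n) 𝓘(ℝ, ℝ) ∞
        (fun x : M => g.val x (dchartSymm p x a) (dchartSymm p x b)) (chartAt 𝔼 p).source :=
      fun x hx => (Bundle.contMDiffWithinAt_totalSpace.1 (h1 x hx)).2
    exact contMDiffOn_iff_contDiffOn.1 (h2.comp (contMDiffOn_chartAt_symm_self p)
      fun z hz => (chartAt 𝔼 p).map_target hz)
  symm z _ a b := by rw [coordMetric_apply, coordMetric_apply, g.symm]
  nondegenerate z hz a ha := by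
    have hx := (chartAt 𝔼 p).map_target hz
    have h1 : dchartSymm p ((chartAt 𝔼 p).symm z) a = 0 := by
      refine g.eq_zero_of_forall _ _ fun u => ?_
      have := ha (dchart p _ u)
      rwa [coordMetric_apply, dchartSymm_dchart hx] at this
    rw [← dchart_dchartSymm hx a, h1, map_zero]

theorem isMetricInChart {p x : M} (hx : x ∈ (chartAt 𝔼 p).source) :
    IsMetricInChart g.tensor (g.coordMetric p) p x where
  mem_source := hx
  eq := by
    filter_upwards [(chartAt 𝔼 p).open_source.mem_nhds hx] with y hy
    exact fun ξ η => g.val_eq_coordMetric hy ξ η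
  symm := (g.isMetricOn_coordMetric p).symm _ ((chartAt 𝔼 p).map_source hx)
  nondegenerate := (g.isMetricOn_coordMetric p).nondegenerate _ ((chartAt 𝔼 p).map_source hx)
  differentiableAt := ((g.isMetricOn_coordMetric p).contDiffOn.contDiffAt
    ((chartAt 𝔼 p).open_target.mem_nhds ((chartAt 𝔼 p).map_source hx))).differentiableAt (by simp)

/-- The Christoffel symbol of the metric in the preferred chart at `p`. -/
abbrev coordΓ (p : M) : 𝔼 → 𝔼 →L[ℝ] 𝔼 →L[ℝ] 𝔼 := christoffel (g.coordMetric p)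

variable {g} [T2Space M]

/-- Only differentiability in the chart is asked of the fields, so that the formula can be iterated:
the curvature applies it to covariant derivatives and to brackets. -/
theorem dchart_leviCivita {p x : M} (hx : x ∈ (chartAt 𝔼 p).source)
    {X Y : ∀ x : M, TangentSpace (𝓡 n) x}
    (hX : DifferentiableAt ℝ (coordField p X) (chartAt 𝔼 p x))
    (hY : DifferentiableAt ℝ (coordField p Y) (chartAt 𝔼 p x)) :
    dchart p x (leviCivita (𝓡 n) g.tensor X Y x)
      = fderiv ℝ (coordField p Y) (chartAt 𝔼 p x) (coordField p X (chartAt 𝔼 p x))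
        + g.coordΓ p (chartAt 𝔼 p x) (coordField p X (chartAt 𝔼 p x))
          (coordField p Y (chartAt 𝔼 p x)) := by
  have hz := (chartAt 𝔼 p).map_source hx
  refine (g.isMetricOn_coordMetric p).ext hz fun c => ?_
  have h := (g.isMetricInChart hx).leviCivita_eq hX hY c
  rw [(g.isMetricOn_coordMetric p).koszulCoord_eq hz] at h
  linarith

omit [T2Space M] in
theorem _root_.IsSmoothField.differentiableAt_coordField {X : ∀ x : M, TangentSpace (𝓡 n) x}
    (hX : IsSmoothField (𝓡 n) X) (p : M) {z : 𝔼} (hz : z ∈ (chartAt 𝔼 p).target) :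
    DifferentiableAt ℝ (coordField p X) z :=
  ((hX.contDiffOn_coordField p).contDiffAt ((chartAt 𝔼 p).open_target.mem_nhds hz)).differentiableAt
    (by simp)

theorem coordField_leviCivita {X Y : ∀ x : M, TangentSpace (𝓡 n) x}
    (hX : IsSmoothField (𝓡 n) X) (hY : IsSmoothField (𝓡 n) Y) (p : M) :
    Set.EqOn (coordField p (leviCivita (𝓡 n) g.tensor X Y))
      (fun z => fderiv ℝ (coordField p Y) z (coordField p X z)
        + g.coordΓ p z (coordField p X z) (coordField p Y z)) (chartAt 𝔼 p).target := by
  intro z hz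
  have hx := (chartAt 𝔼 p).map_target hz
  have hr := (chartAt 𝔼 p).right_inv hz
  have h := dchart_leviCivita (g := g) hx (X := X) (Y := Y)
    (by rw [hr]; exact hX.differentiableAt_coordField p hz)
    (by rw [hr]; exact hY.differentiableAt_coordField p hz)
  rw [hr] at h
  exact h

omit [T2Space M] in
theorem differentiableAt_coordΓ {p : M} {z : 𝔼} (hz : z ∈ (chartAt 𝔼 p).target) :
    DifferentiableAt ℝ (g.coordΓ p) z :=
  ((g.isMetricOn_coordMetric p).contDiffOn_christoffel.contDiffAt
    ((chartAt 𝔼 p).open_target.mem_nhds hz)).differentiableAt (by simp)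

theorem differentiableAt_coordField_leviCivita {X Y : ∀ x : M, TangentSpace (𝓡 n) x}
    (hX : IsSmoothField (𝓡 n) X) (hY : IsSmoothField (𝓡 n) Y) (p : M) {z : 𝔼}
    (hz : z ∈ (chartAt 𝔼 p).target) :
    DifferentiableAt ℝ (coordField p (leviCivita (𝓡 n) g.tensor X Y)) z := by
  have hopen := (chartAt 𝔼 p).open_target.mem_nhds hz
  refine DifferentiableAt.congr_of_eventuallyEq ?_
    ((coordField_leviCivita hX hY p).eventuallyEq_of_mem hopen)
  have h1 : DifferentiableAt ℝ (fderiv ℝ (coordField p Y)) z :=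
    (((hY.contDiffOn_coordField p).contDiffAt hopen).fderiv_right (m := ∞)
      (by simp)).differentiableAt (by simp)
  have h2 := hX.differentiableAt_coordField p hz
  have h3 := hY.differentiableAt_coordField p hz
  exact (h1.clm_apply h2).add (((differentiableAt_coordΓ hz).clm_apply h2).clm_apply h3)

/-- The curvature in the preferred chart. -/
theorem dchart_curvature {p x : M} (hx : x ∈ (chartAt 𝔼 p).source)
    {X Y Z : ∀ x : M, TangentSpace (𝓡 n) x} (hX : IsSmoothField (𝓡 n) X)
    (hY : IsSmoothField (𝓡 n) Y) (hZ : IsSmoothField (𝓡 n) Z) :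
    dchart p x (curvature (𝓡 n) g.tensor X Y Z x)
      = curvatureCoord (g.coordΓ p) (chartAt 𝔼 p x) (dchart p x (X x)) (dchart p x (Y x))
          (dchart p x (Z x)) := by
  have hz := (chartAt 𝔼 p).map_source hx
  have hopen := (chartAt 𝔼 p).open_target.mem_nhds hz
  have dX := hX.differentiableAt_coordField p hz
  have dY := hY.differentiableAt_coordField p hz
  have dZ := hZ.differentiableAt_coordField p hz
  have hbr : Set.EqOn (coordField p (VectorField.mlieBracket (𝓡 n) X Y))
      (fun z => fderiv ℝ (coordField p Y) z (coordField p X z)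
        - fderiv ℝ (coordField p X) z (coordField p Y z)) (chartAt 𝔼 p).target := by
    intro z hz
    have hx := (chartAt 𝔼 p).map_target hz
    have hr := (chartAt 𝔼 p).right_inv hz
    have h := dchart_mlieBracket hx (X := X) (Y := Y)
      (by rw [hr]; exact hX.differentiableAt_coordField p hz)
      (by rw [hr]; exact hY.differentiableAt_coordField p hz)
    rw [hr] at h
    exact h
  have dfd : ∀ {A : ∀ x : M, TangentSpace (𝓡 n) x}, IsSmoothField (𝓡 n) A →
      DifferentiableAt ℝ (fderiv ℝ (coordField p A)) (chartAt 𝔼 p x) := fun hA =>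
    (((hA.contDiffOn_coordField p).contDiffAt hopen).fderiv_right (m := ∞)
      (by simp)).differentiableAt (by simp)
  have dbr : DifferentiableAt ℝ (coordField p (VectorField.mlieBracket (𝓡 n) X Y))
      (chartAt 𝔼 p x) :=
    (((dfd hY).clm_apply dX).sub ((dfd hX).clm_apply dY)).congr_of_eventuallyEq
      (hbr.eventuallyEq_of_mem hopen)
  rw [curvature, map_sub, map_sub,
    dchart_leviCivita hx dX (differentiableAt_coordField_leviCivita hY hZ p hz),
    dchart_leviCivita hx dY (differentiableAt_coordField_leviCivita hX hZ p hz),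
    dchart_leviCivita hx dbr dZ,
    ((coordField_leviCivita hY hZ p).eventuallyEq_of_mem hopen).fderiv_eq,
    ((coordField_leviCivita hX hZ p).eventuallyEq_of_mem hopen).fderiv_eq,
    coordField_leviCivita hY hZ p hz, coordField_leviCivita hX hZ p hz, hbr hz,
    ← coordField_chartAt hx, ← coordField_chartAt hx, ← coordField_chartAt hx]
  exact curvatureCoord_fields (differentiableAt_coordΓ hz) dX dY
    ((hZ.contDiffOn_coordField p).contDiffAt hopen)

/-- Flatness in coordinates. -/
theorem isFlatMetric_iff :
    IsFlatMetric (𝓡 n) g.tensor ↔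
      ∀ (p : M) (a b c : 𝔼), curvatureCoord (g.coordΓ p) (chartAt 𝔼 p p) a b c = 0 := by
  have hs := fun p : M => mem_chart_source 𝔼 p
  constructor
  · intro h p a b c
    have hex : ∀ a : 𝔼, ∃ X : ∀ x : M, TangentSpace (𝓡 n) x, IsSmoothField (𝓡 n) X ∧
        dchart p p (X p) = a := by
      intro a
      obtain ⟨w, rfl⟩ := (dchart_bijective (hs p)).2 a
      obtain ⟨X, hX, rfl⟩ := exists_isSmoothField p w
      exact ⟨X, hX, rfl⟩
    obtain ⟨X, hX, rfl⟩ := hex a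
    obtain ⟨Y, hY, rfl⟩ := hex b
    obtain ⟨Z, hZ, rfl⟩ := hex c
    rw [← dchart_curvature (hs p) hX hY hZ, h X Y Z hX hY hZ, map_zero]
  · intro h X Y Z hX hY hZ p
    apply (dchart_bijective (hs p)).1
    rw [dchart_curvature (hs p) hX hY hZ, h, map_zero]

/-- The connection map in coordinates. -/
theorem dchart_connector {p : M} {v : TangentBundle (𝓡 n) M}
    (hv : v.proj ∈ (chartAt 𝔼 p).source) (ξ : TangentSpace (𝓡 n).tangent v) :
    dchart p v.proj (connector g v ξ)
      = (dtangentCoord p v ξ).2 + g.coordΓ p (chartAt 𝔼 p v.proj) (dtangentCoord p v ξ).1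
          (dchart p v.proj v.2) := by
  have hz := (chartAt 𝔼 p).map_source hv
  have hm := g.isMetricOn_coordMetric p
  have hGd : DifferentiableAt ℝ (g.coordMetric p) (chartAt 𝔼 p v.proj) :=
    (g.isMetricInChart hv).differentiableAt
  set a := (dtangentCoord p v ξ).1 with ha
  set b := (dtangentCoord p v ξ).2 with hb
  -- The product rule holds with the coordinate expression of the connection map: the derivative of
  -- the metric splits into two Christoffel terms, one completing b and the other completing ∇_X Z.
  have key : ∀ X Z : ∀ x : M, TangentSpace (𝓡 n) x,
      IsSmoothField (𝓡 n) X → IsSmoothField (𝓡 n) Z →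
      X v.proj = mfderiv (𝓡 n).tangent (𝓡 n)
        (fun u : TangentBundle (𝓡 n) M => u.proj) v ξ →
      mvfderiv (𝓡 n).tangent (fun u : TangentBundle (𝓡 n) M => g.val u.proj u.2 (Z u.proj)) v ξ
        = g.coordMetric p (chartAt 𝔼 p v.proj)
            (b + g.coordΓ p (chartAt 𝔼 p v.proj) a (dchart p v.proj v.2)) (dchart p v.proj (Z v.proj))
          + g.val v.proj v.2 (leviCivita (𝓡 n) g.tensor X Z v.proj) := by
    intro X Z hX hZ hXv
    have dX := hX.differentiableAt_coordField p hz
    have dZ := hZ.differentiableAt_coordField p hz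
    have hXa : coordField p X (chartAt 𝔼 p v.proj) = a := by
      rw [coordField_chartAt hv, hXv, dchart_mfderiv_proj hv]
    have hd2 : HasFDerivAt (fun q : 𝔼 × 𝔼 => coordField p Z q.1)
        ((fderiv ℝ (coordField p Z) (chartAt 𝔼 p v.proj)).comp (ContinuousLinearMap.fst ℝ 𝔼 𝔼))
        (tangentCoord p v) :=
      hasFDerivAt_comp_fst (q := tangentCoord p v) dZ.hasFDerivAt
    have hd3 : HasFDerivAt (fun q : 𝔼 × 𝔼 => g.coordMetric p q.1)
        ((fderiv ℝ (g.coordMetric p) (chartAt 𝔼 p v.proj)).comp (ContinuousLinearMap.fst ℝ 𝔼 𝔼))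
        (tangentCoord p v) :=
      hasFDerivAt_comp_fst (f := g.coordMetric p) (q := tangentCoord p v) hGd.hasFDerivAt
    have hd1 := hd3.differentiableAt
    have hev : (fun u : TangentBundle (𝓡 n) M => g.val u.proj u.2 (Z u.proj)) =ᶠ[𝓝 v]
        (fun q : 𝔼 × 𝔼 => g.coordMetric p q.1 q.2 (coordField p Z q.1)) ∘ tangentCoord p := by
      filter_upwards [(isOpen_proj_preimage p).mem_nhds hv] with u hu
      simp only [Function.comp_apply, tangentCoord]
      rw [g.val_eq_coordMetric hu, coordField_chartAt hu]
    rw [mvfderiv_tangentCoord hv hev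
      ((hd1.clm_apply differentiableAt_snd).clm_apply hd2.differentiableAt),
      fderiv_metric_apply hd1 differentiableAt_snd hd2.differentiableAt, hd2.fderiv, hd3.fderiv,
      fderiv_snd, g.val_eq_coordMetric hv, dchart_leviCivita hv dX dZ, hXa]
    simp only [ContinuousLinearMap.comp_apply, ContinuousLinearMap.coe_fst',
      ContinuousLinearMap.coe_snd', ← ha, ← hb]
    change fderiv ℝ (g.coordMetric p) (chartAt 𝔼 p v.proj) a (dchart p v.proj v.2)
        (coordField p Z (chartAt 𝔼 p v.proj))
      + g.coordMetric p (chartAt 𝔼 p v.proj) b (coordField p Z (chartAt 𝔼 p v.proj))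
      + g.coordMetric p (chartAt 𝔼 p v.proj) (dchart p v.proj v.2)
        (fderiv ℝ (coordField p Z) (chartAt 𝔼 p v.proj) a) = _
    rw [hm.fderiv_eq hz, coordField_chartAt hv]
    simp only [map_add, add_apply]
    ring
  have hex : ∃ w : TangentSpace (𝓡 n) v.proj, ∀ X Z : ∀ x : M, TangentSpace (𝓡 n) x,
      IsSmoothField (𝓡 n) X → IsSmoothField (𝓡 n) Z →
      X v.proj = mfderiv (𝓡 n).tangent (𝓡 n)
        (fun u : TangentBundle (𝓡 n) M => u.proj) v ξ →
      mvfderiv (𝓡 n).tangent (fun u : TangentBundle (𝓡 n) M => g.val u.proj u.2 (Z u.proj)) v ξ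
        = g.val v.proj w (Z v.proj)
          + g.val v.proj v.2 (leviCivita (𝓡 n) g.tensor X Z v.proj) := by
    obtain ⟨w, hw⟩ := (dchart_bijective hv).2
      (b + g.coordΓ p (chartAt 𝔼 p v.proj) a (dchart p v.proj v.2))
    refine ⟨w, fun X Z hX hZ hXv => ?_⟩
    rw [key X Z hX hZ hXv, g.val_eq_coordMetric hv w, hw]
  have hspec := Classical.epsilon_spec hex
  refine hm.ext hz fun c => ?_
  obtain ⟨w, rfl⟩ := (dchart_bijective hv).2 c
  obtain ⟨Z, hZ, rfl⟩ := exists_isSmoothField v.proj w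
  -- The characterizing property quantifies over extensions of dπ(ξ); an extension exists, so it is
  -- not vacuous.
  obtain ⟨X, hX, hXv⟩ := exists_isSmoothField v.proj (mfderiv (𝓡 n).tangent (𝓡 n)
        (fun u : TangentBundle (𝓡 n) M => u.proj) v ξ)
  have h1 := hspec X Z hX hZ hXv
  rw [key X Z hX hZ hXv] at h1
  rw [← g.val_eq_coordMetric hv]
  exact (add_right_cancel h1).symm

end LorentzMetric

end LorentzCoordinates

/-! ### Construction of the charts of the null congruence. -/

section NullCongruence

variable {n : ℕ} {M : Type*} [TopologicalSpace M] [ChartedSpace (EuclideanSpace ℝ (Fin n)) M]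
  [IsManifold (𝓡 n) ∞ M]

local notation "𝔼" => EuclideanSpace ℝ (Fin n)
local notation "𝔽" => EuclideanSpace ℝ (Fin (2 * (n - 1)))

/-- The orthogonal complement of a timelike vector is positive definite. -/
theorem LorentzMetric.pos_of_orthogonal (g : LorentzMetric n M) {x : M}
    {k w : TangentSpace (𝓡 n) x} (hk : g.val x k k < 0) (hw : g.val x k w = 0) (hw0 : w ≠ 0) :
    0 < g.val x w w := by
  obtain ⟨u, -, hu⟩ := g.signature x
  have hk0 : k ≠ 0 := by rintro rfl; simp at hk
  have ht : g.val x u k ≠ 0 := fun h => (hu k h hk0).not_gt hk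
  -- This combination of w and k is orthogonal to u, so it is spacelike: g(u,k)² g(w,w) + g(u,w)²
  -- g(k,k) > 0. As g(k,k) < 0, the first term must be positive.
  have hz : g.val x u (g.val x u k • w - g.val x u w • k) = 0 := by
    simp only [map_sub, map_smul, smul_eq_mul]; ring
  have hwk : g.val x w k = 0 := by rw [g.symm, hw]
  have hz0 : g.val x u k • w - g.val x u w • k ≠ 0 := by
    intro h
    have h1 := congrArg (g.val x k) h
    simp only [map_sub, map_smul, smul_eq_mul, hw, mul_zero, map_zero, zero_sub, neg_eq_zero,
      mul_eq_zero, hk.ne, or_false] at h1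
    rw [h1, zero_smul, sub_zero, smul_eq_zero] at h
    exact h.elim ht hw0
  have hpos := hu _ hz hz0
  simp only [map_sub, map_smul, sub_apply, smul_apply, smul_eq_mul, hw, hwk] at hpos
  have h2 : 0 ≤ -(g.val x u w ^ 2 * g.val x k k) := by
    rw [← mul_neg]; exact mul_nonneg (sq_nonneg _) (neg_nonneg.2 hk.le)
  have h3 : 0 < g.val x u k ^ 2 * g.val x w w := by nlinarith
  exact pos_of_mul_pos_right h3 (sq_nonneg _)

variable {g : LorentzMetric n M} {K : TimelikeField g}

/-- `D` is the chart at `v₀` of the null congruence, read in the chart of the base at `π(v₀)`. -/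
structure IsChartOfCongruence (D : CongruenceChart 𝔼 𝔽) (v₀ : nullCongruence g K) : Prop where
  G_eq : D.G = g.coordMetric (v₀ : TangentBundle (𝓡 n) M).proj
  subset : D.Ω ⊆ (chartAt 𝔽 v₀).target
  mem : chartAt 𝔽 v₀ v₀ ∈ D.Ω
  proj_mem : ∀ y ∈ D.Ω, ((chartAt 𝔽 v₀).symm y : TangentBundle (𝓡 n) M).proj ∈
    (chartAt 𝔼 (v₀ : TangentBundle (𝓡 n) M).proj).source
  coord : ∀ y, tangentCoord (v₀ : TangentBundle (𝓡 n) M).proj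
    ((chartAt 𝔽 v₀).symm y : TangentBundle (𝓡 n) M) = (D.F y, D.W y)

theorem isSubmanifoldChart_chartAt (v₀ : nullCongruence g K) :
    IsSubmanifoldChart (𝓡 n).tangent (nullCongruence g K) (2 * (n - 1)) (chartAt 𝔽 v₀) :=
  (isEmbeddedSubmanifold_nullCongruence g K v₀).choose_spec.1

/-- F and W are the bundle coordinates of the inverse chart. The left inverse Λ comes from the
smooth local extension r of the chart to the tangent bundle: r composed with the inverse chart is
the identity, and this is differentiated. -/
theorem exists_isChartOfCongruence (hn : 3 ≤ n) (v₀ : nullCongruence g K) :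
    ∃ D : CongruenceChart 𝔼 𝔽, IsChartOfCongruence D v₀ := by
  set p := (v₀ : TangentBundle (𝓡 n) M).proj with hp
  set e := chartAt 𝔼 p with he
  set φ := chartAt 𝔽 v₀ with hφ
  obtain ⟨hsm, hloc⟩ := isSubmanifoldChart_chartAt v₀
  obtain ⟨O, hO, hvO, r, hr, hrφ⟩ := hloc v₀ (mem_chart_source 𝔽 v₀)
  let ι : 𝔽 → TangentBundle (𝓡 n) M := fun y => (φ.symm y : TangentBundle (𝓡 n) M)
  let S : Set (TangentBundle (𝓡 n) M) := O ∩ {u | u.proj ∈ e.source}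
  have hS : IsOpen S := hO.inter (isOpen_proj_preimage p)
  let Ω : Set 𝔽 := φ.target ∩ ι ⁻¹' S
  have hΩ : IsOpen Ω := hsm.continuousOn.isOpen_inter_preimage φ.open_target hS
  let T : 𝔽 → 𝔼 × 𝔼 := fun y => tangentCoord p (ι y)
  have hT : ContDiffOn ℝ ∞ T Ω :=
    contMDiffOn_iff_contDiffOn.1 ((contMDiffOn_tangentCoord p).comp
      (hsm.mono fun y hy => hy.1) fun y hy => hy.2.2)
  let Q : Set (𝔼 × 𝔼) := {q | q.1 ∈ e.target} ∩ tangentCoordSymm p ⁻¹' O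
  have hQ : IsOpen Q := (contMDiffOn_tangentCoordSymm p).continuousOn.isOpen_inter_preimage
    (e.open_target.preimage continuous_fst) hO
  have hR : ContDiffOn ℝ ∞ (fun q : 𝔼 × 𝔼 => r (tangentCoordSymm p q)) Q :=
    contMDiffOn_iff_contDiffOn.1 (hr.comp ((contMDiffOn_tangentCoordSymm p).mono fun q hq => hq.1)
      fun q hq => hq.2)
  have hTQ : ∀ y ∈ Ω, T y ∈ Q := fun y hy => by
    refine ⟨e.map_source hy.2.2, ?_⟩
    change tangentCoordSymm p (tangentCoord p (ι y)) ∈ O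
    rw [tangentCoordSymm_tangentCoord hy.2.2]
    exact hy.2.1
  have hRT : ∀ y ∈ Ω, r (tangentCoordSymm p (T y)) = y := fun y hy => by
    change r (tangentCoordSymm p (tangentCoord p (ι y))) = y
    rw [tangentCoordSymm_tangentCoord hy.2.2]
    exact (hrφ _ (φ.map_target hy.1) hy.2.1).trans (φ.right_inv hy.1)
  have hmem : ∀ y ∈ Ω, ι y ∈ nullCongruence g K := fun y _ => (φ.symm y).2
  have hF : ContDiffOn ℝ ∞ (fun y => (T y).1) Ω := contDiff_fst.comp_contDiffOn hT
  have hW : ContDiffOn ℝ ∞ (fun y => (T y).2) Ω := contDiff_snd.comp_contDiffOn hT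
  let D : CongruenceChart 𝔼 𝔽 :=
    { G := g.coordMetric p
      U := e.target
      K := coordField p K.val
      Ω := Ω
      F := fun y => (T y).1
      W := fun y => (T y).2
      Λ := fun y => fderiv ℝ (fun q : 𝔼 × 𝔼 => r (tangentCoordSymm p q)) (T y)
      metric := g.isMetricOn_coordMetric p
      isOpen := hΩ
      mapsTo := fun y hy => (hTQ y hy).1
      contDiffOn_K := K.smooth.contDiffOn_coordField p
      contDiffOn_F := hF
      contDiffOn_W := hW
      contDiffOn_Λ := (hR.fderiv_of_isOpen hQ (by simp)).comp hT hTQ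
      null := fun y hy => (g.val_eq_coordMetric hy.2.2 _ _).symm.trans (hmem y hy).1
      normalized := fun y hy => by
        refine Eq.trans ?_ (hmem y hy).2
        rw [g.val_eq_coordMetric hy.2.2, ← coordField_chartAt hy.2.2]
        rfl
      pos := fun z hz w hw hw0 => by
        have hx := e.map_target hz
        refine g.pos_of_orthogonal (K.timelike (e.symm z)) ?_ fun h => hw0 ?_
        · rw [g.val_eq_coordMetric hx, dchart_dchartSymm hx, e.right_inv hz]
          exact hw
        · rw [← dchart_dchartSymm hx w, h, map_zero]
      left_inv := fun y hy ξ => by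
        have h1 : HasFDerivAt T (fderiv ℝ T y) y :=
          ((hT.contDiffAt (hΩ.mem_nhds hy)).differentiableAt (by simp)).hasFDerivAt
        have h2 : HasFDerivAt (fun q : 𝔼 × 𝔼 => r (tangentCoordSymm p q)) _ (T y) :=
          ((hR.contDiffAt (hQ.mem_nhds (hTQ y hy))).differentiableAt (by simp)).hasFDerivAt
        have h3 : HasFDerivAt (fun y => r (tangentCoordSymm p (T y)))
            (ContinuousLinearMap.id ℝ 𝔽) y := by
          refine (hasFDerivAt_id y).congr_of_eventuallyEq ?_
          filter_upwards [hΩ.mem_nhds hy] with y hy using hRT y hy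
        have h4 := congrArg (fun L => L ξ) ((h2.comp y h1).unique h3)
        rw [h1.fst.fderiv, h1.snd.fderiv]
        exact h4
      -- With truncated subtraction, 2(n-1) + 2 = 2n needs n ≥ 1.
      finrank_eq := by simp only [finrank_euclideanSpace, Fintype.card_fin]; omega }
  refine ⟨D, rfl, fun y hy => hy.1, ?_, fun y hy => hy.2.2, fun y => rfl⟩
  have h0 : ι (φ v₀) = v₀ := by
    change ((φ.symm (φ v₀) : nullCongruence g K) : TangentBundle (𝓡 n) M) = v₀
    rw [φ.left_inv (mem_chart_source 𝔽 v₀)]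
  refine ⟨mem_chart_target 𝔽 v₀, ?_⟩
  change ι (φ v₀) ∈ S
  rw [h0]
  exact ⟨hvO, mem_chart_source 𝔼 p⟩

end NullCongruence

/-! ### The induced metric and the vertical projection in a chart of the congruence. -/

section NullCongruenceCoordinates

variable {n : ℕ} {M : Type*} [TopologicalSpace M] [ChartedSpace (EuclideanSpace ℝ (Fin n)) M]
  [IsManifold (𝓡 n) ∞ M] {g : LorentzMetric n M} {K : TimelikeField g}

local notation "𝔼" => EuclideanSpace ℝ (Fin n)
local notation "𝔽" => EuclideanSpace ℝ (Fin (2 * (n - 1)))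

theorem mdifferentiableAt_val (v₀ : nullCongruence g K) {s : nullCongruence g K}
    (hs : s ∈ (chartAt 𝔽 v₀).source) :
    MDifferentiableAt (𝓡 (2 * (n - 1))) (𝓡 n).tangent
      (Subtype.val : nullCongruence g K → TangentBundle (𝓡 n) M) s := by
  have h1 := ((isSubmanifoldChart_chartAt v₀).1.contMDiffAt
    ((chartAt 𝔽 v₀).open_target.mem_nhds ((chartAt 𝔽 v₀).map_source hs))).mdifferentiableAt
    (by simp)
  refine (MDifferentiableAt.comp s h1
    ((mdifferentiable_chartAt v₀).mdifferentiableAt hs)).congr_of_eventuallyEq ?_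
  filter_upwards [(chartAt 𝔽 v₀).open_source.mem_nhds hs] with t ht
  simp only [Function.comp_apply]
  rw [(chartAt 𝔽 v₀).left_inv ht]

namespace IsChartOfCongruence

variable {D : CongruenceChart (EuclideanSpace ℝ (Fin n)) (EuclideanSpace ℝ (Fin (2 * (n - 1))))}
  {v₀ : nullCongruence g K} (H : IsChartOfCongruence D v₀)
include H

/-- The domain of the chart in the congruence. -/
theorem nhds : (chartAt 𝔽 v₀).source ∩ chartAt 𝔽 v₀ ⁻¹' D.Ω ∈ 𝓝 v₀ :=
  ((chartAt 𝔽 v₀).isOpen_inter_preimage D.isOpen).mem_nhds ⟨mem_chart_source 𝔽 v₀, H.mem⟩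

variable {s : nullCongruence g K} (hs : s ∈ (chartAt (EuclideanSpace ℝ (Fin (2 * (n - 1)))) v₀).source ∩
    chartAt (EuclideanSpace ℝ (Fin (2 * (n - 1)))) v₀ ⁻¹' D.Ω)
include hs

theorem proj_mem_source : (s : TangentBundle (𝓡 n) M).proj ∈
    (chartAt 𝔼 (v₀ : TangentBundle (𝓡 n) M).proj).source := by
  have := H.proj_mem _ hs.2
  rwa [(chartAt 𝔽 v₀).left_inv hs.1] at this

theorem tangentCoord_eq : tangentCoord (v₀ : TangentBundle (𝓡 n) M).proj
    (s : TangentBundle (𝓡 n) M) = (D.F (chartAt 𝔽 v₀ s), D.W (chartAt 𝔽 v₀ s)) := by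
  rw [← H.coord, (chartAt 𝔽 v₀).left_inv hs.1]

theorem dtangentCoord_mfderiv_val (ζ : TangentSpace (𝓡 (2 * (n - 1))) s) :
    dtangentCoord (v₀ : TangentBundle (𝓡 n) M).proj (s : TangentBundle (𝓡 n) M)
        (mfderiv (𝓡 (2 * (n - 1))) (𝓡 n).tangent (Subtype.val : nullCongruence g K → _) s ζ)
      = (D.dF (chartAt 𝔽 v₀ s) (dchart v₀ s ζ),
          fderiv ℝ D.W (chartAt 𝔽 v₀ s) (dchart v₀ s ζ)) := by
  set p := (v₀ : TangentBundle (𝓡 n) M).proj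
  have hpair := (((CongruenceChart.contDiffAt_F hs.2).differentiableAt (by simp)).hasFDerivAt).prodMk
    ((CongruenceChart.contDiffAt_W hs.2).differentiableAt (by simp)).hasFDerivAt
  have hfun : (fun t : nullCongruence g K => tangentCoord p (t : TangentBundle (𝓡 n) M))
      ∘ (chartAt 𝔽 v₀).symm = fun y => (D.F y, D.W y) := funext fun y => H.coord y
  have h1 := mvfderiv_eq_fderiv_chart hs.1
    (f := fun t : nullCongruence g K => tangentCoord p (t : TangentBundle (𝓡 n) M))
    (by rw [hfun]; exact hpair.differentiableAt) ζ
  rw [hfun, hpair.fderiv] at h1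
  refine Eq.trans ?_ h1
  have h2 : MDifferentiableAt (𝓡 n).tangent 𝓘(ℝ, 𝔼 × 𝔼) (tangentCoord p)
      (s : TangentBundle (𝓡 n) M) :=
    ((contMDiffOn_tangentCoord p).contMDiffAt
      ((isOpen_proj_preimage p).mem_nhds (H.proj_mem_source hs))).mdifferentiableAt (by simp)
  exact (congrArg (fun T => T ζ) (mfderiv_comp s h2 (mdifferentiableAt_val v₀ hs.1))).symm

theorem dchart_mfderiv_proj (ζ : TangentSpace (𝓡 (2 * (n - 1))) s) :
    dchart (v₀ : TangentBundle (𝓡 n) M).proj (s : TangentBundle (𝓡 n) M).proj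
        (mfderiv (𝓡 n).tangent (𝓡 n) (fun u : TangentBundle (𝓡 n) M => u.proj) s
          (mfderiv (𝓡 (2 * (n - 1))) (𝓡 n).tangent (Subtype.val : nullCongruence g K → _) s ζ))
      = D.dF (chartAt 𝔽 v₀ s) (dchart v₀ s ζ) := by
  rw [_root_.dchart_mfderiv_proj (H.proj_mem_source hs), H.dtangentCoord_mfderiv_val hs]

theorem mem_verticalSpace_iff (ζ : TangentSpace (𝓡 (2 * (n - 1))) s) :
    ζ ∈ verticalSpace (𝓡 (2 * (n - 1))) (𝓡 n) (congruenceProj g K) s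
      ↔ D.dF (chartAt 𝔽 v₀ s) (dchart v₀ s ζ) = 0 := by
  have h1 : MDifferentiableAt (𝓡 n).tangent (𝓡 n) (fun u : TangentBundle (𝓡 n) M => u.proj)
      (s : TangentBundle (𝓡 n) M) := (Bundle.contMDiff_proj (n := ∞) _).mdifferentiableAt (by simp)
  have h2 := congrArg (fun T => T ζ) (mfderiv_comp s h1 (mdifferentiableAt_val v₀ hs.1))
  have h3 : mfderiv (𝓡 (2 * (n - 1))) (𝓡 n) (congruenceProj g K) s ζ
      = mfderiv (𝓡 n).tangent (𝓡 n) (fun u : TangentBundle (𝓡 n) M => u.proj) s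
          (mfderiv (𝓡 (2 * (n - 1))) (𝓡 n).tangent (Subtype.val : nullCongruence g K → _) s ζ) :=
    h2
  rw [← H.dchart_mfderiv_proj hs, ← h3]
  exact (map_eq_zero_iff _ (dchart_bijective (H.proj_mem_source hs)).1).symm

variable [T2Space M]

theorem dchart_connector (ζ : TangentSpace (𝓡 (2 * (n - 1))) s) :
    dchart (v₀ : TangentBundle (𝓡 n) M).proj (s : TangentBundle (𝓡 n) M).proj
        (connector g s
          (mfderiv (𝓡 (2 * (n - 1))) (𝓡 n).tangent (Subtype.val : nullCongruence g K → _) s ζ))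
      = D.conn (chartAt 𝔽 v₀ s) (dchart v₀ s ζ) := by
  have h := H.tangentCoord_eq hs
  have h1 : chartAt 𝔼 (v₀ : TangentBundle (𝓡 n) M).proj (s : TangentBundle (𝓡 n) M).proj
    = D.F (chartAt 𝔽 v₀ s) := congrArg Prod.fst h
  have h2 : dchart (v₀ : TangentBundle (𝓡 n) M).proj (s : TangentBundle (𝓡 n) M).proj
    (s : TangentBundle (𝓡 n) M).2 = D.W (chartAt 𝔽 v₀ s) := congrArg Prod.snd h
  rw [LorentzMetric.dchart_connector (H.proj_mem_source hs), H.dtangentCoord_mfderiv_val hs, h1, h2,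
    CongruenceChart.conn_apply, CongruenceChart.Γ, H.G_eq]

theorem congruenceMetric_eq (ζ ξ : TangentSpace (𝓡 (2 * (n - 1))) s) :
    congruenceMetric g K s ζ ξ
      = D.metricC (chartAt 𝔽 v₀ s) (dchart v₀ s ζ) (dchart v₀ s ξ) := by
  have h1 : chartAt 𝔼 (v₀ : TangentBundle (𝓡 n) M).proj (s : TangentBundle (𝓡 n) M).proj
    = D.F (chartAt 𝔽 v₀ s) := congrArg Prod.fst (H.tangentCoord_eq hs)
  rw [congruenceMetric, sasaki, g.val_eq_coordMetric (H.proj_mem_source hs),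
    g.val_eq_coordMetric (H.proj_mem_source hs), H.dchart_mfderiv_proj hs,
    H.dchart_mfderiv_proj hs, H.dchart_connector hs, H.dchart_connector hs, h1,
    CongruenceChart.metricC_apply, H.G_eq]

theorem isMetricInChart : IsMetricInChart (congruenceMetric g K) D.metricC v₀ s where
  mem_source := hs.1
  eq := by
    filter_upwards [((chartAt 𝔽 v₀).isOpen_inter_preimage D.isOpen).mem_nhds hs] with t ht
    exact H.congruenceMetric_eq ht
  symm := CongruenceChart.metricC_symm hs.2
  nondegenerate := CongruenceChart.metricC_nondegenerate hs.2
  differentiableAt := (CongruenceChart.contDiffAt_metricC hs.2).differentiableAt (by simp)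

/-- The coordinate projection satisfies the defining property of the vertical part, so the chosen
vector does too. Two such vectors differ by a vertical vector orthogonal to itself, which is zero as
the fibres are definite. -/
theorem dchart_verticalPart (ξ : TangentSpace (𝓡 (2 * (n - 1))) s) :
    dchart v₀ s (verticalPart (𝓡 (2 * (n - 1))) (𝓡 n) (congruenceMetric g K)
      (congruenceProj g K) s ξ) = D.vert (chartAt 𝔽 v₀ s) (dchart v₀ s ξ) := by
  set y := chartAt 𝔽 v₀ s
  have hy : y ∈ D.Ω := hs.2
  have hex : ∃ w : TangentSpace (𝓡 (2 * (n - 1))) s,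
      w ∈ verticalSpace (𝓡 (2 * (n - 1))) (𝓡 n) (congruenceProj g K) s ∧
      ∀ u ∈ verticalSpace (𝓡 (2 * (n - 1))) (𝓡 n) (congruenceProj g K) s,
        congruenceMetric g K s (ξ - w) u = 0 := by
    obtain ⟨w, hw⟩ := (dchart_bijective hs.1).2 (D.vert y (dchart v₀ s ξ))
    refine ⟨w, (H.mem_verticalSpace_iff hs w).2 ?_, fun u hu => ?_⟩
    · rw [hw]; exact CongruenceChart.dF_vert hy _
    · rw [H.congruenceMetric_eq hs, map_sub, hw]
      exact CongruenceChart.metricC_horizontal_vertical hy (CongruenceChart.vert_sub_vert hy _)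
        ((H.mem_verticalSpace_iff hs u).1 hu)
  obtain ⟨h1, h2⟩ := Classical.epsilon_spec hex
  change dchart v₀ s (Classical.epsilon _) = _
  set w := Classical.epsilon fun w : TangentSpace (𝓡 (2 * (n - 1))) s =>
      w ∈ verticalSpace (𝓡 (2 * (n - 1))) (𝓡 n) (congruenceProj g K) s ∧
      ∀ u ∈ verticalSpace (𝓡 (2 * (n - 1))) (𝓡 n) (congruenceProj g K) s,
        congruenceMetric g K s (ξ - w) u = 0
  have hv := (H.mem_verticalSpace_iff hs w).1 h1
  have hd : D.dF y (dchart v₀ s w - D.vert y (dchart v₀ s ξ)) = 0 := by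
    rw [map_sub, hv, CongruenceChart.dF_vert hy, sub_zero]
  by_contra hne
  refine (CongruenceChart.pos_of_vertical hy hd (sub_ne_zero.2 hne)).ne' ?_
  obtain ⟨u, hu⟩ := (dchart_bijective hs.1).2 (dchart v₀ s w - D.vert y (dchart v₀ s ξ))
  have h3 := h2 u ((H.mem_verticalSpace_iff hs u).2 (by rw [hu]; exact hd))
  rw [H.congruenceMetric_eq hs, hu, map_sub (dchart v₀ s)] at h3
  have h4 := CongruenceChart.metricC_horizontal_vertical hy
    (CongruenceChart.vert_sub_vert hy (dchart v₀ s ξ)) hd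
  have h5 : ∀ a b c d : 𝔽,
      D.metricC y (a - b) d = D.metricC y (c - b) d - D.metricC y (c - a) d := by
    intro a b c d
    simp only [map_sub, sub_apply]
    ring
  rw [h5 _ _ (dchart v₀ s ξ), h4, h3, sub_zero]

theorem dchart_horizontalPart (ξ : TangentSpace (𝓡 (2 * (n - 1))) s) :
    dchart v₀ s (horizontalPart (𝓡 (2 * (n - 1))) (𝓡 n) (congruenceMetric g K)
      (congruenceProj g K) s ξ)
      = dchart v₀ s ξ - D.vert (chartAt 𝔽 v₀ s) (dchart v₀ s ξ) := by
  rw [horizontalPart, map_sub, H.dchart_verticalPart hs]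

end IsChartOfCongruence

end NullCongruenceCoordinates

/-! ### The O'Neill tensor in a chart of the congruence. -/

section ONeill

theorem koszulCoord_congr {V : Type*} [NormedAddCommGroup V] [NormedSpace ℝ V]
    {h : V → V →L[ℝ] V →L[ℝ] ℝ} {X X' Y Y' : V → V} {z : V} (hX : X =ᶠ[𝓝 z] X')
    (hY : Y =ᶠ[𝓝 z] Y') : koszulCoord h X Y z = koszulCoord h X' Y' z := by
  rw [koszulCoord, koszulCoord, hX.self_of_nhds, hY.self_of_nhds, hY.fderiv_eq]

variable {n : ℕ} {M : Type*} [TopologicalSpace M] [ChartedSpace (EuclideanSpace ℝ (Fin n)) M]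
  [IsManifold (𝓡 n) ∞ M] [T2Space M] {g : LorentzMetric n M} {K : TimelikeField g}

local notation "𝔼" => EuclideanSpace ℝ (Fin n)
local notation "𝔽" => EuclideanSpace ℝ (Fin (2 * (n - 1)))

/-- Extending tangent vectors of the congruence to smooth fields requires it to be Hausdorff. -/
theorem t2Space_nullCongruence (g : LorentzMetric n M) (K : TimelikeField g) :
    T2Space (nullCongruence g K) :=
  have : T2Space (TangentBundle (𝓡 n) M) := t2Space_totalSpace
  inferInstance

namespace IsChartOfCongruence

variable {D : CongruenceChart (EuclideanSpace ℝ (Fin n)) (EuclideanSpace ℝ (Fin (2 * (n - 1))))}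
  {v₀ : nullCongruence g K} (H : IsChartOfCongruence D v₀)
include H

theorem coordField_verticalPart {y : 𝔽} (hy : y ∈ D.Ω)
    (E : ∀ v : nullCongruence g K, TangentSpace (𝓡 (2 * (n - 1))) v) :
    coordField v₀ (fun s => verticalPart (𝓡 (2 * (n - 1))) (𝓡 n) (congruenceMetric g K)
      (congruenceProj g K) s (E s)) y = D.vert y (coordField v₀ E y) := by
  have hr := (chartAt 𝔽 v₀).right_inv (H.subset hy)
  have h := H.dchart_verticalPart (s := (chartAt 𝔽 v₀).symm y)
    ⟨(chartAt 𝔽 v₀).map_target (H.subset hy), by rwa [Set.mem_preimage, hr]⟩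
    (E ((chartAt 𝔽 v₀).symm y))
  rw [hr] at h
  exact h

theorem coordField_horizontalPart {y : 𝔽} (hy : y ∈ D.Ω)
    (E : ∀ v : nullCongruence g K, TangentSpace (𝓡 (2 * (n - 1))) v) :
    coordField v₀ (fun s => horizontalPart (𝓡 (2 * (n - 1))) (𝓡 n) (congruenceMetric g K)
      (congruenceProj g K) s (E s)) y = coordField v₀ E y - D.vert y (coordField v₀ E y) := by
  rw [← H.coordField_verticalPart hy]
  exact map_sub (dchart v₀ ((chartAt 𝔽 v₀).symm y)) _ _

/-- The fundamental tensor in the chart of the congruence. -/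
theorem exists_dchart_oneillA {E₁ E₂ : ∀ v : nullCongruence g K, TangentSpace (𝓡 (2 * (n - 1))) v}
    (h₁ : IsSmoothField (𝓡 (2 * (n - 1))) E₁) (h₂ : IsSmoothField (𝓡 (2 * (n - 1))) E₂) :
    ∃ (X Y Q : 𝔽 → 𝔽) (w₁ w₂ : 𝔽),
      (∀ y ∈ D.Ω, DifferentiableAt ℝ X y ∧ DifferentiableAt ℝ Y y ∧ DifferentiableAt ℝ Q y) ∧
      (∀ y ∈ D.Ω, D.vert y (X y) = 0) ∧ (∀ y ∈ D.Ω, D.vert y (Y y) = 0) ∧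
      (∀ y ∈ D.Ω, D.dF y (Q y) = 0) ∧
      (∀ y ∈ D.Ω, D.dF y (X y) = D.dF y (coordField v₀ E₁ y)) ∧
      (∀ y ∈ D.Ω, D.dF y (Y y) = D.dF y (coordField v₀ E₂ y)) ∧
      (∀ ζ, 2 * D.metricC (chartAt 𝔽 v₀ v₀) w₁ ζ = koszulCoord D.metricC X Q (chartAt 𝔽 v₀ v₀) ζ) ∧
      (∀ ζ, 2 * D.metricC (chartAt 𝔽 v₀ v₀) w₂ ζ = koszulCoord D.metricC X Y (chartAt 𝔽 v₀ v₀) ζ) ∧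
      dchart v₀ v₀ (oneillA (𝓡 (2 * (n - 1))) (𝓡 n) (congruenceMetric g K) (congruenceProj g K)
        E₁ E₂ v₀) = (w₁ - D.vert (chartAt 𝔽 v₀ v₀) w₁) + D.vert (chartAt 𝔽 v₀ v₀) w₂ := by
  have := t2Space_nullCongruence g K
  have hs : v₀ ∈ (chartAt 𝔽 v₀).source ∩ chartAt 𝔽 v₀ ⁻¹' D.Ω := mem_of_mem_nhds H.nhds
  have hΩ := D.isOpen.mem_nhds H.mem
  have hd : ∀ {E : ∀ v : nullCongruence g K, TangentSpace (𝓡 (2 * (n - 1))) v},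
      IsSmoothField (𝓡 (2 * (n - 1))) E → ∀ y ∈ D.Ω, DifferentiableAt ℝ (coordField v₀ E) y :=
    fun hE y hy => ((hE.contDiffOn_coordField v₀).contDiffAt
      ((chartAt 𝔽 v₀).open_target.mem_nhds (H.subset hy))).differentiableAt (by simp)
  have hdv : ∀ {E : ∀ v : nullCongruence g K, TangentSpace (𝓡 (2 * (n - 1))) v},
      IsSmoothField (𝓡 (2 * (n - 1))) E → ∀ y ∈ D.Ω,
        DifferentiableAt ℝ (fun y => D.vert y (coordField v₀ E y)) y :=
    fun hE y hy => ((CongruenceChart.contDiffAt_vert hy).differentiableAt (by simp)).clm_apply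
      (hd hE y hy)
  have hdh : ∀ {E : ∀ v : nullCongruence g K, TangentSpace (𝓡 (2 * (n - 1))) v},
      IsSmoothField (𝓡 (2 * (n - 1))) E → ∀ y ∈ D.Ω,
        DifferentiableAt ℝ (fun y => coordField v₀ E y - D.vert y (coordField v₀ E y)) y :=
    fun hE y hy => (hd hE y hy).sub (hdv hE y hy)
  have ev : ∀ E : ∀ v : nullCongruence g K, TangentSpace (𝓡 (2 * (n - 1))) v,
      coordField v₀ (fun s => verticalPart (𝓡 (2 * (n - 1))) (𝓡 n) (congruenceMetric g K)
        (congruenceProj g K) s (E s)) =ᶠ[𝓝 (chartAt 𝔽 v₀ v₀)]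
        fun y => D.vert y (coordField v₀ E y) := fun E => by
    filter_upwards [hΩ] with y hy using H.coordField_verticalPart hy E
  have eh : ∀ E : ∀ v : nullCongruence g K, TangentSpace (𝓡 (2 * (n - 1))) v,
      coordField v₀ (fun s => horizontalPart (𝓡 (2 * (n - 1))) (𝓡 n) (congruenceMetric g K)
        (congruenceProj g K) s (E s)) =ᶠ[𝓝 (chartAt 𝔽 v₀ v₀)]
        fun y => coordField v₀ E y - D.vert y (coordField v₀ E y) := fun E => by
    filter_upwards [hΩ] with y hy using H.coordField_horizontalPart hy E
  have hm := H.isMetricInChart hs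
  -- X and Y are the horizontal parts of E₁ and E₂, Q is the vertical part of E₂; w₁ and w₂ are the
  -- coordinates of ∇_X Q and ∇_X Y.
  refine ⟨fun y => coordField v₀ E₁ y - D.vert y (coordField v₀ E₁ y),
    fun y => coordField v₀ E₂ y - D.vert y (coordField v₀ E₂ y),
    fun y => D.vert y (coordField v₀ E₂ y), _, _,
    fun y hy => ⟨hdh h₁ y hy, hdh h₂ y hy, hdv h₂ y hy⟩,
    fun y hy => CongruenceChart.vert_sub_vert hy _, fun y hy => CongruenceChart.vert_sub_vert hy _,
    fun y hy => CongruenceChart.dF_vert hy _,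
    fun y hy => by rw [map_sub, CongruenceChart.dF_vert hy, sub_zero],
    fun y hy => by rw [map_sub, CongruenceChart.dF_vert hy, sub_zero],
    fun ζ => (hm.leviCivita_eq ((hdh h₁ _ H.mem).congr_of_eventuallyEq (eh E₁))
      ((hdv h₂ _ H.mem).congr_of_eventuallyEq (ev E₂)) ζ).trans ?_,
    fun ζ => (hm.leviCivita_eq ((hdh h₁ _ H.mem).congr_of_eventuallyEq (eh E₁))
      ((hdh h₂ _ H.mem).congr_of_eventuallyEq (eh E₂)) ζ).trans ?_, ?_⟩
  · rw [koszulCoord_congr (eh E₁) (ev E₂)]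
  · rw [koszulCoord_congr (eh E₁) (eh E₂)]
  · rw [oneillA, map_add, H.dchart_horizontalPart hs, H.dchart_verticalPart hs]

end IsChartOfCongruence

end ONeill

end

/-! ### The theorem. -/

theorem mainTheorem6 {n : ℕ} (hn : 3 ≤ n) {M : Type*} [TopologicalSpace M] [T2Space M]
    [SecondCountableTopology M] [ConnectedSpace M]
    [ChartedSpace (EuclideanSpace ℝ (Fin n)) M] [IsManifold (𝓡 n) ∞ M]
    (g : LorentzMetric n M) (K : TimelikeField g) :
    (∀ E₁ E₂ : ∀ v : nullCongruence g K, TangentSpace (𝓡 (2 * (n - 1))) v,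
      IsSmoothField (𝓡 (2 * (n - 1))) E₁ → IsSmoothField (𝓡 (2 * (n - 1))) E₂ →
        ∀ v, oneillA (𝓡 (2 * (n - 1))) (𝓡 n) (congruenceMetric g K) (congruenceProj g K)
          E₁ E₂ v = 0) ↔
      IsFlatMetric (𝓡 n) g.tensor := by
  have hF : ∀ (D : CongruenceChart (EuclideanSpace ℝ (Fin n))
      (EuclideanSpace ℝ (Fin (2 * (n - 1))))) (v : nullCongruence g K), IsChartOfCongruence D v →
      D.F (chartAt (EuclideanSpace ℝ (Fin (2 * (n - 1)))) v v)
          = chartAt (EuclideanSpace ℝ (Fin n)) (v : TangentBundle (𝓡 n) M).proj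
            (v : TangentBundle (𝓡 n) M).proj ∧
        D.W (chartAt (EuclideanSpace ℝ (Fin (2 * (n - 1)))) v v)
          = dchart (v : TangentBundle (𝓡 n) M).proj (v : TangentBundle (𝓡 n) M).proj
            (v : TangentBundle (𝓡 n) M).2 := fun D v H =>
    have h := H.tangentCoord_eq (mem_of_mem_nhds H.nhds)
    ⟨(congrArg Prod.fst h).symm, (congrArg Prod.snd h).symm⟩
  rw [LorentzMetric.isFlatMetric_iff]
  constructor
  · intro hA p
    have := t2Space_nullCongruence g K
    have hs := mem_chart_source (EuclideanSpace ℝ (Fin n)) p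
    have hz := (chartAt (EuclideanSpace ℝ (Fin n)) p).map_source hs
    have hm := g.isMetricOn_coordMetric p
    have hn' : 3 ≤ Module.finrank ℝ (EuclideanSpace ℝ (Fin n)) := by simpa using hn
    refine eq_zero_of_homothety_of_cyclic hn' (fun a b => ?_)
      (curvatureCoord_cyclic hm.isOpen hm.contDiffOn_christoffel
        (fun z hz => hm.christoffel_symm hz) hz)
    -- The curvature operator R(a,b) at p; its null eigenvectors are obtained from points of the
    -- congruence over p.
    let T : EuclideanSpace ℝ (Fin n) →ₗ[ℝ] EuclideanSpace ℝ (Fin n) :=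
      { toFun := curvatureCoord (g.coordΓ p) (chartAt (EuclideanSpace ℝ (Fin n)) p p) a b
        map_add' := fun c c' => by simp only [curvatureCoord, map_add]; abel
        map_smul' := fun r c => by
          simp only [curvatureCoord, map_smul, RingHom.id_apply, smul_sub, smul_add] }
    refine exists_eq_smul_of_null_eigenvectors hn'
      (b := g.coordMetric p (chartAt (EuclideanSpace ℝ (Fin n)) p p))
      (k := dchart p p (K.val p)) (hm.symm _ hz) ?_ ?_ T ?_
    · rw [← g.val_eq_coordMetric hs]
      exact K.timelike p
    · intro w hw hw0
      rw [← dchart_dchartSymm hs w, ← g.val_eq_coordMetric hs] at hw ⊢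
      refine g.pos_of_orthogonal (K.timelike p) hw fun h => hw0 ?_
      rw [← dchart_dchartSymm hs w, h, map_zero]
    · intro w hw hwk
      rw [← dchart_dchartSymm hs w, ← g.val_eq_coordMetric hs] at hw hwk
      let v : nullCongruence g K := ⟨⟨p, dchartSymm p p w⟩, hw, hwk⟩
      obtain ⟨D, H⟩ := exists_isChartOfCongruence hn v
      obtain ⟨hDF, hDW⟩ := hF D v H
      -- The projection is a submersion, so any two base vectors a, b are projections of values at v
      -- of smooth fields on the congruence, to which the vanishing of A applies.
      have hex : ∀ a : EuclideanSpace ℝ (Fin n),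
          ∃ E : ∀ v : nullCongruence g K, TangentSpace (𝓡 (2 * (n - 1))) v,
            IsSmoothField (𝓡 (2 * (n - 1))) E ∧
            D.dF (chartAt _ v v) (coordField v E (chartAt _ v v)) = a := by
        intro a
        obtain ⟨ξ, hξ⟩ := CongruenceChart.dF_surjective H.mem a
        have hv := mem_chart_source (EuclideanSpace ℝ (Fin (2 * (n - 1)))) v
        obtain ⟨ζ, hζ⟩ := (dchart_bijective hv).2 ξ
        obtain ⟨E, hE, rfl⟩ := exists_isSmoothField v ζ
        exact ⟨E, hE, by rw [coordField_chartAt hv, hζ, hξ]⟩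
      obtain ⟨E₁, hE₁, h1⟩ := hex a
      obtain ⟨E₂, hE₂, h2⟩ := hex b
      obtain ⟨X, Y, Q, w₁, w₂, hd, hX, hY, -, hX', hY', -, hw₂, hO⟩ :=
        H.exists_dchart_oneillA hE₁ hE₂
      rw [hA E₁ E₂ hE₁ hE₂ v, map_zero] at hO
      obtain ⟨μ, hμ⟩ := CongruenceChart.exists_curvature_eq_smul H.mem (hd _ H.mem).1
        (hd _ H.mem).2.1 hX hY hw₂ hO.symm
      refine ⟨μ, ?_⟩
      rw [hX' _ H.mem, hY' _ H.mem, h1, h2, hDF, hDW, CongruenceChart.Γ, H.G_eq] at hμ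
      change curvatureCoord (g.coordΓ p) (chartAt (EuclideanSpace ℝ (Fin n)) p p) a b
        (dchart p p (dchartSymm p p w)) = μ • dchart p p (dchartSymm p p w) at hμ
      rwa [dchart_dchartSymm hs] at hμ
  · intro hR E₁ E₂ hE₁ hE₂ v
    obtain ⟨D, H⟩ := exists_isChartOfCongruence hn v
    obtain ⟨hDF, -⟩ := hF D v H
    obtain ⟨X, Y, Q, w₁, w₂, hd, hX, hY, hQ, -, -, hw₁, hw₂, hO⟩ :=
      H.exists_dchart_oneillA hE₁ hE₂
    rw [CongruenceChart.oneill_eq_zero H.mem (hd _ H.mem).1 (hd _ H.mem).2.1 (hd _ H.mem).2.2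
      hX hY hQ (fun a b => by rw [hDF, CongruenceChart.Γ, H.G_eq]; exact hR _ _ _ _) hw₁ hw₂] at hO
    exact (map_eq_zero_iff _ (dchart_bijective
      (mem_chart_source (EuclideanSpace ℝ (Fin (2 * (n - 1)))) v)).1).1 hO
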